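/- **Setting.** Let $d,\nu\ge1$, $\mathbb T=\mathbb R/2\pi\mathbb Z$, and let $V:\mathbb T^d\to\mathbb R$ be continuous with $\mathrm{Ker}(-\Delta+V)=\{0\}$ in $L^2(\mathbb T^d)$. For integer vectors, $|\cdot|$ is the max-norm and $\|\cdot\|$ the Euclidean norm. Let $m$ be the average of $V$, $V_0=V-m$, and $\Lambda=[1/2,3/2]$. Fix a real $\tau\ge d+\nu+3$. *The length $L_0$ and the sets $\mathcal Q_M$.* Let $n^-$ be the number of negative eigenvalues of $-\Delta+V$ (with multiplicity), $\mu_1\le\mu_2\le\dots$ its eigenvalues, and $\beta_0=\min\{|\mu_{n^-}|/2,\ \mu_{n^-+1}\}$ (just $\mu_1$ if $n^-=0$). For finite nonempty $B\subset\mathbb Z^d$ let $(-\Delta+V)_B$ be the compression of $-\Delta+V$ to $\mathrm{span}\{e^{ij\cdot x}:j\in B\}$, and $\partial B=\{j\in B: \mathrm d(j,\mathbb Z^d\setminus B)=1\}$ ($\mathrm d$ is the max-norm distance). A number $L_0\in\mathbb N$ is called *admissible* if for all finite nonempty $B$ with $\mathrm d(0,\partial B)\ge L_0$: (1) if $\{|j|\le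 L_0-1\}\cap B=\emptyset$, then $(-\Delta+V)_B\ge\beta_0 I$; (2) if $\{|j|\le L_0\}\subset B$, then $(-\Delta+V)_B$ has exactly $n^-$ negative eigenvalues (with multiplicity), all $\le-\beta_0$, and all its other eigenvalues are $\ge\beta_0$. Set $\mathcal Q_M=\{j\in\mathbb Z^d:\mathrm d(0,\partial(j+[-M,M]^d))<L_0\}$. *The matrices.* Let $\bar\omega\in\mathbb R^\nu$ with $|\bar\omega|\le1$ (max-norm), $0\le\varepsilon<\varepsilon_0$, and let $\lambda\mapsto g(\lambda,\cdot)$ be a $C^1$ map from $\Lambda$ to the real continuous functions on $\mathbb T^\nu\times\mathbb T^d$ with the sup-norm (in the application $g=\partial_uf(\varphi,x,u(\varphi,x))$ with $u=u(\varepsilon,\lambda)$). Let $T_1(\lambda)$ and $\partial_\lambda T_1(\lambda)$ be the infinite matrices, in the basis $e^{i(l\cdot\varphi+j\cdot x)}$, $(l,j)\in\mathbb Z^\nu\times\mathbb Z^d$, of the multiplications by $g(\lambda,\cdot)$ and $\partial_\lambda g(\lambda,\cdot)$, and $T_2$ that of the multiplication by $V_0(x)$. Put $$A(\varepsilon,\lambda,\theta)=\mathrm{diag}_{(l,j)}\big(-(\lambda\bar\omega\cdot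 l+\theta)^2+\|j\|^2+m\big)+T_2-\varepsilon T_1(\lambda),$$ and let $A_{M,j_0}(\varepsilon,\lambda,\theta)$ be its restriction to $|l|\le M$, $|j-j_0|\le M$. Let $\|\cdot\|_0$ be the $\ell^2$-operator norm, with $\|A^{-1}\|_0=\infty$ if $A$ is not invertible. Define $$B^0_M(j_0;\lambda)=\{\theta\in\mathbb R:\ \|A_{M,j_0}^{-1}(\varepsilon,\lambda,\theta)\|_0>M^\tau\},$$ and let $\mathcal G^0_N$ be the set of $\lambda\in\Lambda$ such that for both $M\in\{N,N-2L_0\}$ and all $j_0\in\mathbb Z^d\setminus\mathcal Q_M$, the set $B^0_M(j_0;\lambda)$ is covered by $N^{2d+\nu+3}$ intervals of length at most $N^{-\tau}$. **Proposition.** An admissible $L_0$ exists. Moreover, for every admissible $L_0$ there are constants $c,C>0$ and $N_0\in\mathbb N$, depending only on $V,d,\nu,\tau,L_0$, such that for all $\bar\omega,\varepsilon_0,\varepsilon,g$ as above with $$\varepsilon_0\big(\|T_1(\lambda)\|_0+\|\partial_\lambda T_1(\lambda)\|_0\big)\le c\qquad\text{for all }\lambda\in\Lambda,$$ and for all integers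 $N\ge N_0$, the set $\mathcal B^0_N=\Lambda\setminus\mathcal G^0_N$ has Lebesgue measure at most $C\,N^{-1}$. -/

import Mathlib

open scoped ENNReal
open MeasureTheory

namespace QuasiPeriodicWave

noncomputable section

/-!
Conventions.  The torus `𝕋ᵏ = (ℝ / 2πℤ)ᵏ` is parametrised by `UnitAddTorus (Fin k)` through
`x = 2π t`: a function `V` on `𝕋ᵈ` is given as `t ↦ V (2π t)`, the exponential `e^{i j·x}` becomes
`UnitAddTorus.mFourier j`, and the (normalised) Fourier coefficients are unchanged.  The Laplacian
is the one of `(ℝ / 2πℤ)ᵈ`, that is `-Δ e^{i j·x} = ‖j‖² e^{i j·x}`.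

For an integer vector `j`, the norm `‖j‖` of Lean is the sup-norm `|j| = max_k |j_k|` and `sqNorm j`
is the square of the Euclidean norm.
-/

/-- Square of the Euclidean norm of an integer vector. -/
def sqNorm {d : ℕ} (j : Fin d → ℤ) : ℝ := ∑ k, (j k : ℝ) ^ 2

/-- The normalised Haar measure on the torus, `(2π)⁻ᵏ dx` in the variable `x`. -/
def torusMeasure (d : ℕ) : Measure (UnitAddTorus (Fin d)) :=
  Measure.pi fun _ => AddCircle.haarAddCircle

/-- Fourier coefficients of a continuous real function on a torus. -/
def coeff {ι : Type} [Fintype ι] (g : C(UnitAddTorus ι, ℝ)) (n : ι → ℤ) : ℂ :=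
  UnitAddTorus.mFourierCoeff (fun x => (g x : ℂ)) n

theorem coeff_neg {ι : Type} [Fintype ι] (g : C(UnitAddTorus ι, ℝ)) (n : ι → ℤ) :
    coeff g (-n) = star (coeff g n) := by
  unfold coeff UnitAddTorus.mFourierCoeff
  rw [RCLike.star_def, ← integral_conj]
  congr 1
  funext x
  simp [UnitAddTorus.mFourier_neg]

/-! ### The operator `-Δ + V` on `L²(𝕋ᵈ)` -/

/-- `u ∈ L²(𝕋ᵈ)` satisfies `(-Δ + V) u = μ u`.  The equation is read on Fourier coefficients, i.e.
in the sense of distributions; as `V` is bounded, such a `u` lies automatically in `H²`, which is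
the domain of the self-adjoint operator `-Δ + V`. -/
def SolvesEigenEq {d : ℕ} (V : C(UnitAddTorus (Fin d), ℝ)) (μ : ℝ)
    (u : Lp ℂ 2 (torusMeasure d)) : Prop :=
  ∀ j : Fin d → ℤ,
    (sqNorm j : ℂ) * UnitAddTorus.mFourierCoeff (fun x => u x) j
      + UnitAddTorus.mFourierCoeff (fun x => (V x : ℂ) * u x) j
      = (μ : ℂ) * UnitAddTorus.mFourierCoeff (fun x => u x) j

/-- `Ker (-Δ + V) = 0`. -/
def TrivialKernel {d : ℕ} (V : C(UnitAddTorus (Fin d), ℝ)) : Prop :=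
  ∀ u : Lp ℂ 2 (torusMeasure d), SolvesEigenEq V 0 u → u = 0

/-- The set of eigenvalues of `-Δ + V`. -/
def eigenvalueSet {d : ℕ} (V : C(UnitAddTorus (Fin d), ℝ)) : Set ℝ :=
  {μ | ∃ u : Lp ℂ 2 (torusMeasure d), u ≠ 0 ∧ SolvesEigenEq V μ u}

/-- `n⁻`: the number of negative eigenvalues of `-Δ + V`, counted with multiplicity. -/
def negCount {d : ℕ} (V : C(UnitAddTorus (Fin d), ℝ)) : ℕ :=
  Module.finrank ℂ
    (Submodule.span ℂ {u : Lp ℂ 2 (torusMeasure d) | ∃ μ < 0, SolvesEigenEq V μ u})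

/-- `β₀ = min {|μ_{n⁻}| / 2, μ_{n⁻+1}}`, where `μ_{n⁻}` is the largest negative and `μ_{n⁻+1}` the
smallest positive eigenvalue of `-Δ + V` (only `μ_1` counts if there is no negative one). -/
def gapConst {d : ℕ} (V : C(UnitAddTorus (Fin d), ℝ)) : ℝ :=
  sInf ({b | ∃ μ ∈ eigenvalueSet V, μ < 0 ∧ b = |μ| / 2} ∪ {b | b ∈ eigenvalueSet V ∧ 0 < b})

/-- The matrix of `(-Δ + V)_B = Π_B (-Δ + V)|_{E_B}` in the basis `e^{i j·x}`, `j ∈ B`. -/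
def restrictedMatrix {d : ℕ} (V : C(UnitAddTorus (Fin d), ℝ)) (B : Finset (Fin d → ℤ)) :
    Matrix B B ℂ :=
  Matrix.diagonal (fun j => (sqNorm j.1 : ℂ)) + Matrix.of fun j j' => coeff V (j.1 - j'.1)

theorem restrictedMatrix_isHermitian {d : ℕ} (V : C(UnitAddTorus (Fin d), ℝ))
    (B : Finset (Fin d → ℤ)) : (restrictedMatrix V B).IsHermitian := by
  unfold restrictedMatrix
  refine Matrix.IsHermitian.add ?_ ?_
  · refine Matrix.isHermitian_diagonal_of_self_adjoint _ ?_
    funext j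
    simp
  · ext j j'
    simp only [Matrix.conjTranspose_apply, Matrix.of_apply]
    rw [← coeff_neg, neg_sub]

/-! ### Boxes, their boundary, and the sites close to the origin -/

/-- `∂B = {j ∈ B : d(j, ℤᵈ \ B) = 1}`, for the sup-norm distance. -/
def innerBoundary {d : ℕ} (B : Finset (Fin d → ℤ)) : Set (Fin d → ℤ) :=
  {j | j ∈ B ∧ ∃ k, k ∉ B ∧ ‖j - k‖ = 1}

/-- The box `{j : |j - j₀| ≤ M}` in `ℤᵏ`. -/
def box {k : ℕ} (M : ℕ) (j₀ : Fin k → ℤ) : Finset (Fin k → ℤ) :=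
  Finset.Icc (fun a => j₀ a - M) (fun a => j₀ a + M)

/-- The defining property of the length `L₀`.  For all finite non-empty `B ⊂ ℤᵈ` with
`d(0, ∂B) ≥ L₀`: if `{|j| ≤ L₀ - 1}` is disjoint from `B` then `(-Δ + V)_B ≥ β₀ I`; if
`{|j| ≤ L₀}` is contained in `B` then `(-Δ + V)_B` has exactly `n⁻` negative eigenvalues (with
multiplicity), all of them `≤ -β₀`, and all its other eigenvalues are `≥ β₀`. -/
def IsSpectralLength {d : ℕ} (V : C(UnitAddTorus (Fin d), ℝ)) (L₀ : ℕ) : Prop :=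
  ∀ B : Finset (Fin d → ℤ), B.Nonempty → (∀ j ∈ innerBoundary B, (L₀ : ℝ) ≤ ‖j‖) →
    ((∀ j : Fin d → ℤ, ‖j‖ ≤ (L₀ : ℝ) - 1 → j ∉ B) →
      ∀ a, gapConst V ≤ (restrictedMatrix_isHermitian V B).eigenvalues a) ∧
    ((∀ j : Fin d → ℤ, ‖j‖ ≤ (L₀ : ℝ) → j ∈ B) →
      (Finset.univ.filter
        fun a => (restrictedMatrix_isHermitian V B).eigenvalues a < 0).card = negCount V ∧
      ∀ a, (restrictedMatrix_isHermitian V B).eigenvalues a ≤ -gapConst V ∨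
        gapConst V ≤ (restrictedMatrix_isHermitian V B).eigenvalues a)

/-- `𝒬_M = {j ∈ ℤᵈ : d(0, ∂(j + [-M, M]ᵈ)) < L₀}`. -/
def nearOrigin (d L₀ M : ℕ) : Set (Fin d → ℤ) :=
  {j | ∃ k ∈ innerBoundary (box M j), ‖k‖ < (L₀ : ℝ)}

/-! ### The linearized operator in the Fourier basis -/

/-- The index set `ℤᵇ = ℤ^ν × ℤᵈ`, with elements `i = (l, j)`. -/
abbrev Site (ν d : ℕ) : Type := (Fin ν → ℤ) × (Fin d → ℤ)

/-- The torus `𝕋^ν × 𝕋ᵈ`, with variables `(φ, x)`. -/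
abbrev SpaceTime (ν d : ℕ) : Type := UnitAddTorus (Fin ν ⊕ Fin d)

/-- The Töplitz matrix `(ĝ_{i - i'})` representing the multiplication by `g(φ, x)`. -/
def multMatrix {ν d : ℕ} (g : C(SpaceTime ν d, ℝ)) : Matrix (Site ν d) (Site ν d) ℂ :=
  Matrix.of fun i i' => coeff g (Sum.elim (i.1 - i'.1) (i.2 - i'.2))

/-- The average `m` of `V`. -/
def average {d : ℕ} (V : C(UnitAddTorus (Fin d), ℝ)) : ℝ := ∫ x, V x ∂(torusMeasure d)

/-- The matrix `T₂` of the multiplication by `V₀(x) = V(x) - m`, acting on functions of `(φ, x)`. -/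
def potentialMatrix (ν : ℕ) {d : ℕ} (V : C(UnitAddTorus (Fin d), ℝ)) :
    Matrix (Site ν d) (Site ν d) ℂ :=
  Matrix.of fun i i' =>
    if i.1 = i'.1 then coeff (V - ContinuousMap.const _ (average V)) (i.2 - i'.2) else 0

/-- The diagonal matrix `D(λ, θ)` with entries `-(λ ω̄·l + θ)² + ‖j‖² + m`. -/
def diagMatrix {ν d : ℕ} (V : C(UnitAddTorus (Fin d), ℝ)) (ω : Fin ν → ℝ) (lam θ : ℝ) :
    Matrix (Site ν d) (Site ν d) ℂ :=
  Matrix.diagonal fun i =>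
    ((-(lam * (∑ a, ω a * (i.1 a : ℝ)) + θ) ^ 2 + sqNorm i.2 + average V : ℝ) : ℂ)

/-- `A(ε, λ, θ) = D(λ, θ) + T₂ - ε T₁(λ)`, where `T₁(λ)` is the multiplication by `g λ`. -/
def fullMatrix {ν d : ℕ} (V : C(UnitAddTorus (Fin d), ℝ)) (ω : Fin ν → ℝ) (ε : ℝ)
    (g : ℝ → C(SpaceTime ν d, ℝ)) (lam θ : ℝ) : Matrix (Site ν d) (Site ν d) ℂ :=
  diagMatrix V ω lam θ + (potentialMatrix ν V - (ε : ℂ) • multMatrix (g lam))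

/-- The restriction of an infinite matrix to a finite set of sites. -/
def restrict {ν d : ℕ} (A : Matrix (Site ν d) (Site ν d) ℂ) (E : Finset (Site ν d)) :
    Matrix E E ℂ :=
  A.submatrix (fun i => i.1) (fun i => i.1)

/-- `A_{M,j₀}`: the restriction of `A` to the sites with `|l| ≤ M`, `|j - j₀| ≤ M`. -/
def centeredMatrix {ν d : ℕ} (A : Matrix (Site ν d) (Site ν d) ℂ) (M : ℕ) (j₀ : Fin d → ℤ) :
    Matrix (box M (0 : Fin ν → ℤ) ×ˢ box M j₀ : Finset (Site ν d))
      (box M (0 : Fin ν → ℤ) ×ˢ box M j₀ : Finset (Site ν d)) ℂ :=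
  restrict A (box M (0 : Fin ν → ℤ) ×ˢ box M j₀)

/-- The `L²`-operator norm `‖·‖₀` of a finite square matrix. -/
def opNorm {n : Type} [Fintype n] [DecidableEq n] (A : Matrix n n ℂ) : ℝ≥0∞ :=
  ENNReal.ofReal ‖Matrix.toEuclideanCLM (n := n) (𝕜 := ℂ) A‖

open Classical in
/-- `‖A⁻¹‖₀`, equal to `∞` when `A` is not invertible. -/
def invNorm {n : Type} [Fintype n] [DecidableEq n] (A : Matrix n n ℂ) : ℝ≥0∞ :=
  if IsUnit A then opNorm A⁻¹ else ⊤

/-- The `L²`-operator norm `‖·‖₀` of an infinite matrix (`∞` if it is unbounded on `ℓ²`), as the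
supremum of the norms of its finite restrictions. -/
def opNormInf {ν d : ℕ} (T : Matrix (Site ν d) (Site ν d) ℂ) : ℝ≥0∞ :=
  ⨆ E : Finset (Site ν d), opNorm (restrict T E)

/-! ### Bad sets and the complexity condition -/

/-- `B⁰_M(j₀; λ) = {θ ∈ ℝ : ‖A_{M,j₀}(ε, λ, θ)⁻¹‖₀ > M^τ}`. -/
def badSet {ν d : ℕ} (V : C(UnitAddTorus (Fin d), ℝ)) (τ : ℝ) (ω : Fin ν → ℝ) (ε : ℝ)
    (g : ℝ → C(SpaceTime ν d, ℝ)) (M : ℕ) (j₀ : Fin d → ℤ) (lam : ℝ) : Set ℝ :=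
  {θ | ENNReal.ofReal ((M : ℝ) ^ τ) < invNorm (centeredMatrix (fullMatrix V ω ε g lam θ) M j₀)}

/-- `S` is covered by `K` intervals of length at most `r`. -/
def CoveredByIntervals (S : Set ℝ) (K : ℕ) (r : ℝ) : Prop :=
  ∃ I : Fin K → Set ℝ, (∀ q, (I q).OrdConnected ∧ volume (I q) ≤ ENNReal.ofReal r) ∧ S ⊆ ⋃ q, I q

/-- The parameter interval `Λ = [1/2, 3/2]`. -/
def Lam : Set ℝ := Set.Icc (1 / 2) (3 / 2)

/-- `𝒢⁰_N`: the `λ ∈ Λ` such that, for `M ∈ {N, N - 2 L₀}` and all `j₀ ∉ 𝒬_M`, the bad set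
`B⁰_M(j₀; λ)` is covered by `N^{2d+ν+3}` intervals of length at most `N^{-τ}`. -/
def goodParams {ν d : ℕ} (V : C(UnitAddTorus (Fin d), ℝ)) (L₀ : ℕ) (τ : ℝ) (ω : Fin ν → ℝ)
    (ε : ℝ) (g : ℝ → C(SpaceTime ν d, ℝ)) (N : ℕ) : Set ℝ :=
  {lam | lam ∈ Lam ∧ ∀ M ∈ ({N, N - 2 * L₀} : Set ℕ), ∀ j₀ : Fin d → ℤ, j₀ ∉ nearOrigin d L₀ M →
    CoveredByIntervals (badSet V τ ω ε g M j₀ lam) (N ^ (2 * d + ν + 3)) ((N : ℝ) ^ (-τ))}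

end

end QuasiPeriodicWave

open QuasiPeriodicWave

namespace QuasiPeriodicWave

noncomputable section

/-! ### Hermitian operators in finite dimension -/

/-- A vector `v ≠ 0` with `‖A v‖ ≤ α ‖v‖` exists. -/
def HasApproxKernel {E : Type*} [NormedAddCommGroup E] [NormedSpace ℂ E] (A : E →L[ℂ] E)
    (α : ℝ) : Prop :=
  ∃ v : E, v ≠ 0 ∧ ‖A v‖ ≤ α * ‖v‖

section FiniteDim

variable {E : Type*} [NormedAddCommGroup E] [InnerProductSpace ℂ E]

/-- The real quadratic form of an operator. -/
def quadForm (A : E →L[ℂ] E) (v : E) : ℝ := (inner ℂ (A v) v).re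

theorem quadForm_add (A B : E →L[ℂ] E) (v : E) :
    quadForm (A + B) v = quadForm A v + quadForm B v := by
  simp [quadForm]

theorem quadForm_sub (A B : E →L[ℂ] E) (v : E) :
    quadForm (A - B) v = quadForm A v - quadForm B v := by
  simp [quadForm]

theorem quadForm_neg (A : E →L[ℂ] E) (v : E) : quadForm (-A) v = -quadForm A v := by
  simp [quadForm]

theorem abs_quadForm_le (A : E →L[ℂ] E) (v : E) : |quadForm A v| ≤ ‖A‖ * ‖v‖ ^ 2 := by
  calc |quadForm A v| ≤ ‖inner ℂ (A v) v‖ := Complex.abs_re_le_norm _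
    _ ≤ ‖A v‖ * ‖v‖ := norm_inner_le_norm _ _
    _ ≤ ‖A‖ * ‖v‖ * ‖v‖ := by gcongr; exact A.le_opNorm v
    _ = ‖A‖ * ‖v‖ ^ 2 := by ring

variable {κ : Type*} [Fintype κ]

theorem inner_eigenbasis (A : E →L[ℂ] E) (hA : (A : E →ₗ[ℂ] E).IsSymmetric)
    (e : OrthonormalBasis κ ℂ E) (ev : κ → ℝ) (he : ∀ i, A (e i) = (ev i : ℂ) • e i) (v : E)
    (i : κ) : inner ℂ (e i) (A v) = ev i * inner ℂ (e i) v := by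
  have := hA (e i) v
  simp only [ContinuousLinearMap.coe_coe, he, inner_smul_left, Complex.conj_ofReal] at this
  exact this.symm

theorem quadForm_eigenbasis (A : E →L[ℂ] E) (hA : (A : E →ₗ[ℂ] E).IsSymmetric)
    (e : OrthonormalBasis κ ℂ E) (ev : κ → ℝ) (he : ∀ i, A (e i) = (ev i : ℂ) • e i) (v : E) :
    quadForm A v = ∑ i, ev i * ‖inner ℂ (e i) v‖ ^ 2 := by
  rw [quadForm, ← e.sum_inner_mul_inner, Complex.re_sum]
  refine Finset.sum_congr rfl fun i _ => ?_
  rw [← inner_conj_symm, inner_eigenbasis A hA e ev he, map_mul, Complex.conj_ofReal, mul_assoc,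
    Complex.re_ofReal_mul, ← Complex.normSq_eq_conj_mul_self, Complex.ofReal_re,
    Complex.normSq_eq_norm_sq]

theorem norm_sq_eigenbasis (e : OrthonormalBasis κ ℂ E) (v : E) :
    ‖v‖ ^ 2 = ∑ i, ‖inner ℂ (e i) v‖ ^ 2 := (e.sum_sq_norm_inner_right v).symm

theorem norm_apply_sq_eigenbasis (A : E →L[ℂ] E) (hA : (A : E →ₗ[ℂ] E).IsSymmetric)
    (e : OrthonormalBasis κ ℂ E) (ev : κ → ℝ) (he : ∀ i, A (e i) = (ev i : ℂ) • e i) (v : E) :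
    ‖A v‖ ^ 2 = ∑ i, ev i ^ 2 * ‖inner ℂ (e i) v‖ ^ 2 := by
  rw [norm_sq_eigenbasis e]
  refine Finset.sum_congr rfl fun i _ => ?_
  rw [inner_eigenbasis A hA e ev he, norm_mul, mul_pow, Complex.norm_real, Real.norm_eq_abs, sq_abs]

theorem eq_zero_of_inner_eigenbasis (e : OrthonormalBasis κ ℂ E) {v : E}
    (h : ∀ i, inner ℂ (e i) v = 0) : v = 0 := by
  have := norm_sq_eigenbasis e v
  simpa [h] using this

theorem lt_quadForm_of_eigenbasis (A : E →L[ℂ] E) (hA : (A : E →ₗ[ℂ] E).IsSymmetric)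
    (e : OrthonormalBasis κ ℂ E) (ev : κ → ℝ) (he : ∀ i, A (e i) = (ev i : ℂ) • e i) {v : E}
    (hv : v ≠ 0) (c : ℝ) (h : ∀ i, inner ℂ (e i) v ≠ 0 → c < ev i) :
    c * ‖v‖ ^ 2 < quadForm A v := by
  rw [quadForm_eigenbasis A hA e ev he, norm_sq_eigenbasis e, Finset.mul_sum]
  obtain ⟨i, hi⟩ : ∃ i, inner ℂ (e i) v ≠ 0 := by
    by_contra! hc
    exact hv (eq_zero_of_inner_eigenbasis e hc)
  refine Finset.sum_lt_sum (fun j _ => ?_) ⟨i, Finset.mem_univ _, ?_⟩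
  · by_cases hj : inner ℂ (e j) v = 0
    · simp [hj]
    · exact mul_le_mul_of_nonneg_right (h j hj).le (by positivity)
  · exact mul_lt_mul_of_pos_right (h i hi) (by positivity)

theorem quadForm_lt_of_eigenbasis (A : E →L[ℂ] E) (hA : (A : E →ₗ[ℂ] E).IsSymmetric)
    (e : OrthonormalBasis κ ℂ E) (ev : κ → ℝ) (he : ∀ i, A (e i) = (ev i : ℂ) • e i) {v : E}
    (hv : v ≠ 0) (c : ℝ) (h : ∀ i, inner ℂ (e i) v ≠ 0 → ev i < c) :
    quadForm A v < c * ‖v‖ ^ 2 := by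
  have := lt_quadForm_of_eigenbasis (-A) (fun x y => by simpa using hA x y) e (fun i => -ev i)
    (fun i => by simp [he]) hv (-c) (fun i hi => neg_lt_neg (h i hi))
  rw [quadForm_neg] at this
  linarith

theorem quadForm_le_of_eigenbasis (A : E →L[ℂ] E) (hA : (A : E →ₗ[ℂ] E).IsSymmetric)
    (e : OrthonormalBasis κ ℂ E) (ev : κ → ℝ) (he : ∀ i, A (e i) = (ev i : ℂ) • e i) (v : E)
    (c : ℝ) (h : ∀ i, inner ℂ (e i) v ≠ 0 → c ≤ ev i) :
    c * ‖v‖ ^ 2 ≤ quadForm A v := by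
  rw [quadForm_eigenbasis A hA e ev he, norm_sq_eigenbasis e, Finset.mul_sum]
  refine Finset.sum_le_sum fun j _ => ?_
  by_cases hj : inner ℂ (e j) v = 0
  · simp [hj]
  · exact mul_le_mul_of_nonneg_right (h j hj) (by positivity)

theorem exists_abs_eigenvalue_le (A : E →L[ℂ] E) (hA : (A : E →ₗ[ℂ] E).IsSymmetric)
    (e : OrthonormalBasis κ ℂ E) (ev : κ → ℝ) (he : ∀ i, A (e i) = (ev i : ℂ) • e i) {α : ℝ}
    (hα : 0 ≤ α) (h : HasApproxKernel A α) : ∃ i, |ev i| ≤ α := by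
  obtain ⟨v, hv, hAv⟩ := h
  by_contra! hc
  obtain ⟨i, hi⟩ : ∃ i, inner ℂ (e i) v ≠ 0 := by
    by_contra! hc
    exact hv (eq_zero_of_inner_eigenbasis e hc)
  have hlt : ∀ j, α ^ 2 < ev j ^ 2 := fun j => by
    rw [← sq_abs (ev j)]
    exact pow_lt_pow_left₀ (hc j) hα two_ne_zero
  have h1 : α ^ 2 * ‖v‖ ^ 2 < ‖A v‖ ^ 2 := by
    rw [norm_apply_sq_eigenbasis A hA e ev he, norm_sq_eigenbasis e, Finset.mul_sum]
    refine Finset.sum_lt_sum (fun j _ => ?_) ⟨i, Finset.mem_univ _, ?_⟩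
    · exact mul_le_mul_of_nonneg_right (hlt j).le (by positivity)
    · exact mul_lt_mul_of_pos_right (hlt i) (by positivity)
  have h2 : ‖A v‖ ^ 2 ≤ (α * ‖v‖) ^ 2 := pow_le_pow_left₀ (norm_nonneg _) hAv 2
  rw [mul_pow] at h2
  linarith

/-- If a linear map is injective on the span of some of the vectors of an orthonormal basis, then
the number of these vectors is at most the dimension of the target. -/
theorem card_le_finrank_of_eigenbasis (e : OrthonormalBasis κ ℂ E) (p : κ → Prop)
    [DecidablePred p] {W : Type*} [AddCommGroup W] [Module ℂ W] [FiniteDimensional ℂ W]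
    (Φ : E →ₗ[ℂ] W)
    (h : ∀ v, (∀ i, inner ℂ (e i) v ≠ 0 → p i) → Φ v = 0 → v = 0) :
    (Finset.univ.filter p).card ≤ Module.finrank ℂ W := by
  classical
  have hli : LinearIndependent ℂ fun i : {i // p i} => Φ (e i) := by
    rw [Fintype.linearIndependent_iff]
    intro c hc i
    have hz : ∑ i : {i // p i}, c i • e i = 0 := by
      refine h _ (fun j hj => ?_) (by simpa [map_sum] using hc)
      by_contra hpj
      refine hj ?_
      rw [inner_sum]
      refine Finset.sum_eq_zero fun k _ => ?_
      rw [inner_smul_right, e.inner_eq_zero (fun hjk => hpj (by rw [hjk]; exact k.2)), mul_zero]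
    have hind := (e.orthonormal.linearIndependent).comp (fun i : {i // p i} => (i : κ))
      Subtype.val_injective
    exact (Fintype.linearIndependent_iff.mp hind) c hz i
  have := hli.fintype_card_le_finrank
  rwa [Fintype.card_subtype] at this

theorem finrank_le_card_of_injective {W : Type*} [AddCommGroup W] [Module ℂ W]
    (q : κ → Prop) [DecidablePred q] (e : OrthonormalBasis κ ℂ E)
    (Φ : W →ₗ[ℂ] E) (h : ∀ w, (∀ i, q i → inner ℂ (e i) (Φ w) = 0) → w = 0) :
    Module.finrank ℂ W ≤ (Finset.univ.filter q).card := by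
  classical
  let Ψ : W →ₗ[ℂ] ({i // q i} → ℂ) :=
    LinearMap.pi fun i => (innerSL ℂ (e i) : E →ₗ[ℂ] ℂ) ∘ₗ Φ
  have hΨ : Function.Injective Ψ := by
    rw [← LinearMap.ker_eq_bot, LinearMap.ker_eq_bot']
    intro w hw
    exact h w fun i hi => congrFun hw ⟨i, hi⟩
  have := LinearMap.finrank_le_finrank_of_injective hΨ
  rwa [Module.finrank_fintype_fun_eq_card, Fintype.card_subtype] at this

end FiniteDim

/-! ### Covering by intervals -/

theorem subset_Icc_of_sub_le {S : Set ℝ} {r : ℝ} (h : ∀ x ∈ S, ∀ y ∈ S, x - y ≤ r) :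
    ∃ I : Set ℝ, I.OrdConnected ∧ volume I ≤ ENNReal.ofReal r ∧ S ⊆ I := by
  rcases S.eq_empty_or_nonempty with rfl | ⟨x₀, hx₀⟩
  · exact ⟨∅, Set.ordConnected_empty, by simp, le_rfl⟩
  have hb : BddBelow S := ⟨x₀ - r, fun y hy => by linarith [h x₀ hx₀ y hy]⟩
  have ha : BddAbove S := ⟨x₀ + r, fun y hy => by linarith [h y hy x₀ hx₀]⟩
  refine ⟨Set.Icc (sInf S) (sSup S), Set.ordConnected_Icc, ?_, subset_Icc_csInf_csSup hb ha⟩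
  rw [Real.volume_Icc]
  refine ENNReal.ofReal_le_ofReal ?_
  have : sSup S ≤ sInf S + r := by
    refine csSup_le ⟨x₀, hx₀⟩ fun x hx => ?_
    have : x - r ≤ sInf S := le_csInf ⟨x₀, hx₀⟩ fun y hy => by linarith [h x hx y hy]
    linarith
  linarith

theorem CoveredByIntervals.mono {S S' : Set ℝ} {K K' : ℕ} {r r' : ℝ}
    (h : CoveredByIntervals S K r) (hS : S' ⊆ S) (hK : K ≤ K') (hr : r ≤ r') :
    CoveredByIntervals S' K' r' := by
  obtain ⟨I, hI, hcov⟩ := h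
  refine ⟨fun q => if hq : q.1 < K then I ⟨q.1, hq⟩ else ∅, fun q => ?_, ?_⟩
  · by_cases hq : q.1 < K
    · simp only [hq, dite_true]
      exact ⟨(hI _).1, (hI _).2.trans (ENNReal.ofReal_le_ofReal hr)⟩
    · simp only [hq, dite_false]
      exact ⟨Set.ordConnected_empty, by simp⟩
  · intro x hx
    obtain ⟨q, hq⟩ := Set.mem_iUnion.mp (hcov (hS hx))
    exact Set.mem_iUnion.mpr ⟨⟨q.1, q.2.trans_le hK⟩, by simpa [q.2] using hq⟩

theorem CoveredByIntervals.union {S S' : Set ℝ} {K K' : ℕ} {r : ℝ}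
    (h : CoveredByIntervals S K r) (h' : CoveredByIntervals S' K' r) :
    CoveredByIntervals (S ∪ S') (K + K') r := by
  obtain ⟨I, hI, hcov⟩ := h
  obtain ⟨I', hI', hcov'⟩ := h'
  refine ⟨Fin.append I I', fun q => ?_, ?_⟩
  · refine Fin.addCases (fun i => ?_) (fun i => ?_) q
    · rw [Fin.append_left]; exact hI i
    · rw [Fin.append_right]; exact hI' i
  · rintro x (hx | hx)
    · obtain ⟨q, hq⟩ := Set.mem_iUnion.mp (hcov hx)
      exact Set.mem_iUnion.mpr ⟨Fin.castAdd K' q, by rwa [Fin.append_left]⟩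
    · obtain ⟨q, hq⟩ := Set.mem_iUnion.mp (hcov' hx)
      exact Set.mem_iUnion.mpr ⟨Fin.natAdd K q, by rwa [Fin.append_right]⟩

theorem CoveredByIntervals.neg {S : Set ℝ} {K : ℕ} {r : ℝ} (h : CoveredByIntervals S K r) :
    CoveredByIntervals (-S) K r := by
  obtain ⟨I, hI, hcov⟩ := h
  refine ⟨fun q => -I q, fun q => ⟨?_, ?_⟩, ?_⟩
  · have := (hI q).1
    refine ⟨fun x hx y hy z hz => ?_⟩
    exact this.out (Set.mem_neg.mp hy) (Set.mem_neg.mp hx) ⟨neg_le_neg hz.2, neg_le_neg hz.1⟩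
  · rw [Measure.measure_neg]
    exact (hI q).2
  · intro x hx
    obtain ⟨q, hq⟩ := Set.mem_iUnion.mp (hcov (Set.mem_neg.mp hx))
    exact Set.mem_iUnion.mpr ⟨q, hq⟩

theorem CoveredByIntervals.volume_le {S : Set ℝ} {K : ℕ} {r : ℝ} (h : CoveredByIntervals S K r) :
    volume S ≤ K * ENNReal.ofReal r := by
  obtain ⟨I, hI, hcov⟩ := h
  calc volume S ≤ volume (⋃ q, I q) := measure_mono hcov
    _ ≤ ∑ q, volume (I q) := measure_iUnion_fintype_le _ _
    _ ≤ ∑ _q : Fin K, ENNReal.ofReal r := Finset.sum_le_sum fun q _ => (hI q).2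
    _ = K * ENNReal.ofReal r := by simp

theorem coveredByIntervals_of_index {S : Set ℝ} {n : ℕ} {r : ℝ} (k : ℝ → ℕ)
    (hk : ∀ t ∈ S, 1 ≤ k t ∧ k t ≤ n)
    (h : ∀ t ∈ S, ∀ t' ∈ S, k t = k t' → t' - t ≤ r) : CoveredByIntervals S n r := by
  have hex : ∀ q : Fin n, ∃ I : Set ℝ, I.OrdConnected ∧ volume I ≤ ENNReal.ofReal r ∧
      {t | t ∈ S ∧ k t = q + 1} ⊆ I := fun q =>
    subset_Icc_of_sub_le fun x hx y hy => h y hy.1 x hx.1 (hy.2.trans hx.2.symm)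
  choose I hI using hex
  refine ⟨I, fun q => ⟨(hI q).1, (hI q).2.1⟩, fun t ht => ?_⟩
  have := hk t ht
  exact Set.mem_iUnion.mpr ⟨⟨k t - 1, by omega⟩, (hI _).2.2 ⟨ht, by simp; omega⟩⟩

/-- For a family of Hermitian operators which decreases at rate at least `β`, the parameters at
which an eigenvalue is at most `α` in absolute value form few short intervals. -/
theorem coveredByIntervals_of_quadForm_decreasing {E : Type*} [NormedAddCommGroup E]
    [InnerProductSpace ℂ E] [FiniteDimensional ℂ E] {S : Set ℝ} (F : ℝ → E →L[ℂ] E)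
    (hF : ∀ t ∈ S, (F t : E →ₗ[ℂ] E).IsSymmetric) {α β : ℝ} (hα : 0 ≤ α) (hβ : 0 < β)
    (hmono : ∀ t ∈ S, ∀ t' ∈ S, t < t' → ∀ v,
      quadForm (F t') v ≤ quadForm (F t) v - β * (t' - t) * ‖v‖ ^ 2) :
    CoveredByIntervals {t | t ∈ S ∧ HasApproxKernel (F t) α} (Module.finrank ℂ E)
      (2 * α / β) := by
  classical
  set n := Module.finrank ℂ E with hn
  have hex : ∀ t, ∃ (e : OrthonormalBasis (Fin n) ℂ E) (ev : Fin n → ℝ),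
      t ∈ S → ∀ i, F t (e i) = (ev i : ℂ) • e i := by
    intro t
    by_cases ht : t ∈ S
    · exact ⟨(hF t ht).eigenvectorBasis hn.symm, (hF t ht).eigenvalues hn.symm,
        fun _ i => (hF t ht).apply_eigenvectorBasis hn.symm i⟩
    · exact ⟨stdOrthonormalBasis ℂ E, 0, fun h => absurd h ht⟩
  choose e ev he using hex
  refine coveredByIntervals_of_index (fun t => (Finset.univ.filter fun i => -α ≤ ev t i).card)
    ?_ ?_
  · rintro t ⟨ht, hbad⟩
    obtain ⟨i, hi⟩ := exists_abs_eigenvalue_le (F t) (hF t ht) (e t) (ev t) (he t ht) hα hbad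
    refine ⟨Finset.card_pos.mpr ⟨i, by simpa using (abs_le.mp hi).1⟩, ?_⟩
    simpa using Finset.card_filter_le (Finset.univ : Finset (Fin n)) fun i => -α ≤ ev t i
  · rintro t ⟨ht, hbad⟩ t' ⟨ht', -⟩ hk
    by_contra! hlt
    have htt' : t < t' := by
      have : 0 ≤ 2 * α / β := by positivity
      linarith
    have hgap : 2 * α < β * (t' - t) := by
      rw [div_lt_iff₀ hβ] at hlt; linarith
    obtain ⟨i, hi⟩ := exists_abs_eigenvalue_le (F t) (hF t ht) (e t) (ev t) (he t ht) hα hbad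
    let Φ : E →ₗ[ℂ] ({i // α < ev t i} → ℂ) :=
      LinearMap.pi fun i => (innerSL ℂ (e t i) : E →ₗ[ℂ] ℂ)
    have h1 : (Finset.univ.filter fun i => -α ≤ ev t' i).card ≤
        Module.finrank ℂ ({i // α < ev t i} → ℂ) := by
      refine card_le_finrank_of_eigenbasis (e t') _ Φ fun v hv hΦ => ?_
      by_contra hv0
      have h2 := quadForm_le_of_eigenbasis (F t') (hF t' ht') (e t') (ev t') (he t' ht') v (-α) hv
      have h3 : quadForm (-F t) v ≥ -α * ‖v‖ ^ 2 := by
        refine quadForm_le_of_eigenbasis (-F t) (fun x y => by simpa using hF t ht x y) (e t)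
          (fun i => -ev t i) (fun i => by simp [he t ht]) v (-α) fun j hj => ?_
        by_contra! hc
        exact hj (congrFun hΦ ⟨j, by linarith⟩)
      rw [quadForm_neg] at h3
      have h4 := hmono t ht t' ht' htt' v
      have h5 : 0 < ‖v‖ ^ 2 := by positivity
      nlinarith [mul_lt_mul_of_pos_right hgap h5]
    rw [Module.finrank_fintype_fun_eq_card, Fintype.card_subtype] at h1
    have h2 : (Finset.univ.filter fun i => α < ev t i).card <
        (Finset.univ.filter fun i => -α ≤ ev t i).card := by
      refine Finset.card_lt_card (Finset.ssubset_iff_of_subset (fun j hj => ?_) |>.mpr ⟨i, ?_, ?_⟩)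
      · simp only [Finset.mem_filter, Finset.mem_univ, true_and] at hj ⊢
        linarith
      · simpa using (abs_le.mp hi).1
      · simpa using (abs_le.mp hi).2
    omega

/-! ### Diagonal operators in a Hilbert basis -/

section Spectral

variable {ι : Type*} {E : Type*} [NormedAddCommGroup E] [InnerProductSpace ℂ E]
  (b : HilbertBasis ι ℂ E)

theorem re_star_mul_ofReal_mul (r : ℝ) (z : ℂ) : (star z * (r * z)).re = r * ‖z‖ ^ 2 := by
  rw [mul_left_comm, Complex.star_def, ← Complex.normSq_eq_conj_mul_self, ← Complex.ofReal_mul,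
    Complex.ofReal_re, Complex.normSq_eq_norm_sq]

theorem hasSum_repr_sq (u : E) : HasSum (fun j => ‖b.repr u j‖ ^ 2) (‖u‖ ^ 2) := by
  have h := (Complex.hasSum_re (b.hasSum_inner_mul_inner u u))
  have h2 : (inner ℂ u u).re = ‖u‖ ^ 2 := by
    rw [inner_self_eq_norm_sq_to_K]; norm_cast
  rw [h2] at h
  refine h.congr_fun fun j => ?_
  rw [b.repr_apply_apply, ← inner_conj_symm u (b j), ← Complex.normSq_eq_conj_mul_self,
    Complex.ofReal_re, Complex.normSq_eq_norm_sq]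

theorem hasSum_repr_inner (u v : E) :
    HasSum (fun j => (star (b.repr u j) * b.repr v j).re) (inner ℂ u v).re := by
  refine (Complex.hasSum_re (b.hasSum_inner_mul_inner u v)).congr_fun fun j => ?_
  rw [b.repr_apply_apply, b.repr_apply_apply, Complex.star_def, inner_conj_symm]

theorem ext_repr {u v : E} (h : ∀ j, b.repr u j = b.repr v j) : u = v :=
  b.repr.injective (lp.ext (funext h))

theorem norm_le_of_repr_le {u v : E} {C : ℝ} (hC : 0 ≤ C)
    (h : ∀ j, ‖b.repr u j‖ ≤ C * ‖b.repr v j‖) : ‖u‖ ≤ C * ‖v‖ := by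
  refine le_of_sq_le_sq ?_ (by positivity)
  rw [mul_pow]
  refine hasSum_le (fun j => ?_) (hasSum_repr_sq b u) ((hasSum_repr_sq b v).mul_left (C ^ 2))
  rw [← mul_pow]
  exact pow_le_pow_left₀ (norm_nonneg _) (h j) 2

theorem exists_repr_eq (a : ι → ℂ) (v : E) {C : ℝ} (h : ∀ j, ‖a j‖ ≤ C * ‖b.repr v j‖) :
    ∃ u : E, ∀ j, b.repr u j = a j := by
  have hs : Summable fun j => ‖a j‖ ^ 2 := by
    refine Summable.of_nonneg_of_le (fun j => by positivity) (fun j => ?_)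
      ((hasSum_repr_sq b v).summable.mul_left (C ^ 2))
    rw [← mul_pow]
    exact pow_le_pow_left₀ (norm_nonneg _) (h j) 2
  have hm : Memℓp a 2 := memℓp_gen (by simpa using hs)
  exact ⟨b.repr.symm ⟨a, hm⟩, fun j => by simp⟩

theorem exists_diagonal (g : ι → ℝ) {C : ℝ} (hC : 0 ≤ C) (hg : ∀ j, |g j| ≤ C) :
    ∃ G : E →L[ℂ] E, (∀ u j, b.repr (G u) j = g j * b.repr u j) ∧ ‖G‖ ≤ C := by
  have hle : ∀ (u : E) j, ‖(g j : ℂ) * b.repr u j‖ ≤ C * ‖b.repr u j‖ := fun u j => by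
    rw [norm_mul, Complex.norm_real, Real.norm_eq_abs]
    exact mul_le_mul_of_nonneg_right (hg j) (norm_nonneg _)
  choose G hG using fun u => exists_repr_eq b (fun j => (g j : ℂ) * b.repr u j) u (hle u)
  let L : E →ₗ[ℂ] E :=
    { toFun := G
      map_add' := fun u v => ext_repr b fun j => by simp [hG, mul_add]
      map_smul' := fun c u => ext_repr b fun j => by simp [hG, mul_left_comm] }
  have hL : ∀ u, ‖L u‖ ≤ C * ‖u‖ := fun u =>
    norm_le_of_repr_le b hC fun j => by
      change ‖b.repr (G u) j‖ ≤ _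
      rw [hG]; exact hle u j
  exact ⟨L.mkContinuous C hL, hG, L.mkContinuous_norm_le hC hL⟩

theorem isCompactOperator_diagonal [CompleteSpace E] (g : ι → ℝ)
    (hg : Filter.Tendsto g Filter.cofinite (nhds 0))
    (G : E →L[ℂ] E) (hG : ∀ u j, b.repr (G u) j = g j * b.repr u j) : IsCompactOperator G := by
  classical
  let Gs : Finset ι → (E →L[ℂ] E) := fun s =>
    ∑ j ∈ s, (g j : ℂ) • (innerSL ℂ (b j)).smulRight (b j)
  have hGs : ∀ s u j, b.repr (Gs s u) j = if j ∈ s then g j * b.repr u j else 0 := by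
    intro s u j
    simp only [Gs, sum_apply, b.repr_apply_apply, inner_sum,
      smul_apply, ContinuousLinearMap.smulRight_apply, innerSL_apply_apply,
      inner_smul_right, orthonormal_iff_ite.mp b.orthonormal, mul_ite, mul_one, mul_zero]
    rw [Finset.sum_ite_eq]
  refine isCompactOperator_of_tendsto (l := Filter.atTop) (F := Gs) ?_
    (Filter.Eventually.of_forall fun s => ?_)
  · rw [Metric.tendsto_nhds]
    intro ε hε
    have hfin : {j | ¬ |g j| < ε / 2}.Finite := by
      have := Metric.tendsto_nhds.mp hg (ε / 2) (by positivity)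
      simpa [Filter.eventually_cofinite] using this
    filter_upwards [Filter.eventually_ge_atTop hfin.toFinset] with s hs
    rw [dist_eq_norm]
    refine lt_of_le_of_lt (ContinuousLinearMap.opNorm_le_bound _ (half_pos hε).le fun u => ?_)
      (half_lt_self hε)
    refine norm_le_of_repr_le b (half_pos hε).le fun j => ?_
    rw [sub_apply, map_sub, lp.coeFn_sub, Pi.sub_apply, hGs, hG]
    by_cases hj : j ∈ s
    · simp only [hj, if_true, sub_self, norm_zero]; positivity
    · have hj' : |g j| < ε / 2 := by
        by_contra hc
        exact hj (hs (by simpa using hc))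
      simp only [hj, if_false, zero_sub, norm_neg, norm_mul, Complex.norm_real, Real.norm_eq_abs]
      exact mul_le_mul_of_nonneg_right hj'.le (norm_nonneg _)
  · have : Gs s ∈ compactOperator (RingHom.id ℂ) E E := by
      refine Submodule.sum_mem _ fun j _ => Submodule.smul_mem _ _ ?_
      change IsCompactOperator _
      have h1 : IsCompactOperator (innerSL ℂ (b j)) :=
        isCompactOperator_of_locallyCompactSpace_dom _
      have h2 := h1.clm_comp (ContinuousLinearMap.toSpanSingleton ℂ (b j))
      convert h2 using 1
      ext x
      simp
    exact this

/-! ### Operators with compact resolvent -/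

variable (w : ι → ℝ) (T : E →L[ℂ] E)

/-- `u` solves `(W + T) u = μ u` where `W` is diagonal with entries `w`. -/
def IsEig (μ : ℝ) (u : E) : Prop :=
  ∀ j, (w j : ℂ) * b.repr u j + b.repr (T u) j = μ * b.repr u j

/-- The span of the eigenvectors with negative eigenvalues. -/
def negSpace : Submodule ℂ E := Submodule.span ℂ {u | ∃ μ < 0, IsEig b w T μ u}

/-- The set of eigenvalues. -/
def eigSet : Set ℝ := {μ | ∃ u, u ≠ 0 ∧ IsEig b w T μ u}

/-- `min {|μ| / 2, μ'}` over the negative eigenvalues `μ` and the positive eigenvalues `μ'`. -/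
def spectralGap : ℝ :=
  sInf ({c | ∃ μ ∈ eigSet b w T, μ < 0 ∧ c = |μ| / 2} ∪ {c | c ∈ eigSet b w T ∧ 0 < c})

variable {b w T}

theorem spectralGap_le_of_neg {μ : ℝ} (hμ : μ ∈ eigSet b w T) (h : μ < 0) :
    spectralGap b w T ≤ -μ / 2 := by
  refine csInf_le ⟨0, ?_⟩ (Or.inl ⟨μ, hμ, h, by rw [abs_of_neg h]⟩)
  rintro c (⟨μ, -, -, rfl⟩ | ⟨-, h⟩)
  · positivity
  · exact h.le

theorem spectralGap_le_of_pos {μ : ℝ} (hμ : μ ∈ eigSet b w T) (h : 0 < μ) :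
    spectralGap b w T ≤ μ := by
  refine csInf_le ⟨0, ?_⟩ (Or.inr ⟨hμ, h⟩)
  rintro c (⟨μ, -, -, rfl⟩ | ⟨-, h⟩)
  · positivity
  · exact h.le

variable [CompleteSpace E]

theorem exists_resolvent (hw0 : ∀ j, 0 ≤ w j) (hw : Filter.Tendsto w Filter.cofinite Filter.atTop)
    (hT : (T : E →ₗ[ℂ] E).IsSymmetric) {σ : ℝ} (hσ : ‖T‖ < σ) :
    ∃ K : E →L[ℂ] E, IsCompactOperator K ∧ (K : E →ₗ[ℂ] E).IsSymmetric ∧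
      (∀ v, (σ - ‖T‖) * ‖K v‖ ^ 2 ≤ (inner ℂ v (K v)).re) ∧
      ∀ u v, K v = u ↔ ∀ j, ((w j : ℂ) + σ) * b.repr u j + b.repr (T u) j = b.repr v j := by
  have hσ0 : 0 < σ := (norm_nonneg T).trans_lt hσ
  have hpos : ∀ j, 0 < w j + σ := fun j => by linarith [hw0 j]
  have hne : ∀ j, (w j : ℂ) + σ ≠ 0 := fun j => by exact_mod_cast (hpos j).ne'
  set g : ι → ℝ := fun j => (w j + σ)⁻¹ with hg
  have hg0 : ∀ j, 0 < g j := fun j => inv_pos.mpr (hpos j)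
  have hgle : ∀ j, σ * g j ≤ 1 := fun j => by
    rw [hg]; simp only
    rw [← div_eq_mul_inv, div_le_one (hpos j)]; linarith [hw0 j]
  obtain ⟨G, hG, hGn⟩ := exists_diagonal b g (C := σ⁻¹) (by positivity) fun j => by
    rw [abs_of_pos (hg0 j), ← one_div, le_div_iff₀ hσ0, mul_comm]; exact hgle j
  have hgt : Filter.Tendsto g Filter.cofinite (nhds 0) :=
    tendsto_inv_atTop_zero.comp (Filter.tendsto_atTop_add_const_right _ _ hw)
  have hGc := isCompactOperator_diagonal b g hgt G hG
  have hGs : (G : E →ₗ[ℂ] E).IsSymmetric := by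
    intro x y
    simp only [ContinuousLinearMap.coe_coe]
    refine (b.hasSum_inner_mul_inner (G x) y).unique
      ((b.hasSum_inner_mul_inner x (G y)).congr_fun fun j => ?_)
    have h1 := hG x j
    have h2 := hG y j
    rw [b.repr_apply_apply, b.repr_apply_apply] at h1 h2
    rw [← inner_conj_symm, h1, h2, map_mul, Complex.conj_ofReal, inner_conj_symm]
    ring
  have hGpos : ∀ a, σ * ‖G a‖ ^ 2 ≤ (inner ℂ a (G a)).re := by
    intro a
    refine hasSum_le (fun j => ?_) ((hasSum_repr_sq b (G a)).mul_left σ)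
      (hasSum_repr_inner b a (G a))
    rw [hG, norm_mul, Complex.norm_real, Real.norm_eq_abs, mul_pow, sq_abs,
      re_star_mul_ofReal_mul, ← mul_assoc]
    refine mul_le_mul_of_nonneg_right ?_ (by positivity)
    calc σ * g j ^ 2 = (σ * g j) * g j := by ring
      _ ≤ 1 * g j := mul_le_mul_of_nonneg_right (hgle j) (hg0 j).le
      _ = g j := one_mul _
  have hGT : ‖-(G * T)‖ < 1 := by
    rw [norm_neg]
    calc ‖G * T‖ ≤ ‖G‖ * ‖T‖ := norm_mul_le _ _
      _ ≤ σ⁻¹ * ‖T‖ := by gcongr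
      _ < σ⁻¹ * σ := by gcongr
      _ = 1 := inv_mul_cancel₀ hσ0.ne'
  obtain ⟨S, hS⟩ := isUnit_one_sub_of_norm_lt_one hGT
  rw [sub_neg_eq_add] at hS
  set K : E →L[ℂ] E := (↑S⁻¹ : E →L[ℂ] E) * G with hK
  have hKiff : ∀ u v, K v = u ↔ u + G (T u) = G v := by
    intro u v
    have h1 : ∀ x, (S : E →L[ℂ] E) ((↑S⁻¹ : E →L[ℂ] E) x) = x := fun x => by
      rw [← mul_apply_eq_comp, Units.mul_inv]; rfl
    have h2 : ∀ x, (↑S⁻¹ : E →L[ℂ] E) ((S : E →L[ℂ] E) x) = x := fun x => by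
      rw [← mul_apply_eq_comp, Units.inv_mul]; rfl
    have h3 : (S : E →L[ℂ] E) u = u + G (T u) := by rw [hS]; rfl
    rw [← h3, hK, mul_apply_eq_comp]
    constructor
    · rintro rfl; exact h1 _
    · intro h; rw [← h, h2]
  have hKeq : ∀ v, K v = G (v - T (K v)) := fun v => by
    rw [map_sub, ← (hKiff (K v) v).mp rfl]; abel
  refine ⟨K, hGc.clm_comp (↑S⁻¹ : E →L[ℂ] E), fun x y => ?_, fun v => ?_, fun u v => ?_⟩
  · simp only [ContinuousLinearMap.coe_coe]
    have hTs := fun p q => hT p q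
    have hGs' := fun p q => hGs p q
    simp only [ContinuousLinearMap.coe_coe] at hTs hGs'
    have e1 : inner ℂ (K x) y = inner ℂ (x - T (K x)) (K y) + inner ℂ (T (K x)) (K y) := by
      conv_rhs => rw [hKeq y, ← hGs', ← hKeq x, ← hKeq y]
      rw [inner_sub_right, hTs]; ring
    rw [e1, ← inner_add_left, sub_add_cancel]
  · have h1 := hGpos (v - T (K v))
    rw [← hKeq v, inner_sub_left, Complex.sub_re] at h1
    have h2 : -(inner ℂ (T (K v)) (K v)).re ≤ ‖T‖ * ‖K v‖ ^ 2 :=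
      (neg_le_abs _).trans (abs_quadForm_le T (K v))
    linarith
  · rw [hKiff]
    constructor
    · intro h j
      have := congrArg (fun x => b.repr x j) h
      simp only [map_add, lp.coeFn_add, Pi.add_apply, hG, hg, Complex.ofReal_inv,
        Complex.ofReal_add] at this
      have hj := hne j
      field_simp at this
      linear_combination this
    · intro h
      refine ext_repr b fun j => ?_
      simp only [map_add, lp.coeFn_add, Pi.add_apply, hG, hg, Complex.ofReal_inv,
        Complex.ofReal_add]
      have hj := hne j
      field_simp
      linear_combination h j

end Spectral

section Spectral

variable {ι : Type*} {E : Type*} [NormedAddCommGroup E] [InnerProductSpace ℂ E]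
  {b : HilbertBasis ι ℂ E} {w : ι → ℝ} {T : E →L[ℂ] E}

theorem norm_apply_sq_le_of_nonneg (P : E →L[ℂ] E) (hP : (P : E →ₗ[ℂ] E).IsSymmetric)
    (h0 : ∀ x, 0 ≤ (inner ℂ x (P x)).re) (x : E) :
    ‖P x‖ ^ 2 ≤ ‖P‖ * (inner ℂ x (P x)).re := by
  rcases eq_or_ne (‖P‖) 0 with hn | hn
  · rw [norm_eq_zero] at hn
    simp [hn]
  have hpos : 0 < ‖P‖ := lt_of_le_of_ne (norm_nonneg _) hn.symm
  have h1 := h0 (x - ((‖P‖⁻¹ : ℝ) : ℂ) • P x)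
  have hs : inner ℂ x (P (P x)) = inner ℂ (P x) (P x) := (hP x (P x)).symm
  have hsq : (inner ℂ (P x) (P x)).re = ‖P x‖ ^ 2 := by
    rw [inner_self_eq_norm_sq_to_K]; norm_cast
  have h2 : (inner ℂ (P x) (P (P x))).re ≤ ‖P‖ * ‖P x‖ ^ 2 :=
    calc (inner ℂ (P x) (P (P x))).re ≤ ‖P x‖ * ‖P (P x)‖ := re_inner_le_norm (𝕜 := ℂ) _ _
      _ ≤ ‖P x‖ * (‖P‖ * ‖P x‖) := by gcongr; exact P.le_opNorm _
      _ = ‖P‖ * ‖P x‖ ^ 2 := by ring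
  simp only [map_sub, map_smul, inner_sub_left, inner_sub_right, inner_smul_left,
    inner_smul_right, hs, Complex.conj_ofReal, Complex.sub_re, Complex.re_ofReal_mul, hsq] at h1
  have h3 : ‖P‖⁻¹ * (‖P‖⁻¹ * (inner ℂ (P x) (P (P x))).re) ≤ ‖P‖⁻¹ * ‖P x‖ ^ 2 := by
    refine mul_le_mul_of_nonneg_left ?_ (by positivity)
    rw [inv_mul_le_iff₀ hpos]; exact h2
  have h4 : ‖P‖⁻¹ * ‖P x‖ ^ 2 ≤ (inner ℂ x (P x)).re := by linarith
  rwa [inv_mul_le_iff₀ hpos] at h4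

theorem isEig_iff {K : E →L[ℂ] E} {σ : ℝ}
    (hK : ∀ u v, K v = u ↔ ∀ j, ((w j : ℂ) + σ) * b.repr u j + b.repr (T u) j = b.repr v j)
    (μ : ℝ) (u : E) : IsEig b w T μ u ↔ ((μ + σ : ℝ) : ℂ) • K u = u := by
  rw [← map_smul, hK]
  refine forall_congr' fun j => ?_
  rw [map_smul, lp.coeFn_smul, Pi.smul_apply, smul_eq_mul, Complex.ofReal_add]
  constructor <;> intro h <;> linear_combination h

theorem le_of_isEig {K : E →L[ℂ] E} {σ : ℝ}
    (hpos : ∀ v, (σ - ‖T‖) * ‖K v‖ ^ 2 ≤ (inner ℂ v (K v)).re)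
    {m : ℝ} {u : E} (hu : u ≠ 0) (h : (m : ℂ) • K u = u) : σ - ‖T‖ ≤ m := by
  have hm : m ≠ 0 := fun h0 => hu (by rw [← h, h0]; simp)
  have hKu : K u ≠ 0 := fun h0 => hu (by rw [← h, h0]; simp)
  have h1 := hpos u
  have h2 : (inner ℂ u (K u)).re = m * ‖K u‖ ^ 2 := by
    nth_rewrite 1 [← h]
    rw [inner_smul_left, Complex.conj_ofReal, Complex.re_ofReal_mul, inner_self_eq_norm_sq_to_K]
    norm_cast
  rw [h2] at h1
  exact le_of_mul_le_mul_right h1 (by positivity)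

theorem exists_isEig_of_eigenvector {K : E →L[ℂ] E} {σ : ℝ}
    (hKs : (K : E →ₗ[ℂ] E).IsSymmetric)
    (hK : ∀ u v, K v = u ↔ ∀ j, ((w j : ℂ) + σ) * b.repr u j + b.repr (T u) j = b.repr v j)
    {κ : ℂ} {u : E} (hκ : κ ≠ 0) (hu : u ≠ 0) (h : K u = κ • u) :
    ∃ μ : ℝ, IsEig b w T μ u ∧ κ = ((μ + σ)⁻¹ : ℝ) := by
  have hev : Module.End.HasEigenvalue (K : E →ₗ[ℂ] E) κ :=
    Module.End.hasEigenvalue_of_hasEigenvector ⟨Module.End.mem_eigenspace_iff.mpr h, hu⟩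
  have hre : ((κ.re : ℝ) : ℂ) = κ := Complex.conj_eq_iff_re.mp (hKs.conj_eigenvalue_eq_self hev)
  refine ⟨κ.re⁻¹ - σ, ?_, ?_⟩
  · rw [isEig_iff hK, sub_add_cancel, h, smul_smul, Complex.ofReal_inv, hre,
      inv_mul_cancel₀ hκ, one_smul]
  · rw [sub_add_cancel, inv_inv, hre]

variable [CompleteSpace E]

theorem spectralGap_pos [Nontrivial E] (hw0 : ∀ j, 0 ≤ w j)
    (hw : Filter.Tendsto w Filter.cofinite Filter.atTop)
    (hT : (T : E →ₗ[ℂ] E).IsSymmetric) (hker : ∀ u, IsEig b w T 0 u → u = 0) :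
    0 < spectralGap b w T := by
  set σ : ℝ := ‖T‖ + 1 with hσ
  have hσ0 : 0 < σ := by positivity
  have hσT : ‖T‖ < σ := by linarith
  obtain ⟨K, hKc, hKs, hKpos, hK⟩ := exists_resolvent (b := b) hw0 hw hT hσT
  have hσc : ((σ : ℂ))⁻¹ ≠ 0 := inv_ne_zero (by exact_mod_cast hσ0.ne')
  have hres : (σ : ℂ)⁻¹ ∈ resolventSet ℂ K := by
    refine (hKc.hasEigenvalue_or_mem_resolventSet hσc).resolve_left fun hev => ?_
    obtain ⟨u, hu⟩ := hev.exists_hasEigenvector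
    have h1 := Module.End.mem_eigenspace_iff.mp hu.1
    refine hu.2 (hker u ((isEig_iff hK 0 u).mpr ?_))
    rw [ContinuousLinearMap.coe_coe] at h1
    rw [h1, smul_smul, zero_add, mul_inv_cancel₀ (by exact_mod_cast hσ0.ne'), one_smul]
  obtain ⟨r, hr, hball⟩ := Metric.isOpen_iff.mp (spectrum.isOpen_resolventSet (𝕜 := ℂ) K) _ hres
  have hlow : ∀ μ ∈ eigSet b w T, r * σ ≤ |μ| := by
    rintro μ ⟨u, hu, hμ⟩
    have h1 := (isEig_iff hK μ u).mp hμ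
    have h2 := le_of_isEig hKpos hu h1
    have hm : 1 ≤ μ + σ := by linarith
    have hmc : ((μ + σ : ℝ) : ℂ) ≠ 0 := by
      exact_mod_cast (by linarith : (0 : ℝ) < μ + σ).ne'
    have hKu : K u = ((μ + σ : ℝ) : ℂ)⁻¹ • u := by
      conv_rhs => rw [← h1]
      rw [smul_smul, inv_mul_cancel₀ hmc, one_smul]
    have hnot : ((μ + σ : ℝ) : ℂ)⁻¹ ∉ Metric.ball ((σ : ℂ)⁻¹) r := by
      intro hmem
      refine (hKc.hasEigenvalue_iff_mem_spectrum (inv_ne_zero hmc)).mp ?_ (hball hmem)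
      exact Module.End.hasEigenvalue_of_hasEigenvector ⟨Module.End.mem_eigenspace_iff.mpr hKu, hu⟩
    rw [Metric.mem_ball, not_lt, dist_eq_norm, ← Complex.ofReal_inv, ← Complex.ofReal_inv,
      ← Complex.ofReal_sub, Complex.norm_real, Real.norm_eq_abs] at hnot
    have h3 : (μ + σ)⁻¹ - σ⁻¹ = -μ / ((μ + σ) * σ) := by
      field_simp; ring
    rw [h3, abs_div, abs_neg, abs_of_pos (by positivity : 0 < (μ + σ) * σ),
      le_div_iff₀ (by positivity)] at hnot
    calc r * σ = r * (1 * σ) := by ring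
      _ ≤ r * ((μ + σ) * σ) := by gcongr
      _ ≤ |μ| := hnot
  have hne : (eigSet b w T).Nonempty := by
    by_contra hemp
    rw [Set.not_nonempty_iff_eq_empty] at hemp
    have hK0 : K = 0 := by
      rw [← ContinuousLinearMap.eq_zero_of_forall_hasEigenvalue_eq_zero hKc hKs]
      intro κ hκ
      by_contra hκ0
      obtain ⟨u, hu⟩ := hκ.exists_hasEigenvector
      obtain ⟨μ, hμ, -⟩ := exists_isEig_of_eigenvector hKs hK hκ0 hu.2
        (Module.End.mem_eigenspace_iff.mp hu.1)
      have : μ ∈ eigSet b w T := ⟨u, hu.2, hμ⟩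
      rw [hemp] at this
      exact this
    obtain ⟨v, hv⟩ := exists_ne (0 : E)
    refine hv (ext_repr b fun j => ?_)
    have := (hK 0 v).mp (by rw [hK0]; rfl) j
    simpa using this.symm
  refine lt_of_lt_of_le (by positivity : 0 < r * σ / 2) (le_csInf ?_ ?_)
  · obtain ⟨μ, hμ⟩ := hne
    have h1 : 0 < |μ| := (by positivity : 0 < r * σ).trans_le (hlow μ hμ)
    rcases lt_or_ge μ 0 with h | h
    · exact ⟨_, Or.inl ⟨μ, hμ, h, rfl⟩⟩
    · exact ⟨_, Or.inr ⟨hμ, by rwa [abs_of_nonneg h] at h1⟩⟩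
  · have hrs : 0 < r * σ := by positivity
    rintro c (⟨μ, hμ, -, rfl⟩ | ⟨hc, hc0⟩)
    · linarith [hlow μ hμ]
    · have := hlow c hc
      rw [abs_of_pos hc0] at this
      linarith

/-- Above the span of the negative eigenvectors, the quadratic form is at least the gap. -/
theorem spectralGap_mul_le_of_mem_orthogonal (hw0 : ∀ j, 0 ≤ w j)
    (hw : Filter.Tendsto w Filter.cofinite Filter.atTop)
    (hT : (T : E →ₗ[ℂ] E).IsSymmetric) (hker : ∀ u, IsEig b w T 0 u → u = 0)
    (hgap : 0 < spectralGap b w T)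
    {u h : E} (hu : u ∈ (negSpace b w T)ᗮ)
    (huh : ∀ j, (w j : ℂ) * b.repr u j + b.repr (T u) j = b.repr h j) :
    spectralGap b w T * ‖u‖ ^ 2 ≤ (inner ℂ h u).re := by
  set σ : ℝ := ‖T‖ + 1 with hσ
  have hσ0 : 0 < σ := by positivity
  have hσT : ‖T‖ < σ := by linarith
  obtain ⟨K, hKc, hKs, hKpos, hK⟩ := exists_resolvent (b := b) hw0 hw hT hσT
  set v : E := h + (σ : ℂ) • u with hv
  have hKv : K v = u := by
    rw [hK]
    intro j
    rw [hv, map_add, map_smul, lp.coeFn_add, Pi.add_apply, lp.coeFn_smul, Pi.smul_apply, ← huh j,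
      smul_eq_mul]
    ring
  have heigK : ∀ μ < 0, ∀ x, IsEig b w T μ x → x = 0 ∨
      ∃ m : ℝ, m ≠ 0 ∧ K x = (m : ℂ) • x := by
    intro μ _ x hx
    by_cases hx0 : x = 0
    · exact Or.inl hx0
    have h1 := (isEig_iff hK μ x).mp hx
    have h2 := le_of_isEig hKpos hx0 h1
    have hm : μ + σ ≠ 0 := by linarith
    refine Or.inr ⟨(μ + σ)⁻¹, inv_ne_zero hm, ?_⟩
    conv_rhs => rw [← h1]
    rw [smul_smul, ← Complex.ofReal_mul, inv_mul_cancel₀ hm, Complex.ofReal_one, one_smul]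
  have hmem : ∀ x : E, x ∈ (negSpace b w T)ᗮ ↔ ∀ μ < 0, ∀ y, IsEig b w T μ y →
      inner ℂ y x = 0 := by
    intro x
    rw [negSpace, Submodule.mem_orthogonal]
    constructor
    · intro hx μ hμ y hy
      exact hx y (Submodule.subset_span ⟨μ, hμ, hy⟩)
    · intro hx y hy
      refine Submodule.span_induction (p := fun y _ => inner ℂ y x = 0) ?_ (by simp) ?_ ?_ hy
      · rintro y ⟨μ, hμ, hy⟩; exact hx μ hμ y hy
      · intro y z _ _ hy hz; rw [inner_add_left, hy, hz, add_zero]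
      · intro c y _ hy; rw [inner_smul_left, hy, mul_zero]
  set Z : Submodule ℂ E := (negSpace b w T)ᗮ with hZ
  have hinv : ∀ x ∈ Z, (K : E →ₗ[ℂ] E) x ∈ Z := by
    intro x hx
    rw [hmem] at hx ⊢
    intro μ hμ y hy
    rw [← hKs y x]
    rcases heigK μ hμ y hy with rfl | ⟨m, -, hm⟩
    · simp
    · rw [ContinuousLinearMap.coe_coe, hm, inner_smul_left, hx μ hμ y hy, mul_zero]
  have hvZ : v ∈ Z := by
    rw [hmem] at hu ⊢
    intro μ hμ y hy
    rcases heigK μ hμ y hy with rfl | ⟨m, hm0, hm⟩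
    · simp
    · have h1 := hu μ hμ y hy
      have h2 := hKs y v
      simp only [ContinuousLinearMap.coe_coe, hKv, h1, hm, inner_smul_left,
        Complex.conj_ofReal] at h2
      exact (mul_eq_zero.mp h2).resolve_left (by exact_mod_cast hm0)
  let P : Z →L[ℂ] Z := K.restrict hinv
  have hPc : IsCompactOperator P := hKc.restrict' hinv
  have hPs : (P : Z →ₗ[ℂ] Z).IsSymmetric := hKs.restrict_invariant hinv
  have hP0 : ∀ x : Z, 0 ≤ (inner ℂ x (P x)).re := fun x => by
    refine le_trans ?_ (hKpos (x : E))
    have : 0 ≤ σ - ‖T‖ := by linarith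
    positivity
  have hPnorm : ‖P‖ * (spectralGap b w T + σ) ≤ 1 := by
    rcases subsingleton_or_nontrivial Z with hsub | hnt
    · have : P = 0 := Subsingleton.elim _ _
      simp [this]
    rcases eq_or_ne ‖P‖ 0 with hz | hz
    · simp [hz]
    have hsr := P.spectralRadius_eq_nnnorm hPs.isSelfAdjoint
    obtain ⟨κ, hκ, hκn⟩ := spectrum.exists_nnnorm_eq_spectralRadius P
    rw [hsr, ENNReal.coe_inj] at hκn
    have hκn' : ‖κ‖ = ‖P‖ := congrArg NNReal.toReal hκn
    have hκ0 : κ ≠ 0 := by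
      rw [← norm_ne_zero_iff, hκn']; exact hz
    obtain ⟨x, hx⟩ := ((hPc.hasEigenvalue_iff_mem_spectrum hκ0).mpr hκ).exists_hasEigenvector
    have hxe : K (x : E) = κ • (x : E) :=
      congrArg Subtype.val (Module.End.mem_eigenspace_iff.mp hx.1)
    have hx0 : (x : E) ≠ 0 := fun h0 => hx.2 (Subtype.ext h0)
    obtain ⟨μ, hμ, hκμ⟩ := exists_isEig_of_eigenvector hKs hK hκ0 hx0 hxe
    have hlow := le_of_isEig hKpos hx0 ((isEig_iff hK μ _).mp hμ)
    have hμpos : 0 < μ := by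
      rcases lt_trichotomy μ 0 with h | h | h
      · have h1 := (hmem x).mp x.2 μ h x hμ
        exact absurd (inner_self_eq_zero.mp h1) hx0
      · rw [h] at hμ
        exact absurd (hker _ hμ) hx0
      · exact h
    have hle := spectralGap_le_of_pos (b := b) (w := w) (T := T) ⟨x, hx0, hμ⟩ hμpos
    rw [← hκn', hκμ, Complex.norm_real, Real.norm_eq_abs,
      abs_of_pos (by positivity : 0 < (μ + σ)⁻¹), inv_mul_le_iff₀ (by positivity)]
    linarith
  have h1 := norm_apply_sq_le_of_nonneg P hPs hP0 ⟨v, hvZ⟩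
  have h2 : ‖P ⟨v, hvZ⟩‖ = ‖u‖ := by
    rw [← hKv]; rfl
  have h3 : (inner ℂ (⟨v, hvZ⟩ : Z) (P ⟨v, hvZ⟩)).re = (inner ℂ v u).re := by
    rw [← hKv]; rfl
  rw [h2, h3] at h1
  have h4 : (spectralGap b w T + σ) * ‖u‖ ^ 2 ≤ (inner ℂ v u).re := by
    have h5 := hP0 ⟨v, hvZ⟩
    rw [h3] at h5
    calc (spectralGap b w T + σ) * ‖u‖ ^ 2
        ≤ (spectralGap b w T + σ) * (‖P‖ * (inner ℂ v u).re) :=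
          mul_le_mul_of_nonneg_left h1 (by linarith)
      _ = (‖P‖ * (spectralGap b w T + σ)) * (inner ℂ v u).re := by ring
      _ ≤ 1 * (inner ℂ v u).re := mul_le_mul_of_nonneg_right hPnorm h5
      _ = _ := one_mul _
  have h6 : (inner ℂ v u).re = (inner ℂ h u).re + σ * ‖u‖ ^ 2 := by
    rw [hv, inner_add_left, inner_smul_left, Complex.conj_ofReal, Complex.add_re,
      Complex.re_ofReal_mul, inner_self_eq_norm_sq_to_K]
    norm_cast
  linarith

end Spectral

section Spectral

variable {ι : Type*} {E : Type*} [NormedAddCommGroup E] [InnerProductSpace ℂ E]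
  {b : HilbertBasis ι ℂ E} {w : ι → ℝ} {T : E →L[ℂ] E}

variable (b w T) in
/-- The solutions of `(W + T) u = μ u`. -/
def eigSubmodule (μ : ℝ) : Submodule ℂ E where
  carrier := {u | IsEig b w T μ u}
  zero_mem' := fun j => by simp
  add_mem' := fun {u v} hu hv j => by
    simp only [map_add, lp.coeFn_add, Pi.add_apply]
    linear_combination hu j + hv j
  smul_mem' := fun c u hu j => by
    simp only [map_smul, lp.coeFn_smul, Pi.smul_apply, smul_eq_mul]
    linear_combination c * hu j

theorem hasSum_weight_of_image {u h : E}
    (huh : ∀ j, (w j : ℂ) * b.repr u j + b.repr (T u) j = b.repr h j) :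
    HasSum (fun j => w j * ‖b.repr u j‖ ^ 2) ((inner ℂ h u).re - quadForm T u) := by
  have h1 := (hasSum_repr_inner b u h).sub (hasSum_repr_inner b u (T u))
  have e1 : (inner ℂ u h).re = (inner ℂ h u).re := by
    rw [← inner_conj_symm, Complex.conj_re]
  have e2 : (inner ℂ u (T u)).re = quadForm T u := by
    rw [← inner_conj_symm, Complex.conj_re, quadForm]
  rw [e1, e2] at h1
  refine h1.congr_fun fun j => ?_
  rw [← Complex.sub_re, ← mul_sub, ← huh, add_sub_cancel_right, re_star_mul_ofReal_mul]

variable (b) in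
/-- The coordinates in a finite set of indices. -/
def coordMap (B : Finset ι) : E →ₗ[ℂ] EuclideanSpace ℂ B where
  toFun u := WithLp.toLp 2 fun j => b.repr u j
  map_add' u v := by ext j; simp
  map_smul' c u := by ext j; simp

variable (b) in
/-- The vector with given coordinates in a finite set of indices, and none outside. -/
def ofCoords (B : Finset ι) : EuclideanSpace ℂ B →ₗ[ℂ] E where
  toFun x := ∑ j : B, x j • b j
  map_add' x y := by simp [add_smul, Finset.sum_add_distrib]
  map_smul' c x := by simp [mul_smul, Finset.smul_sum]

open Classical in
theorem repr_ofCoords (B : Finset ι) (x : EuclideanSpace ℂ B) (j : ι) :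
    b.repr (ofCoords b B x) j = if h : j ∈ B then x ⟨j, h⟩ else 0 := by
  rw [b.repr_apply_apply]
  simp only [ofCoords, LinearMap.coe_mk, AddHom.coe_mk, inner_sum, inner_smul_right,
    orthonormal_iff_ite.mp b.orthonormal, mul_ite, mul_one, mul_zero]
  split_ifs with h
  · rw [Finset.sum_eq_single ⟨j, h⟩]
    · simp
    · rintro k - hk
      rw [if_neg]
      rintro rfl
      exact hk rfl
    · simp
  · refine Finset.sum_eq_zero fun k _ => ?_
    rw [if_neg]
    rintro rfl
    exact h k.2

theorem hasSum_ofCoords (B : Finset ι) (x : EuclideanSpace ℂ B) (c : ι → ℝ) :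
    HasSum (fun j => c j * ‖b.repr (ofCoords b B x) j‖ ^ 2) (∑ j : B, c j * ‖x j‖ ^ 2) := by
  classical
  have h : ∑ j : B, c j * ‖x j‖ ^ 2 =
      ∑ j ∈ B, c j * ‖b.repr (ofCoords b B x) j‖ ^ 2 := by
    rw [← Finset.sum_coe_sort B]
    refine Finset.sum_congr rfl fun j _ => ?_
    rw [repr_ofCoords, dif_pos j.2]
  rw [h]
  refine hasSum_sum_of_ne_finset_zero fun j hj => ?_
  rw [repr_ofCoords, dif_neg hj]
  simp

theorem norm_ofCoords (B : Finset ι) (x : EuclideanSpace ℂ B) : ‖ofCoords b B x‖ = ‖x‖ := by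
  have h := hasSum_ofCoords (b := b) B x fun _ => 1
  simp only [one_mul] at h
  have h2 := h.unique (hasSum_repr_sq b _)
  rw [← EuclideanSpace.norm_sq_eq] at h2
  exact ((sq_eq_sq₀ (norm_nonneg _) (norm_nonneg _)).mp h2).symm

variable [CompleteSpace E]

theorem exists_image_of_mem_negSpace (hw0 : ∀ j, 0 ≤ w j)
    (hw : Filter.Tendsto w Filter.cofinite Filter.atTop)
    (hT : (T : E →ₗ[ℂ] E).IsSymmetric) {u : E} (hu : u ∈ negSpace b w T) :
    ∃ h : E, (∀ j, (w j : ℂ) * b.repr u j + b.repr (T u) j = b.repr h j) ∧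
      (inner ℂ h u).re ≤ -(2 * spectralGap b w T) * ‖u‖ ^ 2 := by
  classical
  obtain ⟨K, -, hKs, -, hK⟩ := exists_resolvent (b := b) (T := T) hw0 hw hT (lt_add_one _)
  have hle : negSpace b w T ≤ ⨆ μ : {μ : ℝ // μ < 0}, eigSubmodule b w T μ := by
    refine Submodule.span_le.mpr ?_
    rintro x ⟨μ, hμ, hx⟩
    exact Submodule.mem_iSup_of_mem (p := fun μ : {μ : ℝ // μ < 0} => eigSubmodule b w T μ)
      ⟨μ, hμ⟩ hx
  obtain ⟨f, hf, rfl⟩ := (Submodule.mem_iSup_iff_exists_finsupp _ _).mp (hle hu)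
  have hort : ∀ μ ν : {μ : ℝ // μ < 0}, μ ≠ ν → inner ℂ (f μ) (f ν) = 0 := by
    intro μ ν hμν
    have h1 := (isEig_iff hK μ (f μ)).mp (hf μ)
    have h2 := (isEig_iff hK ν (f ν)).mp (hf ν)
    have h3 := hKs (f μ) (f ν)
    simp only [ContinuousLinearMap.coe_coe] at h3
    set m := (μ : ℝ) + (‖T‖ + 1)
    set n := (ν : ℝ) + (‖T‖ + 1)
    have h4 : inner ℂ (f μ) (f ν) = m * inner ℂ (K (f μ)) (f ν) := by
      nth_rewrite 1 [← h1]
      rw [inner_smul_left, Complex.conj_ofReal]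
    have h5 : inner ℂ (f μ) (f ν) = n * inner ℂ (K (f μ)) (f ν) := by
      nth_rewrite 1 [← h2]
      rw [inner_smul_right, ← h3]
    have h6 : ((m - n : ℝ) : ℂ) * inner ℂ (K (f μ)) (f ν) = 0 := by
      push_cast
      linear_combination h5 - h4
    have h7 : m - n ≠ 0 := by
      intro h; apply hμν; apply Subtype.ext
      simp only [m, n] at h; linarith
    rw [h4, (mul_eq_zero.mp h6).resolve_left (by exact_mod_cast h7), mul_zero]
  have hinner : ∀ c : {μ : ℝ // μ < 0} → ℝ,
      (inner ℂ (∑ μ ∈ f.support, (c μ : ℂ) • f μ) (∑ μ ∈ f.support, f μ)).re =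
        ∑ μ ∈ f.support, c μ * ‖f μ‖ ^ 2 := by
    intro c
    rw [sum_inner, Complex.re_sum]
    refine Finset.sum_congr rfl fun μ hμ => ?_
    rw [inner_sum, Finset.sum_eq_single μ, inner_smul_left, Complex.conj_ofReal,
      Complex.re_ofReal_mul, inner_self_eq_norm_sq_to_K]
    · norm_cast
    · intro ν _ hν
      rw [inner_smul_left, hort μ ν hν.symm, mul_zero]
    · intro h; exact absurd hμ h
  refine ⟨∑ μ ∈ f.support, ((μ : ℝ) : ℂ) • f μ, fun j => ?_, ?_⟩
  · simp only [Finsupp.sum, map_sum, lp.coeFn_sum, Finset.sum_apply, map_smul, lp.coeFn_smul,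
      Pi.smul_apply, smul_eq_mul]
    rw [Finset.mul_sum, ← Finset.sum_add_distrib]
    exact Finset.sum_congr rfl fun μ _ => hf μ j
  · have hn : ‖f.sum fun _ x => x‖ ^ 2 = ∑ μ ∈ f.support, ‖f μ‖ ^ 2 := by
      have h1 := hinner fun _ => 1
      simp only [Complex.ofReal_one, one_smul, one_mul] at h1
      rw [← h1, Finsupp.sum, inner_self_eq_norm_sq_to_K]
      norm_cast
    rw [hn, Finsupp.sum, hinner fun μ => μ, Finset.mul_sum]
    refine Finset.sum_le_sum fun μ hμ => mul_le_mul_of_nonneg_right ?_ (by positivity)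
    have := spectralGap_le_of_neg (b := b) (w := w) (T := T)
      ⟨f μ, Finsupp.mem_support_iff.mp hμ, hf μ⟩ μ.2
    linarith

/-- The quadratic form of a negative vector stays below `-β` after truncation. -/
theorem truncated_form_le (hw0 : ∀ j, 0 ≤ w j)
    (hw : Filter.Tendsto w Filter.cofinite Filter.atTop)
    (hT : (T : E →ₗ[ℂ] E).IsSymmetric) (hgap : 0 < spectralGap b w T) (B : Finset ι)
    (hB : ∀ j, w j ≤ 4 * ‖T‖ ^ 3 / spectralGap b w T ^ 2 + 1 → j ∈ B)
    {u : E} (hu : u ∈ negSpace b w T) :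
    ∑ j : B, w j * ‖coordMap b B u j‖ ^ 2 + quadForm T (ofCoords b B (coordMap b B u)) ≤
      -spectralGap b w T * ‖u‖ ^ 2 ∧ ‖coordMap b B u‖ ≤ ‖u‖ := by
  classical
  set β := spectralGap b w T with hβ
  set R := 4 * ‖T‖ ^ 3 / β ^ 2 + 1 with hR
  have hR0 : 0 < R := by positivity
  obtain ⟨h, huh, hform⟩ := exists_image_of_mem_negSpace hw0 hw hT hu
  have hW := hasSum_weight_of_image huh
  set p := ofCoords b B (coordMap b B u) with hp
  set q := u - p with hq
  have hpj : ∀ j, b.repr p j = if j ∈ B then b.repr u j else 0 := by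
    intro j
    rw [hp, repr_ofCoords]
    split_ifs <;> rfl
  have hqj : ∀ j, b.repr q j = if j ∈ B then 0 else b.repr u j := by
    intro j
    rw [hq, map_sub, lp.coeFn_sub, Pi.sub_apply, hpj]
    split_ifs <;> simp
  have hTu := abs_quadForm_le T u
  have hqn : R * ‖q‖ ^ 2 ≤ ‖T‖ * ‖u‖ ^ 2 := by
    have h1 : R * ‖q‖ ^ 2 ≤ (inner ℂ h u).re - quadForm T u := by
      refine hasSum_le (fun j => ?_) ((hasSum_repr_sq b q).mul_left R) hW
      rw [hqj]
      split_ifs with hj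
      · simpa using mul_nonneg (hw0 j) (sq_nonneg _)
      · have : R ≤ w j := by
          by_contra! hc
          exact hj (hB j hc.le)
        exact mul_le_mul_of_nonneg_right this (by positivity)
    have h2 := neg_abs_le (quadForm T u)
    have h3 : 0 ≤ β * ‖u‖ ^ 2 := by positivity
    linarith
  have hpn : ‖p‖ ≤ ‖u‖ := by
    have := norm_le_of_repr_le b (u := p) (v := u) zero_le_one fun j => by
      rw [hpj]; split_ifs <;> simp
    simpa using this
  have hq2 : 2 * ‖T‖ * ‖q‖ ≤ β * ‖u‖ := by
    refine le_of_sq_le_sq ?_ (by positivity)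
    have h1 : 4 * ‖T‖ ^ 3 ≤ β ^ 2 * R := by
      rw [hR, mul_add, mul_div_cancel₀ _ (by positivity)]
      nlinarith [sq_nonneg β]
    refine le_of_mul_le_mul_right ?_ hR0
    calc (2 * ‖T‖ * ‖q‖) ^ 2 * R = 4 * ‖T‖ ^ 2 * (R * ‖q‖ ^ 2) := by ring
      _ ≤ 4 * ‖T‖ ^ 2 * (‖T‖ * ‖u‖ ^ 2) := by gcongr
      _ = (4 * ‖T‖ ^ 3) * ‖u‖ ^ 2 := by ring
      _ ≤ (β ^ 2 * R) * ‖u‖ ^ 2 := by gcongr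
      _ = (β * ‖u‖) ^ 2 * R := by ring
  have hdiff : quadForm T p - quadForm T u ≤ β * ‖u‖ ^ 2 := by
    have e : quadForm T u - quadForm T p = (inner ℂ (T q) u).re + (inner ℂ (T p) q).re := by
      rw [quadForm, quadForm, hq, map_sub, inner_sub_left, inner_sub_right, Complex.sub_re,
        Complex.sub_re]
      ring
    have b1 : -(‖T‖ * ‖q‖ * ‖u‖) ≤ (inner ℂ (T q) u).re := by
      refine neg_le_of_abs_le ((Complex.abs_re_le_norm _).trans ((norm_inner_le_norm _ _).trans ?_))
      gcongr
      exact T.le_opNorm q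
    have b2 : -(‖T‖ * ‖u‖ * ‖q‖) ≤ (inner ℂ (T p) q).re := by
      refine neg_le_of_abs_le ((Complex.abs_re_le_norm _).trans ((norm_inner_le_norm _ _).trans ?_))
      gcongr
      exact (T.le_opNorm p).trans (by gcongr)
    have b3 : 2 * ‖T‖ * ‖q‖ * ‖u‖ ≤ β * ‖u‖ * ‖u‖ := by gcongr
    nlinarith
  have hsum : ∑ j : B, w j * ‖coordMap b B u j‖ ^ 2 ≤ (inner ℂ h u).re - quadForm T u := by
    refine hasSum_le (fun j => ?_) (hasSum_ofCoords (b := b) B (coordMap b B u) w) hW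
    rw [← hp, hpj]
    split_ifs
    · exact le_rfl
    · simpa using mul_nonneg (hw0 j) (sq_nonneg _)
  refine ⟨?_, ?_⟩
  · linarith
  · rw [← norm_ofCoords (b := b)]
    exact hpn

theorem finiteDimensional_negSpace (hw0 : ∀ j, 0 ≤ w j)
    (hw : Filter.Tendsto w Filter.cofinite Filter.atTop)
    (hT : (T : E →ₗ[ℂ] E).IsSymmetric) (hgap : 0 < spectralGap b w T) :
    FiniteDimensional ℂ (negSpace b w T) := by
  have hfin : {j | w j ≤ 4 * ‖T‖ ^ 3 / spectralGap b w T ^ 2 + 1}.Finite := by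
    have := hw.eventually (Filter.eventually_gt_atTop (4 * ‖T‖ ^ 3 / spectralGap b w T ^ 2 + 1))
    simpa [Filter.eventually_cofinite] using this
  refine Module.Finite.of_injective (coordMap b hfin.toFinset ∘ₗ (negSpace b w T).subtype) ?_
  rw [← LinearMap.ker_eq_bot, LinearMap.ker_eq_bot']
  intro u hu
  have h := (truncated_form_le hw0 hw hT hgap hfin.toFinset (fun j hj => by simpa using hj) u.2).1
  have hu' : coordMap b hfin.toFinset (u : E) = 0 := hu
  rw [hu'] at h
  simp only [quadForm, map_zero, inner_zero_left, Complex.zero_re, PiLp.zero_apply, norm_zero,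
    ne_eq, OfNat.ofNat_ne_zero, not_false_eq_true, zero_pow, mul_zero, Finset.sum_const_zero,
    add_zero] at h
  have h2 : ‖(u : E)‖ ^ 2 ≤ 0 := by
    by_contra! hc
    nlinarith
  have h3 : (u : E) = 0 := by
    simpa using le_antisymm h2 (by positivity)
  exact Subtype.ext h3

/-- Eigenvalues of a large compression of `W + T`: as many negative ones as for `W + T`, and none
in the gap. -/
theorem eigenvalues_of_compression (hw0 : ∀ j, 0 ≤ w j)
    (hw : Filter.Tendsto w Filter.cofinite Filter.atTop)
    (hT : (T : E →ₗ[ℂ] E).IsSymmetric) (hker : ∀ u, IsEig b w T 0 u → u = 0)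
    (hgap : 0 < spectralGap b w T) (B : Finset ι)
    (hB : ∀ j, w j ≤ 4 * ‖T‖ ^ 3 / spectralGap b w T ^ 2 + 1 → j ∈ B)
    (A : EuclideanSpace ℂ B →L[ℂ] EuclideanSpace ℂ B)
    (hA : (A : EuclideanSpace ℂ B →ₗ[ℂ] EuclideanSpace ℂ B).IsSymmetric)
    (hAform : ∀ x, quadForm A x = ∑ j : B, w j * ‖x j‖ ^ 2 + quadForm T (ofCoords b B x))
    {κ : Type*} [Fintype κ] (e : OrthonormalBasis κ ℂ (EuclideanSpace ℂ B)) (ev : κ → ℝ)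
    (he : ∀ i, A (e i) = (ev i : ℂ) • e i) :
    (Finset.univ.filter fun a => ev a < 0).card = Module.finrank ℂ (negSpace b w T) ∧
      ∀ a, ev a ≤ -spectralGap b w T ∨ spectralGap b w T ≤ ev a := by
  classical
  have hfd := finiteDimensional_negSpace hw0 hw hT hgap
  set β := spectralGap b w T with hβ
  have h1 : (Finset.univ.filter fun a => ev a < β).card ≤ Module.finrank ℂ (negSpace b w T) := by
    refine card_le_finrank_of_eigenbasis e _
      ((negSpace b w T).orthogonalProjectionOnto.toLinearMap ∘ₗ ofCoords b B) fun x hx hΦ => ?_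
    by_contra hx0
    have hlt := quadForm_lt_of_eigenbasis A hA e ev he hx0 β hx
    have hmem : ofCoords b B x ∈ (negSpace b w T)ᗮ := by
      rw [← Submodule.orthogonalProjectionOnto_eq_zero_iff]
      exact hΦ
    obtain ⟨y, hy⟩ := exists_repr_eq b (fun j => (w j : ℂ) * b.repr (ofCoords b B x) j)
      (ofCoords b B x) (C := ∑ j ∈ B, w j) fun j => by
        by_cases hj : j ∈ B
        · rw [norm_mul, Complex.norm_real, Real.norm_eq_abs, abs_of_nonneg (hw0 j)]
          exact mul_le_mul_of_nonneg_right
            (Finset.single_le_sum (f := w) (fun k _ => hw0 k) hj) (norm_nonneg _)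
        · rw [repr_ofCoords, dif_neg hj]; simp
    have huh : ∀ j, (w j : ℂ) * b.repr (ofCoords b B x) j + b.repr (T (ofCoords b B x)) j =
        b.repr (y + T (ofCoords b B x)) j := fun j => by
      rw [map_add, lp.coeFn_add, Pi.add_apply, hy]
    have hge := spectralGap_mul_le_of_mem_orthogonal hw0 hw hT hker hgap hmem huh
    have hs := (hasSum_weight_of_image huh).unique (hasSum_ofCoords B x w)
    rw [norm_ofCoords] at hge
    rw [hAform] at hlt
    linarith
  have h2 : Module.finrank ℂ (negSpace b w T) ≤ (Finset.univ.filter fun a => ev a ≤ -β).card := by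
    refine finrank_le_card_of_injective _ e (coordMap b B ∘ₗ (negSpace b w T).subtype)
      fun u hu => ?_
    simp only [LinearMap.comp_apply, Submodule.subtype_apply] at hu
    obtain ⟨hform, hn⟩ := truncated_form_le hw0 hw hT hgap B hB u.2
    rw [← hAform] at hform
    have hn2 : ‖coordMap b B (u : E)‖ ^ 2 ≤ ‖(u : E)‖ ^ 2 :=
      pow_le_pow_left₀ (norm_nonneg _) hn 2
    have hz : coordMap b B (u : E) = 0 := by
      by_contra hz
      have := lt_quadForm_of_eigenbasis A hA e ev he hz (-β) fun i hi => by
        by_contra! hc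
        exact hi (hu i hc)
      nlinarith
    rw [hz] at hform
    simp only [quadForm, map_zero, inner_zero_left, Complex.zero_re] at hform
    have h3 : (u : E) = 0 := by
      have : ‖(u : E)‖ ^ 2 ≤ 0 := by
        by_contra! hc
        nlinarith
      simpa using le_antisymm this (by positivity)
    exact Subtype.ext h3
  have s1 : (Finset.univ.filter fun a => ev a ≤ -β) ⊆ Finset.univ.filter fun a => ev a < 0 := by
    intro a ha
    simp only [Finset.mem_filter, Finset.mem_univ, true_and] at ha ⊢
    linarith
  have s2 : (Finset.univ.filter fun a => ev a < 0) ⊆ Finset.univ.filter fun a => ev a < β := by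
    intro a ha
    simp only [Finset.mem_filter, Finset.mem_univ, true_and] at ha ⊢
    linarith
  have c1 := Finset.card_le_card s1
  have c2 := Finset.card_le_card s2
  refine ⟨by omega, fun a => ?_⟩
  have heq : (Finset.univ.filter fun a => ev a ≤ -β) = Finset.univ.filter fun a => ev a < β :=
    Finset.eq_of_subset_of_card_le (s1.trans s2) (h1.trans h2)
  by_contra! hc
  have : a ∈ Finset.univ.filter fun a => ev a ≤ -β := by
    rw [heq]; simpa using hc.2
  simp only [Finset.mem_filter, Finset.mem_univ, true_and] at this
  linarith [hc.1]

end Spectral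

/-! ### The operator `-Δ + V` on the torus -/

section Torus

variable {d : ℕ}

instance : IsProbabilityMeasure (torusMeasure d) := by
  unfold torusMeasure; infer_instance

/-- The Fourier basis of `L²(𝕋ᵈ)`. -/
def torusBasis (d : ℕ) : HilbertBasis (Fin d → ℤ) ℂ (Lp ℂ 2 (torusMeasure d)) :=
  UnitAddTorus.mFourierBasis

theorem torusBasis_repr (u : Lp ℂ 2 (torusMeasure d)) (j : Fin d → ℤ) :
    (torusBasis d).repr u j = UnitAddTorus.mFourierCoeff (fun x => u x) j :=
  UnitAddTorus.mFourierBasis_repr u j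

theorem torusBasis_ae (j : Fin d → ℤ) :
    ⇑(torusBasis d j) =ᵐ[torusMeasure d] UnitAddTorus.mFourier j := by
  have h : torusBasis d j = UnitAddTorus.mFourierLp 2 j :=
    congrFun UnitAddTorus.coe_mFourierBasis j
  rw [h]
  exact UnitAddTorus.coeFn_mFourierLp 2 j

/-- A real continuous function, seen as a complex one. -/
def toComplex {ι : Type} [Fintype ι] (V : C(UnitAddTorus ι, ℝ)) : C(UnitAddTorus ι, ℂ) :=
  ⟨fun x => (V x : ℂ), by fun_prop⟩

/-- The multiplication by `V` on `L²(𝕋ᵈ)`. -/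
def potentialOp (V : C(UnitAddTorus (Fin d), ℝ)) :
    Lp ℂ 2 (torusMeasure d) →L[ℂ] Lp ℂ 2 (torusMeasure d) :=
  (ContinuousLinearMap.mul ℂ ℂ).holderL (torusMeasure d) ∞ 2 2
    (ContinuousMap.toLp (E := ℂ) ∞ (torusMeasure d) ℂ (toComplex V))

theorem potentialOp_ae (V : C(UnitAddTorus (Fin d), ℝ)) (u : Lp ℂ 2 (torusMeasure d)) :
    ⇑(potentialOp V u) =ᵐ[torusMeasure d] fun x => (V x : ℂ) * u x := by
  have h1 := (ContinuousLinearMap.mul ℂ ℂ).coeFn_holder (r := 2)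
    (ContinuousMap.toLp (E := ℂ) ∞ (torusMeasure d) ℂ (toComplex V)) u
  have h2 := ContinuousMap.coeFn_toLp (p := ∞) (𝕜 := ℂ) (torusMeasure d) (toComplex V)
  filter_upwards [h1, h2] with x hx1 hx2
  refine hx1.trans ?_
  rw [hx2]
  rfl

theorem potentialOp_isSymmetric (V : C(UnitAddTorus (Fin d), ℝ)) :
    (potentialOp V : Lp ℂ 2 (torusMeasure d) →ₗ[ℂ] Lp ℂ 2 (torusMeasure d)).IsSymmetric := by
  intro u v
  simp only [ContinuousLinearMap.coe_coe, L2.inner_def]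
  refine integral_congr_ae ?_
  filter_upwards [potentialOp_ae V u, potentialOp_ae V v] with x hu hv
  rw [hu, hv]
  simp only [RCLike.inner_apply, map_mul, Complex.conj_ofReal]
  ring

theorem repr_potentialOp (V : C(UnitAddTorus (Fin d), ℝ)) (u : Lp ℂ 2 (torusMeasure d))
    (j : Fin d → ℤ) : (torusBasis d).repr (potentialOp V u) j =
      UnitAddTorus.mFourierCoeff (fun x => (V x : ℂ) * u x) j := by
  rw [torusBasis_repr]
  unfold UnitAddTorus.mFourierCoeff
  refine integral_congr_ae ?_
  exact (potentialOp_ae V u).mono fun x hx =>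
    congrArg (fun z => UnitAddTorus.mFourier (-j) x • z) hx

theorem repr_potentialOp_basis (V : C(UnitAddTorus (Fin d), ℝ)) (j j' : Fin d → ℤ) :
    (torusBasis d).repr (potentialOp V (torusBasis d j')) j = coeff V (j - j') := by
  rw [repr_potentialOp]
  unfold coeff UnitAddTorus.mFourierCoeff
  refine integral_congr_ae ?_
  refine (torusBasis_ae j').mono fun x hx => ?_
  refine (congrArg (fun z => UnitAddTorus.mFourier (-j) x • ((V x : ℂ) * z)) hx).trans ?_
  simp only [neg_sub, sub_eq_neg_add j' j, UnitAddTorus.mFourier_add, smul_eq_mul]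
  ring

theorem isEig_iff_solvesEigenEq (V : C(UnitAddTorus (Fin d), ℝ)) (μ : ℝ)
    (u : Lp ℂ 2 (torusMeasure d)) :
    IsEig (torusBasis d) sqNorm (potentialOp V) μ u ↔ SolvesEigenEq V μ u := by
  unfold IsEig SolvesEigenEq
  simp only [repr_potentialOp]
  simp only [torusBasis_repr]

theorem negCount_eq (V : C(UnitAddTorus (Fin d), ℝ)) :
    negCount V = Module.finrank ℂ (negSpace (torusBasis d) sqNorm (potentialOp V)) := by
  have h : {u : Lp ℂ 2 (torusMeasure d) | ∃ μ < 0, SolvesEigenEq V μ u} =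
      {u | ∃ μ < 0, IsEig (torusBasis d) sqNorm (potentialOp V) μ u} := by
    simp only [isEig_iff_solvesEigenEq]
  unfold negCount negSpace
  rw [h]

theorem gapConst_eq (V : C(UnitAddTorus (Fin d), ℝ)) :
    gapConst V = spectralGap (torusBasis d) sqNorm (potentialOp V) := by
  unfold gapConst spectralGap eigSet eigenvalueSet
  simp only [isEig_iff_solvesEigenEq]

theorem sqNorm_nonneg (j : Fin d → ℤ) : 0 ≤ sqNorm j :=
  Finset.sum_nonneg fun _ _ => sq_nonneg _

theorem norm_sq_le_sqNorm (j : Fin d → ℤ) : ‖j‖ ^ 2 ≤ sqNorm j := by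
  have h : ‖j‖ ≤ Real.sqrt (sqNorm j) := by
    rw [pi_norm_le_iff_of_nonneg (Real.sqrt_nonneg _)]
    intro k
    rw [Int.norm_eq_abs]
    refine Real.abs_le_sqrt ?_
    exact Finset.single_le_sum (f := fun k => ((j k : ℝ)) ^ 2) (fun _ _ => sq_nonneg _)
      (Finset.mem_univ k)
  calc ‖j‖ ^ 2 ≤ Real.sqrt (sqNorm j) ^ 2 := pow_le_pow_left₀ (norm_nonneg _) h 2
    _ = sqNorm j := Real.sq_sqrt (sqNorm_nonneg j)

theorem sqNorm_le (j : Fin d → ℤ) : sqNorm j ≤ d * ‖j‖ ^ 2 := by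
  calc sqNorm j ≤ ∑ _k : Fin d, ‖j‖ ^ 2 := by
        refine Finset.sum_le_sum fun k _ => ?_
        rw [← sq_abs, ← Int.norm_eq_abs]
        exact pow_le_pow_left₀ (norm_nonneg _) (norm_le_pi_norm j k) 2
    _ = d * ‖j‖ ^ 2 := by simp

theorem tendsto_sqNorm :
    Filter.Tendsto (sqNorm : (Fin d → ℤ) → ℝ) Filter.cofinite Filter.atTop := by
  rw [Filter.tendsto_atTop]
  intro R
  rw [Filter.eventually_cofinite]
  refine (Set.finite_Icc (fun _ : Fin d => -⌈|R| + 1⌉) fun _ => ⌈|R| + 1⌉).subset fun j hj => ?_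
  have h1 : ‖j‖ ^ 2 < (|R| + 1) ^ 2 := by
    have h2 := norm_sq_le_sqNorm j
    have h3 : sqNorm j < R := not_le.mp hj
    nlinarith [le_abs_self R, abs_nonneg R]
  have h2 : ‖j‖ ≤ |R| + 1 := (lt_of_pow_lt_pow_left₀ 2 (by positivity) h1).le
  have h3 : ∀ k, |j k| ≤ ⌈|R| + 1⌉ := fun k => by
    have h4 := (norm_le_pi_norm j k).trans (h2.trans (Int.le_ceil _))
    rw [Int.norm_eq_abs] at h4
    exact_mod_cast h4
  exact ⟨fun k => (abs_le.mp (h3 k)).1, fun k => (abs_le.mp (h3 k)).2⟩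

theorem gapConst_pos (V : C(UnitAddTorus (Fin d), ℝ)) (hV : TrivialKernel V) : 0 < gapConst V := by
  have : Nontrivial (Lp ℂ 2 (torusMeasure d)) :=
    ⟨torusBasis d 0, 0, (torusBasis d).orthonormal.ne_zero 0⟩
  rw [gapConst_eq]
  refine spectralGap_pos sqNorm_nonneg tendsto_sqNorm (potentialOp_isSymmetric V) fun u hu => ?_
  exact hV u ((isEig_iff_solvesEigenEq V 0 u).mp hu)

theorem isSymmetric_toEuclideanCLM {n : Type*} [Fintype n] [DecidableEq n] {M : Matrix n n ℂ}
    (hM : M.IsHermitian) : (Matrix.toEuclideanCLM (n := n) (𝕜 := ℂ) M :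
      EuclideanSpace ℂ n →ₗ[ℂ] EuclideanSpace ℂ n).IsSymmetric :=
  Matrix.isSymmetric_toEuclideanLin_iff.mpr hM

theorem toEuclideanCLM_eigenvectorBasis {n : Type*} [Fintype n] [DecidableEq n]
    {M : Matrix n n ℂ} (hM : M.IsHermitian) (a : n) :
    Matrix.toEuclideanCLM (n := n) (𝕜 := ℂ) M (hM.eigenvectorBasis a) =
      (hM.eigenvalues a : ℂ) • hM.eigenvectorBasis a := by
  have h := hM.mulVec_eigenvectorBasis a
  ext i
  have h2 := congrFun h i
  simpa using h2

theorem quadForm_toEuclideanCLM {n : Type*} [Fintype n] [DecidableEq n] (M : Matrix n n ℂ)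
    (x : EuclideanSpace ℂ n) : quadForm (Matrix.toEuclideanCLM (n := n) (𝕜 := ℂ) M) x =
      ∑ i, (x i * star (M.mulVec x i)).re := by
  rw [quadForm, PiLp.inner_apply, Complex.re_sum]
  rfl

theorem repr_potentialOp_ofCoords (V : C(UnitAddTorus (Fin d), ℝ)) (B : Finset (Fin d → ℤ))
    (x : EuclideanSpace ℂ B) (j : Fin d → ℤ) :
    (torusBasis d).repr (potentialOp V (ofCoords (torusBasis d) B x)) j =
      ∑ j' : B, coeff V (j - j') * x j' := by
  simp only [ofCoords, LinearMap.coe_mk, AddHom.coe_mk, map_sum, map_smul, lp.coeFn_sum,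
    Finset.sum_apply, lp.coeFn_smul, Pi.smul_apply, repr_potentialOp_basis, smul_eq_mul]
  exact Finset.sum_congr rfl fun j' _ => mul_comm (x j') _

theorem quadForm_restrictedMatrix (V : C(UnitAddTorus (Fin d), ℝ)) (B : Finset (Fin d → ℤ))
    (x : EuclideanSpace ℂ B) :
    quadForm (Matrix.toEuclideanCLM (n := B) (𝕜 := ℂ) (restrictedMatrix V B)) x =
      ∑ j : B, sqNorm (j : Fin d → ℤ) * ‖x j‖ ^ 2 +
        quadForm (potentialOp V) (ofCoords (torusBasis d) B x) := by
  have h1 : quadForm (potentialOp V) (ofCoords (torusBasis d) B x) =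
      ∑ j : B, (x j * star (∑ j' : B, coeff V (j - j') * x j')).re := by
    conv_lhs => rw [quadForm]; arg 1; arg 3; simp only [ofCoords, LinearMap.coe_mk, AddHom.coe_mk]
    rw [inner_sum, Complex.re_sum]
    refine Finset.sum_congr rfl fun j _ => ?_
    rw [inner_smul_right, ← inner_conj_symm, ← (torusBasis d).repr_apply_apply,
      ← repr_potentialOp_ofCoords]
    rfl
  rw [h1, quadForm_toEuclideanCLM, ← Finset.sum_add_distrib]
  refine Finset.sum_congr rfl fun j _ => ?_
  have h2 : (restrictedMatrix V B).mulVec x j =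
      (sqNorm (j : Fin d → ℤ) : ℂ) * x j + ∑ j' : B, coeff V (j - j') * x j' := by
    rw [restrictedMatrix, Matrix.add_mulVec, Pi.add_apply, Matrix.mulVec_diagonal]
    rfl
  have h3 := re_star_mul_ofReal_mul (sqNorm (j : Fin d → ℤ)) (x j)
  rw [h2, star_add, mul_add, Complex.add_re, ← h3]
  congr 1
  simp only [star_mul', Complex.star_def, Complex.conj_ofReal]
  ring_nf

theorem sum_norm_sq_eq {n : Type*} [Fintype n] (x : EuclideanSpace ℂ n) :
    ∑ i, ‖x i‖ ^ 2 = ‖x‖ ^ 2 := (EuclideanSpace.norm_sq_eq x).symm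

theorem le_quadForm_restrictedMatrix (V : C(UnitAddTorus (Fin d), ℝ)) (B : Finset (Fin d → ℤ))
    {c : ℝ} (hc : ∀ j ∈ B, c ≤ sqNorm j) (x : EuclideanSpace ℂ B) :
    (c - ‖potentialOp V‖) * ‖x‖ ^ 2 ≤
      quadForm (Matrix.toEuclideanCLM (n := B) (𝕜 := ℂ) (restrictedMatrix V B)) x := by
  rw [quadForm_restrictedMatrix]
  have h1 := neg_le_of_abs_le (abs_quadForm_le (potentialOp V) (ofCoords (torusBasis d) B x))
  rw [norm_ofCoords] at h1
  have h2 : c * ‖x‖ ^ 2 ≤ ∑ j : B, sqNorm (j : Fin d → ℤ) * ‖x j‖ ^ 2 := by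
    rw [← sum_norm_sq_eq, Finset.mul_sum]
    exact Finset.sum_le_sum fun j _ => mul_le_mul_of_nonneg_right (hc j j.2) (by positivity)
  linarith

theorem quadForm_restrictedMatrix_le (V : C(UnitAddTorus (Fin d), ℝ)) (B : Finset (Fin d → ℤ))
    {c : ℝ} (hc : ∀ j ∈ B, sqNorm j ≤ c) (x : EuclideanSpace ℂ B) :
    quadForm (Matrix.toEuclideanCLM (n := B) (𝕜 := ℂ) (restrictedMatrix V B)) x ≤
      (c + ‖potentialOp V‖) * ‖x‖ ^ 2 := by
  rw [quadForm_restrictedMatrix]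
  have h1 := le_of_abs_le (abs_quadForm_le (potentialOp V) (ofCoords (torusBasis d) B x))
  rw [norm_ofCoords] at h1
  have h2 : ∑ j : B, sqNorm (j : Fin d → ℤ) * ‖x j‖ ^ 2 ≤ c * ‖x‖ ^ 2 := by
    rw [← sum_norm_sq_eq, Finset.mul_sum]
    exact Finset.sum_le_sum fun j _ => mul_le_mul_of_nonneg_right (hc j j.2) (by positivity)
  linarith

theorem exists_isSpectralLength (V : C(UnitAddTorus (Fin d), ℝ)) (hV : TrivialKernel V) :
    ∃ L₀ : ℕ, IsSpectralLength V L₀ := by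
  have hβ := gapConst_pos V hV
  set β := gapConst V with hβdef
  have hβ' : β = spectralGap (torusBasis d) sqNorm (potentialOp V) := gapConst_eq V
  set R := 4 * ‖potentialOp V‖ ^ 3 / β ^ 2 + 1 + ‖potentialOp V‖ + β with hR
  have hR1 : 1 ≤ R := by
    have : 0 ≤ 4 * ‖potentialOp V‖ ^ 3 / β ^ 2 := by positivity
    have := norm_nonneg (potentialOp V)
    linarith
  set L := ⌈R⌉₊ with hL
  have hLR : R ≤ L := Nat.le_ceil R
  refine ⟨L + 1, fun B _ _ => ⟨fun hdis a => ?_, fun hsub => ?_⟩⟩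
  · have h1 := le_quadForm_restrictedMatrix V B (c := R) (fun j hj => by
      have h2 : (L : ℝ) < ‖j‖ := by
        by_contra! hc
        exact hdis j (by push_cast; linarith) hj
      have h3 := norm_sq_le_sqNorm j
      nlinarith) ((restrictedMatrix_isHermitian V B).eigenvectorBasis a)
    rw [quadForm, toEuclideanCLM_eigenvectorBasis, inner_smul_left, Complex.conj_ofReal,
      Complex.re_ofReal_mul, inner_self_eq_norm_sq_to_K, OrthonormalBasis.norm_eq_one] at h1
    have h2 : 0 ≤ 4 * ‖potentialOp V‖ ^ 3 / β ^ 2 := by positivity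
    simp only [one_pow, mul_one, Complex.coe_algebraMap, Complex.ofReal_one, Complex.one_re] at h1
    linarith
  · have h := eigenvalues_of_compression (b := torusBasis d) sqNorm_nonneg tendsto_sqNorm
      (potentialOp_isSymmetric V)
      (fun u hu => hV u ((isEig_iff_solvesEigenEq V 0 u).mp hu)) (hβ' ▸ hβ) B
      (fun j hj => hsub j (by
        rw [← hβ'] at hj
        have h1 := norm_sq_le_sqNorm j
        have h2 : sqNorm j ≤ L := by
          have := norm_nonneg (potentialOp V)
          linarith
        push_cast
        nlinarith [norm_nonneg j]))
      (Matrix.toEuclideanCLM (n := B) (𝕜 := ℂ) (restrictedMatrix V B))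
      (isSymmetric_toEuclideanCLM (restrictedMatrix_isHermitian V B))
      (quadForm_restrictedMatrix V B) (restrictedMatrix_isHermitian V B).eigenvectorBasis
      (restrictedMatrix_isHermitian V B).eigenvalues
      (toEuclideanCLM_eigenvectorBasis (restrictedMatrix_isHermitian V B))
    rw [← hβ', ← negCount_eq] at h
    exact h

end Torus

/-! ### Eigenvalue variation in the parameters -/

section Diagonal

variable {κ : Type*} [Fintype κ] [DecidableEq κ]

/-- The operator with a real diagonal matrix. -/
def diagCLM (a : κ → ℝ) : EuclideanSpace ℂ κ →L[ℂ] EuclideanSpace ℂ κ :=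
  Matrix.toEuclideanCLM (n := κ) (𝕜 := ℂ) (Matrix.diagonal fun k => (a k : ℂ))

theorem diagCLM_apply (a : κ → ℝ) (v : EuclideanSpace ℂ κ) (k : κ) :
    diagCLM a v k = a k * v k := by
  change (Matrix.mulVec _ _) k = _
  rw [Matrix.mulVec_diagonal]
  rfl

theorem diagCLM_isSymmetric (a : κ → ℝ) :
    (diagCLM a : EuclideanSpace ℂ κ →ₗ[ℂ] EuclideanSpace ℂ κ).IsSymmetric := by
  refine isSymmetric_toEuclideanCLM (Matrix.isHermitian_diagonal_of_self_adjoint _ ?_)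
  funext k
  simp

theorem quadForm_diagCLM (a : κ → ℝ) (v : EuclideanSpace ℂ κ) :
    quadForm (diagCLM a) v = ∑ k, a k * ‖v k‖ ^ 2 := by
  rw [quadForm, PiLp.inner_apply, Complex.re_sum]
  refine Finset.sum_congr rfl fun k _ => ?_
  rw [diagCLM_apply, ← re_star_mul_ofReal_mul]
  simp only [RCLike.inner_apply, map_mul, Complex.conj_ofReal, Complex.star_def]
  ring_nf

theorem norm_diagCLM_apply_le (a : κ → ℝ) {C : ℝ} (hC : 0 ≤ C) (ha : ∀ k, |a k| ≤ C)
    (v : EuclideanSpace ℂ κ) : ‖diagCLM a v‖ ≤ C * ‖v‖ := by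
  refine le_of_sq_le_sq ?_ (by positivity)
  rw [mul_pow, EuclideanSpace.norm_sq_eq, EuclideanSpace.norm_sq_eq, Finset.mul_sum]
  refine Finset.sum_le_sum fun k _ => ?_
  rw [diagCLM_apply, norm_mul, Complex.norm_real, Real.norm_eq_abs, mul_pow]
  have := ha k
  gcongr

theorem norm_diagCLM_le (a : κ → ℝ) {C : ℝ} (hC : 0 ≤ C) (ha : ∀ k, |a k| ≤ C) :
    ‖diagCLM a‖ ≤ C :=
  ContinuousLinearMap.opNorm_le_bound _ hC (norm_diagCLM_apply_le a hC ha)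

theorem diagCLM_sub (a a' : κ → ℝ) :
    diagCLM (fun k => a k - a' k) = diagCLM a - diagCLM a' := by
  ext v k
  simp [diagCLM_apply, sub_mul]

/-- The variation in the frequency: in the coordinates where `-Δ + V` is diagonal with entries `h`
away from `0`, the bad parameters `t` are few. -/
theorem coveredByIntervals_frequency (x h : κ → ℝ) {β c α : ℝ} (hβ : 0 < β) (hα : 0 ≤ α)
    (hh : ∀ k, β ≤ |h k|) (R : ℝ → EuclideanSpace ℂ κ →L[ℂ] EuclideanSpace ℂ κ)
    (hRs : ∀ t ∈ Lam, (R t : EuclideanSpace ℂ κ →ₗ[ℂ] EuclideanSpace ℂ κ).IsSymmetric)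
    (hRn : ∀ t ∈ Lam, ‖R t‖ ≤ c)
    (hRl : ∀ t ∈ Lam, ∀ t' ∈ Lam, ‖R t' - R t‖ ≤ c * |t' - t|) (hc : 80 * c ≤ β) :
    CoveredByIntervals
      {t | t ∈ Lam ∧ HasApproxKernel (diagCLM (fun k => -(t * x k) ^ 2 + h k) - R t) α}
      (Fintype.card κ) (32 * α / β) := by
  set s : ℝ → κ → ℝ := fun t k => if 0 < h k then t⁻¹ else t with hs
  set A : ℝ → EuclideanSpace ℂ κ →L[ℂ] EuclideanSpace ℂ κ :=
    fun t => diagCLM (fun k => -(t * x k) ^ 2 + h k) - R t with hA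
  set F : ℝ → EuclideanSpace ℂ κ →L[ℂ] EuclideanSpace ℂ κ :=
    fun t => diagCLM (s t) ∘L A t ∘L diagCLM (s t) with hF
  have ht0 : ∀ {t : ℝ}, t ∈ Lam → 1 / 2 ≤ t ∧ t ≤ 3 / 2 := fun ht => ht
  have hinv : ∀ {t : ℝ}, t ∈ Lam → 2 / 3 ≤ t⁻¹ ∧ t⁻¹ ≤ 2 := fun {t} ht => by
    have h1 := ht0 ht
    have h2 : 0 < t := by linarith
    rw [← one_div, le_div_iff₀ h2, div_le_iff₀ h2]
    constructor <;> linarith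
  have hsb : ∀ {t : ℝ}, t ∈ Lam → ∀ k, 1 / 2 ≤ s t k ∧ s t k ≤ 2 := fun {t} ht k => by
    have h1 := ht0 ht
    have h2 := hinv ht
    simp only [hs]
    split_ifs <;> constructor <;> linarith
  have hsn : ∀ {t : ℝ}, t ∈ Lam → ‖diagCLM (s t)‖ ≤ 2 := fun {t} ht =>
    norm_diagCLM_le _ (by norm_num) fun k => by
      have := hsb ht k
      rw [abs_of_nonneg (by linarith)]; exact this.2
  have hsl : ∀ {t t' : ℝ}, t ∈ Lam → t' ∈ Lam → t < t' →
      ‖diagCLM (s t') - diagCLM (s t)‖ ≤ 4 * (t' - t) := fun {t t'} ht ht' htt' => by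
    rw [← diagCLM_sub]
    refine norm_diagCLM_le _ (by linarith) fun k => ?_
    simp only [hs]
    split_ifs
    · have h1 := ht0 ht
      have h1' := ht0 ht'
      have h2 : t'⁻¹ - t⁻¹ = -((t' - t) * (t⁻¹ * t'⁻¹)) := by
        have : t ≠ 0 := by linarith
        have : t' ≠ 0 := by linarith
        field_simp; ring
      have h3 := hinv ht
      have h3' := hinv ht'
      have h4 : t⁻¹ * t'⁻¹ ≤ 4 := by nlinarith
      have h5 : 0 ≤ t⁻¹ * t'⁻¹ := by nlinarith
      rw [h2, abs_neg, abs_of_nonneg (mul_nonneg (by linarith) h5)]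
      nlinarith
    · rw [abs_of_pos (by linarith)]; linarith
  have hdiag : ∀ {t t' : ℝ}, t ∈ Lam → t' ∈ Lam → t < t' → ∀ k,
      s t' k ^ 2 * (-(t' * x k) ^ 2 + h k) ≤
        s t k ^ 2 * (-(t * x k) ^ 2 + h k) - β / 2 * (t' - t) := fun {t t'} ht ht' htt' k => by
    have h1 := ht0 ht
    have h1' := ht0 ht'
    have h3 := hinv ht
    have h3' := hinv ht'
    have ht1 : t ≠ 0 := by linarith
    have ht1' : t' ≠ 0 := by linarith
    have hk := hh k
    simp only [hs]
    split_ifs with hpos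
    · rw [abs_of_pos hpos] at hk
      have e1 : t'⁻¹ ^ 2 * (-(t' * x k) ^ 2 + h k) = -x k ^ 2 + t'⁻¹ ^ 2 * h k := by
        field_simp
      have e2 : t⁻¹ ^ 2 * (-(t * x k) ^ 2 + h k) = -x k ^ 2 + t⁻¹ ^ 2 * h k := by
        field_simp
      have e3 : t⁻¹ ^ 2 - t'⁻¹ ^ 2 = (t' - t) * ((t⁻¹ * t'⁻¹) * (t⁻¹ + t'⁻¹)) := by
        field_simp
        ring
      have h4 : 4 / 9 ≤ t⁻¹ * t'⁻¹ := by nlinarith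
      have h5 : 1 / 2 ≤ (t⁻¹ * t'⁻¹) * (t⁻¹ + t'⁻¹) := by nlinarith
      have h6 : (t' - t) * (1 / 2) ≤ t⁻¹ ^ 2 - t'⁻¹ ^ 2 := by
        rw [e3]
        exact mul_le_mul_of_nonneg_left h5 (by linarith)
      have h7 : (t' - t) * (1 / 2) * β ≤ (t⁻¹ ^ 2 - t'⁻¹ ^ 2) * h k :=
        mul_le_mul h6 hk hβ.le (by nlinarith)
      rw [e1, e2]
      linarith
    · rw [abs_of_nonpos (not_lt.mp hpos)] at hk
      have h4 : t ^ 4 * x k ^ 2 ≤ t' ^ 4 * x k ^ 2 := by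
        have : 0 ≤ t := by linarith
        gcongr
      have h5 : t' - t ≤ t' ^ 2 - t ^ 2 := by nlinarith
      have h6 : (t' - t) * β ≤ (t' ^ 2 - t ^ 2) * (-h k) :=
        mul_le_mul h5 hk hβ.le (by linarith)
      have h7 : 0 ≤ (t' - t) * β := mul_nonneg (by linarith) hβ.le
      nlinarith
  have hFq : ∀ t v, quadForm (F t) v = ∑ k, s t k ^ 2 * (-(t * x k) ^ 2 + h k) * ‖v k‖ ^ 2 -
      quadForm (diagCLM (s t) ∘L R t ∘L diagCLM (s t)) v := fun t v => by
    have e : F t = diagCLM (fun k => s t k ^ 2 * (-(t * x k) ^ 2 + h k)) -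
        diagCLM (s t) ∘L R t ∘L diagCLM (s t) := by
      ext v k
      simp only [hF, hA, ContinuousLinearMap.comp_apply, sub_apply, PiLp.sub_apply, diagCLM_apply]
      push_cast
      ring
    rw [e, quadForm_sub, quadForm_diagCLM]
  have hcov := coveredByIntervals_of_quadForm_decreasing (S := Lam) F (fun t ht => ?_)
    (α := 4 * α) (β := β / 4) (by positivity) (by positivity) (fun t ht t' ht' htt' v => ?_)
  · refine hcov.mono ?_ (by simp) (le_of_eq (by ring))
    rintro t ⟨ht, v, hv, hAv⟩
    refine ⟨ht, diagCLM (fun k => (s t k)⁻¹) v, ?_, ?_⟩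
    all_goals
      have hC : diagCLM (s t) (diagCLM (fun k => (s t k)⁻¹) v) = v := by
        ext k
        have := hsb ht k
        have h1 : (s t k : ℂ) ≠ 0 := by exact_mod_cast (by linarith : s t k ≠ 0)
        rw [diagCLM_apply, diagCLM_apply, Complex.ofReal_inv, mul_inv_cancel_left₀ h1]
    · intro h0
      rw [h0, map_zero] at hC
      exact hv hC.symm
    · simp only [hF, ContinuousLinearMap.comp_apply, hC]
      have h1 : ‖v‖ ≤ 2 * ‖diagCLM (fun k => (s t k)⁻¹) v‖ := by
        conv_lhs => rw [← hC]
        exact (ContinuousLinearMap.le_opNorm _ _).trans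
          (mul_le_mul_of_nonneg_right (hsn ht) (norm_nonneg _))
      calc ‖diagCLM (s t) (A t v)‖ ≤ 2 * ‖A t v‖ :=
            (ContinuousLinearMap.le_opNorm _ _).trans
              (mul_le_mul_of_nonneg_right (hsn ht) (norm_nonneg _))
        _ ≤ 2 * (α * ‖v‖) := by gcongr
        _ ≤ 2 * (α * (2 * ‖diagCLM (fun k => (s t k)⁻¹) v‖)) := by gcongr
        _ = 4 * α * ‖diagCLM (fun k => (s t k)⁻¹) v‖ := by ring
  · intro v v'
    have h1 := diagCLM_isSymmetric (s t)
    have h2 := diagCLM_isSymmetric fun k => -(t * x k) ^ 2 + h k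
    have h3 := hRs t ht
    simp only [LinearMap.IsSymmetric, ContinuousLinearMap.coe_coe] at h1 h2 h3
    simp only [hF, hA, ContinuousLinearMap.coe_coe, ContinuousLinearMap.comp_apply, sub_apply]
    rw [h1, ← h1 v, inner_sub_left, inner_sub_right, h2, h3]
  · rw [hFq, hFq]
    have hc0 : 0 ≤ c := (norm_nonneg _).trans (hRn t ht)
    set G : ℝ → EuclideanSpace ℂ κ →L[ℂ] EuclideanSpace ℂ κ :=
      fun t => diagCLM (s t) ∘L R t ∘L diagCLM (s t) with hG
    have h1 : ∑ k, s t' k ^ 2 * (-(t' * x k) ^ 2 + h k) * ‖v k‖ ^ 2 ≤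
        ∑ k, s t k ^ 2 * (-(t * x k) ^ 2 + h k) * ‖v k‖ ^ 2 - β / 2 * (t' - t) * ‖v‖ ^ 2 := by
      rw [EuclideanSpace.norm_sq_eq v, Finset.mul_sum, ← Finset.sum_sub_distrib]
      refine Finset.sum_le_sum fun k _ => ?_
      rw [← sub_mul]
      exact mul_le_mul_of_nonneg_right (hdiag ht ht' htt' k) (by positivity)
    have h2 : ‖G t' - G t‖ ≤ 20 * c * (t' - t) := by
      have e : G t' - G t = (diagCLM (s t') - diagCLM (s t)) ∘L R t' ∘L diagCLM (s t') +
          diagCLM (s t) ∘L (R t' - R t) ∘L diagCLM (s t') +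
          diagCLM (s t) ∘L R t ∘L (diagCLM (s t') - diagCLM (s t)) := by
        ext v k
        simp only [hG, ContinuousLinearMap.comp_apply, sub_apply, add_apply, map_sub]
        abel_nf
      have n3 : ∀ P Q U : EuclideanSpace ℂ κ →L[ℂ] EuclideanSpace ℂ κ,
          ‖P ∘L Q ∘L U‖ ≤ ‖P‖ * (‖Q‖ * ‖U‖) := fun P Q U =>
        (ContinuousLinearMap.opNorm_comp_le _ _).trans
          (mul_le_mul_of_nonneg_left (ContinuousLinearMap.opNorm_comp_le _ _) (norm_nonneg _))
      have hRl' := hRl t ht t' ht'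
      rw [abs_of_pos (by linarith)] at hRl'
      have htt0 : 0 ≤ t' - t := by linarith
      have b1 := (n3 (diagCLM (s t') - diagCLM (s t)) (R t') (diagCLM (s t'))).trans
        (mul_le_mul (hsl ht ht' htt') (mul_le_mul (hRn t' ht') (hsn ht') (norm_nonneg _) hc0)
          (by positivity) (by linarith))
      have b2 := (n3 (diagCLM (s t)) (R t' - R t) (diagCLM (s t'))).trans
        (mul_le_mul (hsn ht) (mul_le_mul hRl' (hsn ht') (norm_nonneg _) (by positivity))
          (by positivity) (by norm_num))
      have b3 := (n3 (diagCLM (s t)) (R t) (diagCLM (s t') - diagCLM (s t))).trans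
        (mul_le_mul (hsn ht) (mul_le_mul (hRn t ht) (hsl ht ht' htt') (norm_nonneg _) hc0)
          (by positivity) (by norm_num))
      rw [e]
      refine (norm_add₃_le).trans ?_
      linarith
    have h3 : quadForm (G t) v - quadForm (G t') v ≤ 20 * c * (t' - t) * ‖v‖ ^ 2 := by
      rw [← quadForm_sub]
      refine (le_abs_self _).trans ((abs_quadForm_le _ v).trans ?_)
      rw [norm_sub_rev]
      gcongr
    have h4 : 20 * c * (t' - t) * ‖v‖ ^ 2 ≤ β / 4 * (t' - t) * ‖v‖ ^ 2 := by
      have : 0 ≤ t' - t := by linarith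
      gcongr
      linarith
    simp only [hG] at h3 ⊢
    linarith

/-- The variation in `θ`: far from the origin the eigenvalues are monotone in `θ`. -/
theorem coveredByIntervals_phase_pos (x : κ → ℝ) {X Θ r α : ℝ}
    (hx : ∀ k, |x k| ≤ X) (hr : 0 < r) (hΘ : X + r / 2 ≤ Θ) (hα : 0 ≤ α)
    (Q : EuclideanSpace ℂ κ →L[ℂ] EuclideanSpace ℂ κ)
    (hQ : (Q : EuclideanSpace ℂ κ →ₗ[ℂ] EuclideanSpace ℂ κ).IsSymmetric) :
    CoveredByIntervals
      {θ | θ ∈ Set.Ioi Θ ∧ HasApproxKernel (diagCLM (fun k => -(x k + θ) ^ 2) + Q) α}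
      (Fintype.card κ) (2 * α / r) := by
  have h := coveredByIntervals_of_quadForm_decreasing (S := Set.Ioi Θ)
    (fun θ => diagCLM (fun k => -(x k + θ) ^ 2) + Q) (fun θ _ => ?_) hα hr
    (fun θ hθ θ' hθ' hlt v => ?_)
  · rwa [finrank_euclideanSpace] at h
  · exact (diagCLM_isSymmetric _).add hQ
  · rw [quadForm_add, quadForm_add, quadForm_diagCLM, quadForm_diagCLM, EuclideanSpace.norm_sq_eq v,
      Finset.mul_sum, add_sub_right_comm, ← Finset.sum_sub_distrib]
    refine add_le_add_left (Finset.sum_le_sum fun k _ => ?_) _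
    rw [← sub_mul]
    refine mul_le_mul_of_nonneg_right ?_ (by positivity)
    have h1 := (abs_le.mp (hx k)).1
    have h2 : Θ < θ := hθ
    have h3 : Θ < θ' := hθ'
    nlinarith

theorem coveredByIntervals_phase (x : κ → ℝ) {X Θ r α : ℝ}
    (hx : ∀ k, |x k| ≤ X) (hr : 0 < r) (hΘ : X + r / 2 ≤ Θ) (hα : 0 ≤ α)
    (Q : EuclideanSpace ℂ κ →L[ℂ] EuclideanSpace ℂ κ)
    (hQ : (Q : EuclideanSpace ℂ κ →ₗ[ℂ] EuclideanSpace ℂ κ).IsSymmetric) :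
    CoveredByIntervals
      {θ | Θ < |θ| ∧ HasApproxKernel (diagCLM (fun k => -(x k + θ) ^ 2) + Q) α}
      (Fintype.card κ + Fintype.card κ) (2 * α / r) := by
  have h1 := coveredByIntervals_phase_pos x hx hr hΘ hα Q hQ
  have h2 := (coveredByIntervals_phase_pos (fun k => -x k) (by simpa using hx) hr hΘ hα Q hQ).neg
  refine (h1.union h2).mono ?_ le_rfl le_rfl
  rintro θ ⟨hθ, hA⟩
  rcases lt_abs.mp hθ with h | h
  · exact Or.inl ⟨h, hA⟩
  · refine Or.inr (Set.mem_neg.mpr ⟨h, ?_⟩)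
    convert hA using 4
    ring

end Diagonal

/-! ### Fourier coefficients as linear functionals -/

section Coefficients

variable {ι : Type} [Fintype ι]

theorem integrable_mFourier_smul (g : C(UnitAddTorus ι, ℝ)) (n : ι → ℤ) :
    Integrable (fun t => UnitAddTorus.mFourier (-n) t • (g t : ℂ))
      (Measure.pi fun _ : ι => AddCircle.haarAddCircle) := by
  refine Continuous.integrable_of_hasCompactSupport (by fun_prop) ?_
  exact HasCompactSupport.of_compactSpace _

/-- The Fourier coefficient as a continuous linear functional. -/
def coeffCLM (n : ι → ℤ) : C(UnitAddTorus ι, ℝ) →L[ℝ] ℂ :=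
  LinearMap.mkContinuous
    { toFun := fun g => coeff g n
      map_add' := fun g g' => by
        have h := integral_add (integrable_mFourier_smul g n) (integrable_mFourier_smul g' n)
        refine Eq.trans (integral_congr_ae (Filter.Eventually.of_forall fun t => ?_)) h
        simp [mul_add]
      map_smul' := fun c g => by
        have h := integral_const_mul (c : ℂ) (μ := Measure.pi fun _ : ι => AddCircle.haarAddCircle)
          (fun t => UnitAddTorus.mFourier (-n) t • (g t : ℂ))
        refine Eq.trans (integral_congr_ae (Filter.Eventually.of_forall fun t => ?_))
          (h.trans (Complex.real_smul (x := c)).symm)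
        simp [mul_left_comm] } 1 fun g => by
    have h : ∀ t, ‖UnitAddTorus.mFourier (-n) t • (g t : ℂ)‖ ≤ ‖g‖ := fun t => by
      rw [norm_smul, Complex.norm_real]
      calc ‖UnitAddTorus.mFourier (-n) t‖ * ‖g t‖ ≤ 1 * ‖g‖ := by
            refine mul_le_mul ?_ (g.norm_coe_le_norm t) (norm_nonneg _) zero_le_one
            exact (ContinuousMap.norm_coe_le_norm _ t).trans UnitAddTorus.mFourier_norm.le
        _ = ‖g‖ := one_mul _
    have h2 := norm_integral_le_of_norm_le_const
      (μ := Measure.pi fun _ : ι => AddCircle.haarAddCircle) (Filter.Eventually.of_forall h)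
    rw [probReal_univ, mul_one] at h2
    rw [one_mul]
    exact h2

theorem coeffCLM_apply (n : ι → ℤ) (g : C(UnitAddTorus ι, ℝ)) : coeffCLM n g = coeff g n := rfl

theorem coeff_const {d : ℕ} (m : ℝ) (n : Fin d → ℤ) :
    coeff (ContinuousMap.const (UnitAddTorus (Fin d)) m) n = if n = 0 then (m : ℂ) else 0 := by
  have h1 : potentialOp (ContinuousMap.const (UnitAddTorus (Fin d)) m) (torusBasis d 0) =
      (m : ℂ) • torusBasis d 0 := by
    refine Lp.ext ?_
    filter_upwards [potentialOp_ae (ContinuousMap.const (UnitAddTorus (Fin d)) m) (torusBasis d 0),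
      Lp.coeFn_smul (m : ℂ) (torusBasis d 0)] with x h1 h2
    rw [h1, h2]
    rfl
  have h2 := repr_potentialOp_basis (ContinuousMap.const (UnitAddTorus (Fin d)) m) n 0
  rw [sub_zero, h1, (torusBasis d).repr_apply_apply, inner_smul_right,
    orthonormal_iff_ite.mp (torusBasis d).orthonormal] at h2
  rw [← h2]
  split_ifs <;> simp

end Coefficients

/-! ### Tensor products with the identity -/

section Tensor

variable {n a c : Type*} [DecidableEq a]

/-- The matrix `1 ⊗ H` on an index set identified with a product. -/
def blockMatrix (φ : n ≃ a × c) (H : Matrix c c ℂ) : Matrix n n ℂ :=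
  Matrix.of fun i i' => if (φ i).1 = (φ i').1 then H (φ i).2 (φ i').2 else 0

theorem blockMatrix_isHermitian (φ : n ≃ a × c) {H : Matrix c c ℂ} (hH : H.IsHermitian) :
    (blockMatrix φ H).IsHermitian := by
  ext i i'
  simp only [Matrix.conjTranspose_apply, blockMatrix, Matrix.of_apply]
  by_cases h : (φ i).1 = (φ i').1
  · rw [if_pos h, if_pos h.symm]
    exact hH.apply _ _
  · rw [if_neg h, if_neg (Ne.symm h), star_zero]

variable [Fintype n] [Fintype a] [Fintype c] [DecidableEq n] [DecidableEq c]

theorem exists_product_eigenbasis (φ : n ≃ a × c) {H : Matrix c c ℂ} (hH : H.IsHermitian) :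
    ∃ f : OrthonormalBasis (a × c) ℂ (EuclideanSpace ℂ n),
      (∀ p, Matrix.toEuclideanCLM (n := n) (𝕜 := ℂ) (blockMatrix φ H) (f p) =
        (hH.eigenvalues p.2 : ℂ) • f p) ∧
      ∀ (r : a → ℝ) p, diagCLM (fun i => r (φ i).1) (f p) = (r p.1 : ℂ) • f p := by
  let v : a × c → EuclideanSpace ℂ n := fun p =>
    WithLp.toLp 2 fun i => if (φ i).1 = p.1 then hH.eigenvectorBasis p.2 (φ i).2 else 0
  have hv : ∀ p i, v p i = if (φ i).1 = p.1 then hH.eigenvectorBasis p.2 (φ i).2 else 0 :=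
    fun _ _ => rfl
  have hon : Orthonormal ℂ v := by
    rw [orthonormal_iff_ite]
    intro p q
    have h1 : inner ℂ (v p) (v q) =
        ∑ x : a × c, if x.1 = p.1 ∧ x.1 = q.1 then
          inner ℂ (hH.eigenvectorBasis p.2 x.2) (hH.eigenvectorBasis q.2 x.2) else 0 := by
      rw [PiLp.inner_apply, ← φ.sum_comp]
      refine Finset.sum_congr rfl fun i _ => ?_
      rw [hv, hv]
      by_cases h1 : (φ i).1 = p.1
      · by_cases h2 : (φ i).1 = q.1
        · rw [if_pos h1, if_pos h2, if_pos ⟨h1, h2⟩]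
        · rw [if_neg h2, inner_zero_right, if_neg (fun h => h2 h.2)]
      · rw [if_neg h1, inner_zero_left, if_neg (fun h => h1 h.1)]
    rw [h1, Fintype.sum_prod_type]
    have h2 := orthonormal_iff_ite.mp hH.eigenvectorBasis.orthonormal p.2 q.2
    rw [PiLp.inner_apply] at h2
    by_cases hpq : p.1 = q.1
    · rw [Finset.sum_eq_single p.1]
      · simp only [hpq, and_self, if_true]
        rw [h2]
        simp [Prod.ext_iff, hpq]
      · intro x _ hx
        simp [hx]
      · simp
    · rw [if_neg (fun h => hpq (congrArg Prod.fst h))]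
      refine Finset.sum_eq_zero fun x _ => Finset.sum_eq_zero fun y _ => ?_
      rw [if_neg]
      rintro ⟨h, h'⟩
      exact hpq (h.symm.trans h')
  have hspan : ⊤ ≤ Submodule.span ℂ (Set.range v) := by
    rcases isEmpty_or_nonempty (a × c) with he | hne
    · have : IsEmpty n := φ.isEmpty
      intro x _
      rw [Subsingleton.elim x 0]
      exact zero_mem _
    · refine (hon.linearIndependent.span_eq_top_of_card_eq_finrank ?_).ge
      rw [finrank_euclideanSpace, Fintype.card_congr φ]
  refine ⟨OrthonormalBasis.mk hon hspan, fun p => ?_, fun r p => ?_⟩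
  · rw [OrthonormalBasis.coe_mk]
    ext i
    change Matrix.mulVec _ _ i = _
    rw [Matrix.mulVec, dotProduct, PiLp.smul_apply, hv]
    have h1 : ∑ i', blockMatrix φ H i i' * v p i' = ∑ x : a × c,
        if (φ i).1 = x.1 ∧ x.1 = p.1 then
          H (φ i).2 x.2 * hH.eigenvectorBasis p.2 x.2 else 0 := by
      rw [← φ.sum_comp]
      refine Finset.sum_congr rfl fun i' _ => ?_
      rw [hv, blockMatrix, Matrix.of_apply]
      by_cases h1 : (φ i).1 = (φ i').1 <;> by_cases h2 : (φ i').1 = p.1 <;> simp [h1, h2]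
    refine h1.trans ?_
    rw [Fintype.sum_prod_type]
    have h2 := congrFun (hH.mulVec_eigenvectorBasis p.2) (φ i).2
    rw [Matrix.mulVec, dotProduct] at h2
    by_cases hp : (φ i).1 = p.1
    · rw [Finset.sum_eq_single p.1]
      · simp only [hp, and_self, if_true]
        rw [h2]
        simp
      · intro x _ hx
        simp [hx]
      · simp
    · rw [if_neg hp, smul_zero]
      refine Finset.sum_eq_zero fun x _ => Finset.sum_eq_zero fun y _ => ?_
      rw [if_neg]
      rintro ⟨h, h'⟩
      exact hp (h.trans h')
  · rw [OrthonormalBasis.coe_mk]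
    ext i
    rw [diagCLM_apply, PiLp.smul_apply, hv, smul_eq_mul]
    by_cases hp : (φ i).1 = p.1
    · rw [hp]
    · simp [hp]

theorem hasApproxKernel_conj {E F : Type*} [NormedAddCommGroup E] [InnerProductSpace ℂ E]
    [NormedAddCommGroup F] [InnerProductSpace ℂ F] (U : E ≃ₗᵢ[ℂ] F) (A : E →L[ℂ] E)
    (B : F →L[ℂ] F) (h : ∀ v, B (U v) = U (A v)) {α : ℝ} (hA : HasApproxKernel A α) :
    HasApproxKernel B α := by
  obtain ⟨v, hv, hAv⟩ := hA
  refine ⟨U v, by simpa using hv, ?_⟩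
  rwa [h, U.norm_map, U.norm_map]

end Tensor

/-! ### Inverses and approximate kernels -/

theorem hasApproxKernel_of_invNorm {n : Type} [Fintype n] [DecidableEq n] {A : Matrix n n ℂ}
    {K : ℝ} (hK : 0 < K) (h : ENNReal.ofReal K < invNorm A) :
    HasApproxKernel (Matrix.toEuclideanCLM (n := n) (𝕜 := ℂ) A) K⁻¹ := by
  set Φ := Matrix.toEuclideanCLM (n := n) (𝕜 := ℂ) with hΦ
  by_cases hA : IsUnit A
  · rw [invNorm, if_pos hA, opNorm, ENNReal.ofReal_lt_ofReal_iff_of_nonneg hK.le] at h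
    obtain ⟨x, hx⟩ : ∃ x, K * ‖x‖ < ‖Φ A⁻¹ x‖ := by
      by_contra! hc
      exact absurd (ContinuousLinearMap.opNorm_le_bound _ hK.le hc) (not_le.mpr h)
    have hdet := (Matrix.isUnit_iff_isUnit_det A).mp hA
    have hAx : Φ A (Φ A⁻¹ x) = x := by
      have : Φ A * Φ A⁻¹ = 1 := by rw [← map_mul, Matrix.mul_nonsing_inv A hdet, map_one]
      rw [← mul_apply_eq_comp, this]; rfl
    refine ⟨Φ A⁻¹ x, fun h0 => ?_, ?_⟩
    · rw [h0, norm_zero] at hx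
      exact absurd hx (not_lt.mpr (by positivity))
    · rw [hAx, le_inv_mul_iff₀ hK]
      exact hx.le
  · have hdet : A.det = 0 := by
      by_contra hc
      exact hA ((Matrix.isUnit_iff_isUnit_det A).mpr (isUnit_iff_ne_zero.mpr hc))
    obtain ⟨v, hv, hAv⟩ := Matrix.exists_mulVec_eq_zero_iff.mpr hdet
    refine ⟨WithLp.toLp 2 v, by simpa using hv, ?_⟩
    have : Φ A (WithLp.toLp 2 v) = 0 := by
      ext i
      exact congrFun hAv i
    rw [this, norm_zero]
    positivity

theorem norm_toEuclideanCLM_restrict_le {ν d : ℕ} (T : Matrix (Site ν d) (Site ν d) ℂ)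
    (E : Finset (Site ν d)) :
    ENNReal.ofReal ‖Matrix.toEuclideanCLM (n := E) (𝕜 := ℂ) (restrict T E)‖ ≤ opNormInf T :=
  le_iSup (fun E => opNorm (restrict T E)) E

/-! ### The restricted operators -/

section Sites

variable {ν d : ℕ}

/-- The sites of a product box as a product. -/
def siteEquiv (s : Finset (Fin ν → ℤ)) (t : Finset (Fin d → ℤ)) :
    (s ×ˢ t : Finset (Site ν d)) ≃ s × t where
  toFun i := (⟨i.1.1, (Finset.mem_product.mp i.2).1⟩, ⟨i.1.2, (Finset.mem_product.mp i.2).2⟩)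
  invFun p := ⟨(p.1.1, p.2.1), Finset.mem_product.mpr ⟨p.1.2, p.2.2⟩⟩
  left_inv _ := rfl
  right_inv _ := rfl

/-- The compression of the multiplication by `g` to finitely many sites, linearly in `g`. -/
def multOp (E : Finset (Site ν d)) : C(SpaceTime ν d, ℝ) →L[ℝ]
    EuclideanSpace ℂ E →L[ℂ] EuclideanSpace ℂ E where
  toFun g := Matrix.toEuclideanCLM (n := E) (𝕜 := ℂ) (restrict (multMatrix g) E)
  map_add' g g' := by
    rw [← map_add]
    congr 1
    ext i i'
    exact map_add (coeffCLM _) g g'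
  map_smul' c g := by
    have h : restrict (multMatrix (c • g)) E = (c : ℂ) • restrict (multMatrix g) E := by
      ext i i'
      exact (map_smul (coeffCLM _) c g).trans (Complex.real_smul (x := c))
    rw [h, map_smul]
    rfl
  cont := by
    have h1 : Continuous fun A : Matrix E E ℂ => Matrix.toEuclideanCLM (n := E) (𝕜 := ℂ) A :=
      LinearMap.continuous_of_finiteDimensional
        (Matrix.toEuclideanCLM (n := E) (𝕜 := ℂ)).toAlgEquiv.toLinearMap
    refine h1.comp ?_
    exact continuous_matrix fun i i' => (coeffCLM _).continuous

theorem multOp_apply (E : Finset (Site ν d)) (g : C(SpaceTime ν d, ℝ)) :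
    multOp E g = Matrix.toEuclideanCLM (n := E) (𝕜 := ℂ) (restrict (multMatrix g) E) := rfl

theorem multOp_isSymmetric (E : Finset (Site ν d)) (g : C(SpaceTime ν d, ℝ)) :
    (multOp E g : EuclideanSpace ℂ E →ₗ[ℂ] EuclideanSpace ℂ E).IsSymmetric := by
  refine isSymmetric_toEuclideanCLM (M := restrict (multMatrix g) E) ?_
  ext i i'
  simp only [Matrix.conjTranspose_apply, restrict, Matrix.submatrix_apply, multMatrix,
    Matrix.of_apply]
  rw [← coeff_neg]
  congr 1
  funext k
  rcases k with k | k <;> simp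

/-- The operator `-Δ + V`, acting in the space variables only, compressed to a product box. -/
def spaceOp (V : C(UnitAddTorus (Fin d), ℝ)) (s : Finset (Fin ν → ℤ)) (t : Finset (Fin d → ℤ)) :
    EuclideanSpace ℂ (s ×ˢ t : Finset (Site ν d)) →L[ℂ]
      EuclideanSpace ℂ (s ×ˢ t : Finset (Site ν d)) :=
  Matrix.toEuclideanCLM (n := (s ×ˢ t : Finset (Site ν d))) (𝕜 := ℂ)
    (blockMatrix (siteEquiv s t) (restrictedMatrix V t))

theorem spaceOp_isSymmetric (V : C(UnitAddTorus (Fin d), ℝ)) (s : Finset (Fin ν → ℤ))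
    (t : Finset (Fin d → ℤ)) :
    (spaceOp V s t : EuclideanSpace ℂ (s ×ˢ t : Finset (Site ν d)) →ₗ[ℂ]
      EuclideanSpace ℂ (s ×ˢ t : Finset (Site ν d))).IsSymmetric :=
  isSymmetric_toEuclideanCLM (blockMatrix_isHermitian _ (restrictedMatrix_isHermitian V t))

/-- The scalar product of a frequency with an integer vector. -/
def freq (ω : Fin ν → ℝ) (l : Fin ν → ℤ) : ℝ := ∑ a, ω a * (l a : ℝ)

/-- The operator with matrix `A_{M,j₀}(ε, λ, θ)`. -/
def centeredOp (V : C(UnitAddTorus (Fin d), ℝ)) (ω : Fin ν → ℝ) (ε : ℝ)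
    (g : ℝ → C(SpaceTime ν d, ℝ)) (M : ℕ) (j₀ : Fin d → ℤ) (lam θ : ℝ) :
    EuclideanSpace ℂ (box M (0 : Fin ν → ℤ) ×ˢ box M j₀ : Finset (Site ν d)) →L[ℂ]
      EuclideanSpace ℂ (box M (0 : Fin ν → ℤ) ×ˢ box M j₀ : Finset (Site ν d)) :=
  Matrix.toEuclideanCLM (n := (box M (0 : Fin ν → ℤ) ×ˢ box M j₀ : Finset (Site ν d))) (𝕜 := ℂ)
    (centeredMatrix (fullMatrix V ω ε g lam θ) M j₀)

theorem centeredOp_eq (V : C(UnitAddTorus (Fin d), ℝ)) (ω : Fin ν → ℝ) (ε : ℝ)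
    (g : ℝ → C(SpaceTime ν d, ℝ)) (M : ℕ) (j₀ : Fin d → ℤ) (lam θ : ℝ) :
    centeredOp V ω ε g M j₀ lam θ =
      diagCLM (fun i => -(lam * freq ω i.1.1 + θ) ^ 2) +
        (spaceOp V (box M 0) (box M j₀) - ε • multOp (box M 0 ×ˢ box M j₀) (g lam)) := by
  have hε : ε • multOp (box M (0 : Fin ν → ℤ) ×ˢ box M j₀) (g lam) =
      Matrix.toEuclideanCLM (𝕜 := ℂ)
        ((ε : ℂ) • restrict (multMatrix (g lam)) (box M (0 : Fin ν → ℤ) ×ˢ box M j₀)) := by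
    rw [map_smul, multOp_apply]
    rfl
  rw [hε, spaceOp, diagCLM, centeredOp, ← map_sub, ← map_add]
  congr 1
  ext i i'
  have hV : coeff (V - ContinuousMap.const _ (average V)) (i.1.2 - i'.1.2) =
      coeff V (i.1.2 - i'.1.2) - if i.1.2 = i'.1.2 then (average V : ℂ) else 0 := by
    rw [← coeffCLM_apply, map_sub, coeffCLM_apply, coeffCLM_apply, coeff_const]
    simp only [sub_eq_zero]
  simp only [centeredMatrix, restrict, fullMatrix, diagMatrix, potentialMatrix, blockMatrix,
    Matrix.add_apply, Matrix.sub_apply, Matrix.smul_apply, Matrix.submatrix_apply,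
    Matrix.of_apply, hV, restrictedMatrix, Matrix.diagonal_apply, siteEquiv, Equiv.coe_fn_mk,
    Subtype.mk.injEq]
  have hii : (i : Site ν d) = i' ↔ i.1.1 = i'.1.1 ∧ i.1.2 = i'.1.2 := Prod.ext_iff
  by_cases h1 : i.1.1 = i'.1.1
  · by_cases h2 : i.1.2 = i'.1.2
    · have h : i = i' := Subtype.ext (hii.mpr ⟨h1, h2⟩)
      subst h
      simp only [if_true]
      push_cast
      unfold freq
      push_cast
      ring
    · have h : ¬ (i : Site ν d) = i' := fun h => h2 (hii.mp h).2
      have h' : ¬ i = i' := fun h' => h (congrArg Subtype.val h')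
      simp only [h, h', h1, h2, if_true, if_false, sub_zero, zero_add]
  · have h : ¬ (i : Site ν d) = i' := fun h => h1 (hii.mp h).1
    have h' : ¬ i = i' := fun h' => h (congrArg Subtype.val h')
    simp only [h, h', h1, if_false]

theorem le_eigenvalues_restrictedMatrix (V : C(UnitAddTorus (Fin d), ℝ))
    (B : Finset (Fin d → ℤ)) {c : ℝ} (hc : ∀ j ∈ B, c ≤ sqNorm j) (a : B) :
    c - ‖potentialOp V‖ ≤ (restrictedMatrix_isHermitian V B).eigenvalues a := by
  have h := le_quadForm_restrictedMatrix V B hc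
    ((restrictedMatrix_isHermitian V B).eigenvectorBasis a)
  rw [quadForm, toEuclideanCLM_eigenvectorBasis, inner_smul_left, Complex.conj_ofReal,
    Complex.re_ofReal_mul, inner_self_eq_norm_sq_to_K, OrthonormalBasis.norm_eq_one] at h
  simpa using h

theorem eigenvalues_restrictedMatrix_le (V : C(UnitAddTorus (Fin d), ℝ))
    (B : Finset (Fin d → ℤ)) {c : ℝ} (hc : ∀ j ∈ B, sqNorm j ≤ c) (a : B) :
    (restrictedMatrix_isHermitian V B).eigenvalues a ≤ c + ‖potentialOp V‖ := by
  have h := quadForm_restrictedMatrix_le V B hc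
    ((restrictedMatrix_isHermitian V B).eigenvectorBasis a)
  rw [quadForm, toEuclideanCLM_eigenvectorBasis, inner_smul_left, Complex.conj_ofReal,
    Complex.re_ofReal_mul, inner_self_eq_norm_sq_to_K, OrthonormalBasis.norm_eq_one] at h
  simpa using h

theorem le_quadForm_spaceOp (V : C(UnitAddTorus (Fin d), ℝ)) (s : Finset (Fin ν → ℤ))
    (t : Finset (Fin d → ℤ)) {c : ℝ} (hc : ∀ j ∈ t, c ≤ sqNorm j)
    (v : EuclideanSpace ℂ (s ×ˢ t : Finset (Site ν d))) :
    (c - ‖potentialOp V‖) * ‖v‖ ^ 2 ≤ quadForm (spaceOp V s t) v := by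
  obtain ⟨f, hf, -⟩ := exists_product_eigenbasis (siteEquiv s t) (restrictedMatrix_isHermitian V t)
  exact quadForm_le_of_eigenbasis _ (spaceOp_isSymmetric V s t) f _ hf v _
    fun p _ => le_eigenvalues_restrictedMatrix V t hc p.2

theorem quadForm_spaceOp_le (V : C(UnitAddTorus (Fin d), ℝ)) (s : Finset (Fin ν → ℤ))
    (t : Finset (Fin d → ℤ)) {c : ℝ} (hc : ∀ j ∈ t, sqNorm j ≤ c)
    (v : EuclideanSpace ℂ (s ×ˢ t : Finset (Site ν d))) :
    quadForm (spaceOp V s t) v ≤ (c + ‖potentialOp V‖) * ‖v‖ ^ 2 := by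
  obtain ⟨f, hf, -⟩ := exists_product_eigenbasis (siteEquiv s t) (restrictedMatrix_isHermitian V t)
  have h := quadForm_le_of_eigenbasis (-spaceOp V s t)
    (fun x y => by simpa using spaceOp_isSymmetric V s t x y) f
    (fun p => -(restrictedMatrix_isHermitian V t).eigenvalues p.2)
    (fun p => by
      rw [neg_apply, Complex.ofReal_neg, neg_smul]
      exact congrArg Neg.neg (hf p)) v (-(c + ‖potentialOp V‖))
    fun p _ => neg_le_neg (eigenvalues_restrictedMatrix_le V t hc p.2)
  rw [quadForm_neg] at h
  linarith

end Sites

/-! ### Boxes away from the sites close to the origin -/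

section Boxes

variable {d : ℕ}

theorem mem_box {M : ℕ} {j₀ j : Fin d → ℤ} : j ∈ box M j₀ ↔ ∀ a, |j a - j₀ a| ≤ M := by
  simp only [box, Finset.mem_Icc, Pi.le_def, abs_le]
  constructor
  · intro h a
    have h1 := h.1 a
    have h2 := h.2 a
    constructor <;> linarith
  · intro h
    refine ⟨fun a => ?_, fun a => ?_⟩ <;> have := h a <;> linarith

theorem norm_sub_le_of_mem_box {M : ℕ} {j₀ j : Fin d → ℤ} (h : j ∈ box M j₀) :
    ‖j - j₀‖ ≤ M := by
  rw [pi_norm_le_iff_of_nonneg (by positivity)]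
  intro a
  rw [Int.norm_eq_abs, Pi.sub_apply]
  exact_mod_cast mem_box.mp h a

theorem card_box (M : ℕ) (j₀ : Fin d → ℤ) : (box M j₀).card = (2 * M + 1) ^ d := by
  rw [box, Pi.card_Icc]
  simp only [Int.card_Icc]
  rw [Finset.prod_congr rfl (g := fun _ => 2 * M + 1) fun a _ => by
    have : j₀ a + M + 1 - (j₀ a - M) = ((2 * M + 1 : ℕ) : ℤ) := by push_cast; ring
    rw [this, Int.toNat_natCast]]
  simp

theorem norm_le_iff_forall_abs {j : Fin d → ℤ} {r : ℤ} (hr : 0 ≤ r) :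
    ‖j‖ ≤ r ↔ ∀ a, |j a| ≤ r := by
  rw [pi_norm_le_iff_of_nonneg (by exact_mod_cast hr)]
  refine forall_congr' fun a => ?_
  rw [Int.norm_eq_abs]
  exact_mod_cast Iff.rfl

/-- A box with boundary at distance at least `L` from the origin avoids a ball or contains one. -/
theorem box_disjoint_or_contains {L M : ℕ} {j₀ : Fin d → ℤ}
    (hb : ∀ j ∈ innerBoundary (box M j₀), (L : ℝ) ≤ ‖j‖) :
    (∀ j : Fin d → ℤ, ‖j‖ ≤ (L : ℝ) - 1 → j ∉ box M j₀) ∨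
      ∀ j : Fin d → ℤ, ‖j‖ ≤ (L : ℝ) → j ∈ box M j₀ := by
  by_contra! hcon
  obtain ⟨⟨j, hj, hjB⟩, i, hi, hiB⟩ := hcon
  have hL1 : (1 : ℤ) ≤ L := by
    have : (0 : ℝ) ≤ (L : ℝ) - 1 := (norm_nonneg j).trans hj
    have : (1 : ℝ) ≤ L := by linarith
    exact_mod_cast this
  have hj' : ∀ a, |j a| ≤ (L : ℤ) - 1 :=
    (norm_le_iff_forall_abs (by linarith)).mp (by push_cast; exact hj)
  have hi' : ∀ a, |i a| ≤ (L : ℤ) := (norm_le_iff_forall_abs (by linarith)).mp (by exact_mod_cast hi)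
  have hjB' := mem_box.mp hjB
  obtain ⟨a, ha⟩ : ∃ a, (M : ℤ) < |i a - j₀ a| := by
    by_contra! hc
    exact hiB (mem_box.mpr hc)
  obtain ⟨σ, hσ, hpa, hqa⟩ : ∃ σ : ℤ, |σ| = 1 ∧ |j₀ a + σ * M| ≤ (L : ℤ) - 1 ∧
      |j₀ a + σ * M + σ - j₀ a| > M := by
    have h1 := abs_le.mp (hj' a)
    have h2 := abs_le.mp (hi' a)
    have h3 := abs_le.mp (hjB' a)
    rcases lt_abs.mp ha with h | h
    · refine ⟨1, by simp, abs_le.mpr ⟨by linarith, by linarith⟩, ?_⟩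
      rw [gt_iff_lt, lt_abs]; left; linarith
    · refine ⟨-1, by simp, abs_le.mpr ⟨by linarith, by linarith⟩, ?_⟩
      rw [gt_iff_lt, lt_abs]; right; linarith
  set p : Fin d → ℤ := Function.update j a (j₀ a + σ * M) with hp
  set q : Fin d → ℤ := Function.update j a (j₀ a + σ * M + σ) with hq
  have hpB : p ∈ box M j₀ := by
    rw [mem_box]
    intro k
    by_cases hk : k = a
    · subst hk
      rw [hp, Function.update_self, add_sub_cancel_left, abs_mul, hσ, one_mul, Nat.abs_cast]
    · rw [hp, Function.update_of_ne hk]; exact hjB' k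
  have hqB : q ∉ box M j₀ := by
    rw [mem_box]
    intro h
    have := h a
    rw [hq, Function.update_self] at this
    exact absurd this (not_le.mpr hqa)
  have hpq : ‖p - q‖ = 1 := by
    refine le_antisymm ?_ ?_
    · rw [pi_norm_le_iff_of_nonneg zero_le_one]
      intro k
      by_cases hk : k = a
      · subst hk
        simp only [hp, hq, Pi.sub_apply, Function.update_self, sub_add_cancel_left, norm_neg]
        rw [Int.norm_eq_abs]
        exact_mod_cast hσ.le
      · simp [hp, hq, Function.update_of_ne hk]
    · refine le_trans (le_of_eq ?_) (norm_le_pi_norm (p - q) a)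
      simp only [hp, hq, Pi.sub_apply, Function.update_self, sub_add_cancel_left, norm_neg]
      rw [Int.norm_eq_abs]
      exact_mod_cast hσ.symm
  have hpn : ‖p‖ ≤ ((L - 1 : ℤ) : ℝ) := by
    rw [norm_le_iff_forall_abs (by linarith)]
    intro k
    by_cases hk : k = a
    · subst hk
      rw [hp, Function.update_self]; exact hpa
    · rw [hp, Function.update_of_ne hk]; exact hj' k
  have := hb p ⟨hpB, q, hqB, hpq⟩
  push_cast at hpn
  linarith

theorem gapConst_le_abs_eigenvalues {V : C(UnitAddTorus (Fin d), ℝ)} {L₀ : ℕ}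
    (hL : IsSpectralLength V L₀) {M : ℕ} {j₀ : Fin d → ℤ} (hj₀ : j₀ ∉ nearOrigin d L₀ M)
    (a : box M j₀) :
    gapConst V ≤ |(restrictedMatrix_isHermitian V (box M j₀)).eigenvalues a| := by
  have hb : ∀ j ∈ innerBoundary (box M j₀), (L₀ : ℝ) ≤ ‖j‖ := fun j hj => by
    by_contra! hc
    exact hj₀ ⟨j, hj, hc⟩
  obtain ⟨h1, h2⟩ := hL (box M j₀) ⟨a.1, a.2⟩ hb
  rcases box_disjoint_or_contains hb with h | h
  · exact (h1 h a).trans (le_abs_self _)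
  · rcases (h2 h).2 a with h | h
    · exact le_trans (by linarith) (neg_le_abs _)
    · exact h.trans (le_abs_self _)

end Boxes

/-! ### From measure to complexity -/

/-- A set whose `ρ`-neighbourhood has small measure is covered by few intervals of length `r`. -/
theorem coveredByIntervals_of_volume_le {S S' : Set ℝ} {K : ℕ} {r ρ : ℝ} (hρ : 0 < ρ)
    (hρr : ρ ≤ r / 2) (hS : ∀ s ∈ S, ∀ t, |t - s| ≤ ρ → t ∈ S')
    (hvol : volume S' ≤ ENNReal.ofReal (K * ρ)) : CoveredByIntervals S K r := by
  classical
  have hr : 0 < r := by linarith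
  set G : Set ℤ := (fun s => ⌊s / r⌋) '' S with hG
  have hcell : ∀ s : ℝ, (⌊s / r⌋ : ℝ) * r ≤ s ∧ s < (⌊s / r⌋ : ℝ) * r + r := fun s => by
    have h1 := Int.floor_le (s / r)
    have h2 := Int.lt_floor_add_one (s / r)
    rw [le_div_iff₀ hr] at h1
    rw [div_lt_iff₀ hr] at h2
    exact ⟨h1, by linarith⟩
  have hJ : ∀ k ∈ G, ∃ u : ℝ, Set.Ico u (u + ρ) ⊆ S' ∧
      Set.Ico u (u + ρ) ⊆ Set.Ico ((k : ℝ) * r) (k * r + r) := by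
    rintro k ⟨s, hs, rfl⟩
    have hc := hcell s
    simp only
    by_cases hlt : s ≤ (⌊s / r⌋ : ℝ) * r + r / 2
    · refine ⟨s, fun t ht => hS s hs t ?_, fun t ht => ⟨hc.1.trans ht.1, by linarith [ht.2]⟩⟩
      rw [abs_le]; constructor <;> linarith [ht.1, ht.2]
    · refine ⟨s - ρ, fun t ht => hS s hs t ?_, fun t ht => ⟨?_, ?_⟩⟩
      · rw [abs_le]; constructor <;> linarith [ht.1, ht.2]
      · linarith [ht.1]
      · linarith [ht.2]
  choose! u hu using hJ
  have hcard : ∀ F : Finset ℤ, (F : Set ℤ) ⊆ G → F.card ≤ K := by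
    intro F hF
    have hdis : Set.PairwiseDisjoint (F : Set ℤ) fun k => Set.Ico (u k) (u k + ρ) := by
      intro k hk k' hk' hne
      refine Set.disjoint_left.mpr fun t ht ht' => hne ?_
      have h1 := (hu k (hF hk)).2 ht
      have h2 := (hu k' (hF hk')).2 ht'
      have e1 : (k : ℝ) < k' + 1 := by
        by_contra! hc
        nlinarith [h1.1, h2.2]
      have e2 : (k' : ℝ) < k + 1 := by
        by_contra! hc
        nlinarith [h2.1, h1.2]
      have e1' : k < k' + 1 := by exact_mod_cast e1
      have e2' : k' < k + 1 := by exact_mod_cast e2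
      omega
    have h1 : volume (⋃ k ∈ F, Set.Ico (u k) (u k + ρ)) = F.card * ENNReal.ofReal ρ := by
      rw [measure_biUnion_finset hdis fun _ _ => measurableSet_Ico]
      simp [Real.volume_Ico]
    have h2 : volume (⋃ k ∈ F, Set.Ico (u k) (u k + ρ)) ≤ volume S' :=
      measure_mono (Set.iUnion₂_subset fun k hk => (hu k (hF hk)).1)
    rw [h1] at h2
    have h3 := h2.trans hvol
    rw [← ENNReal.ofReal_natCast, ← ENNReal.ofReal_mul (by positivity),
      ENNReal.ofReal_le_ofReal_iff (by positivity)] at h3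
    exact_mod_cast le_of_mul_le_mul_right h3 hρ
  have hfin : G.Finite := by
    by_contra hinf
    obtain ⟨F, hF, hFc⟩ := Set.Infinite.exists_subset_card_eq hinf (K + 1)
    have := hcard F hF
    omega
  set F := hfin.toFinset with hFdef
  have hFK : F.card ≤ K := hcard F (by simp [hFdef])
  refine CoveredByIntervals.mono (S := S) (K := F.card) (r := r) ?_ le_rfl hFK le_rfl
  refine ⟨fun q => Set.Ico ((F.equivFin.symm q : ℤ) * r) ((F.equivFin.symm q : ℤ) * r + r),
    fun q => ⟨Set.ordConnected_Ico, by simp [Real.volume_Ico]⟩, fun s hs => ?_⟩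
  have hk : ⌊s / r⌋ ∈ F := by
    rw [hFdef, Set.Finite.mem_toFinset]
    exact ⟨s, hs, rfl⟩
  refine Set.mem_iUnion.mpr ⟨F.equivFin ⟨_, hk⟩, ?_⟩
  rw [Equiv.symm_apply_apply]
  exact hcell s

/-- Averaging over the parameters: if the bad parameters `λ` along every line `θ = λ η` are few,
then for most `λ` the bad `θ` are covered by few intervals. -/
theorem volume_not_covered_le {X : Type*} [NormedAddCommGroup X] [NormedSpace ℂ X]
    [FiniteDimensional ℂ X] (A : ℝ → ℝ → X →L[ℂ] X)
    (hA : ContinuousOn (Function.uncurry A) (Lam ×ˢ Set.univ))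
    {α R R₁ ρ r δ : ℝ} {K n : ℕ} (hK : 0 < K) (hρ : 0 < ρ) (hρr : ρ ≤ r / 2) (hδ : 0 ≤ δ)
    (hR₁ : 0 ≤ R₁) (hR : 2 * (R₁ + ρ) ≤ R)
    (hbound : ∀ t ∈ Lam, ∀ θ, HasApproxKernel (A t θ) α → |θ| ≤ R₁)
    (hfat : ∀ t ∈ Lam, ∀ θ, HasApproxKernel (A t θ) α → ∀ θ', |θ' - θ| ≤ ρ →
      HasApproxKernel (A t θ') (2 * α))
    (hcov : ∀ η, CoveredByIntervals {t | t ∈ Lam ∧ HasApproxKernel (A t (t * η)) (2 * α)} n δ) :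
    volume {t | t ∈ Lam ∧ ¬ CoveredByIntervals {θ | HasApproxKernel (A t θ) α} K r} ≤
      ENNReal.ofReal (4 * R * n * δ / (K * ρ)) := by
  have : ProperSpace X := FiniteDimensional.proper ℂ X
  have hR0 : 0 ≤ R := by linarith
  set D : Set (ℝ × ℝ) := {p | p.1 ∈ Lam ∧ p.2 ∈ Set.Icc (-R) R ∧
    HasApproxKernel (A p.1 (p.1 * p.2)) (2 * α)} with hD
  have hclosed : MeasurableSet D := by
    set Q : Set ((ℝ × ℝ) × X) := (Lam ×ˢ Set.Icc (-R) R) ×ˢ Metric.sphere (0 : X) 1 with hQ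
    have hQc : IsCompact Q := (isCompact_Icc.prod isCompact_Icc).prod (isCompact_sphere _ _)
    have hcont : ContinuousOn (fun z : (ℝ × ℝ) × X => ‖A z.1.1 (z.1.1 * z.1.2) z.2‖) Q := by
      refine ContinuousOn.norm (ContinuousOn.clm_apply ?_ continuous_snd.continuousOn)
      exact hA.comp (f := fun z : (ℝ × ℝ) × X => (z.1.1, z.1.1 * z.1.2))
        (Continuous.continuousOn (by fun_prop)) fun z hz => ⟨hz.1.1, Set.mem_univ _⟩
    have hcl := hcont.preimage_isClosed_of_isClosed hQc.isClosed (isClosed_Iic (a := 2 * α))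
    have himg : D = Prod.fst '' (Q ∩ (fun z : (ℝ × ℝ) × X =>
        ‖A z.1.1 (z.1.1 * z.1.2) z.2‖) ⁻¹' Set.Iic (2 * α)) := by
      ext p
      constructor
      · rintro ⟨h1, h2, v, hv, hAv⟩
        have hvn : 0 < ‖v‖ := norm_pos_iff.mpr hv
        refine ⟨(p, ((‖v‖⁻¹ : ℝ) : ℂ) • v), ⟨⟨⟨h1, h2⟩, ?_⟩, ?_⟩, rfl⟩
        · rw [mem_sphere_zero_iff_norm, norm_smul, Complex.norm_real, Real.norm_eq_abs,
            abs_of_pos (by positivity), inv_mul_cancel₀ hvn.ne']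
        · simp only [Set.mem_preimage, Set.mem_Iic, map_smul]
          rw [norm_smul, Complex.norm_real, Real.norm_eq_abs, abs_of_pos (by positivity),
            inv_mul_le_iff₀ hvn]
          linarith
      · rintro ⟨⟨p', v⟩, ⟨⟨⟨h1, h2⟩, h3⟩, h4⟩, rfl⟩
        rw [mem_sphere_zero_iff_norm] at h3
        refine ⟨h1, h2, v, fun h0 => by simp [h0] at h3, ?_⟩
        simp only at h3
        rw [h3, mul_one]
        exact h4
    rw [himg]
    exact ((hQc.of_isClosed_subset hcl Set.inter_subset_left).image
      continuous_fst).isClosed.measurableSet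
  have hvolD : volume D ≤ ENNReal.ofReal (2 * R * n * δ) := by
    rw [Measure.volume_eq_prod, Measure.prod_apply_symm hclosed]
    have h1 : ∀ η, volume ((fun x => (x, η)) ⁻¹' D) ≤
        (Set.Icc (-R) R).indicator (fun _ => (n : ℝ≥0∞) * ENNReal.ofReal δ) η := by
      intro η
      by_cases hη : η ∈ Set.Icc (-R) R
      · rw [Set.indicator_of_mem hη]
        refine (measure_mono ?_).trans (hcov η).volume_le
        rintro t ⟨ht, -, hk⟩
        exact ⟨ht, hk⟩
      · rw [Set.indicator_of_notMem hη]
        have : (fun x => (x, η)) ⁻¹' D = ∅ := by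
          ext t
          simp only [Set.mem_preimage, Set.mem_empty_iff_false, iff_false]
          exact fun h => hη h.2.1
        rw [this, measure_empty]
    refine (lintegral_mono h1).trans (le_of_eq ?_)
    rw [lintegral_indicator measurableSet_Icc, setLIntegral_const, Real.volume_Icc,
      ← ENNReal.ofReal_natCast, ← ENNReal.ofReal_mul (by positivity),
      ← ENNReal.ofReal_mul (by positivity)]
    congr 1
    ring
  have hmarkov : ENNReal.ofReal (K * ρ / 2) *
      volume {t : ℝ | ENNReal.ofReal (K * ρ / 2) ≤ volume (Prod.mk t ⁻¹' D)} ≤ volume D := by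
    rw [Measure.volume_eq_prod, Measure.prod_apply hclosed]
    exact mul_meas_ge_le_lintegral (measurable_measure_prodMk_left hclosed) _
  have hsub : {t | t ∈ Lam ∧ ¬ CoveredByIntervals {θ | HasApproxKernel (A t θ) α} K r} ⊆
      {t | ENNReal.ofReal (K * ρ / 2) ≤ volume (Prod.mk t ⁻¹' D)} := by
    rintro t ⟨ht, hnot⟩
    by_contra hlt
    simp only [Set.mem_ofPred_eq, not_le] at hlt
    have ht0 : (1 : ℝ) / 2 ≤ t ∧ t ≤ 3 / 2 := ht
    have htpos : 0 < t := by linarith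
    refine hnot (coveredByIntervals_of_volume_le
      (S' := (fun θ => t⁻¹ * θ) ⁻¹' (Prod.mk t ⁻¹' D)) hρ hρr ?_ ?_)
    · intro θ hθ θ' hθ'
      have h1 := hbound t ht θ hθ
      have h2 := hfat t ht θ hθ θ' hθ'
      have h3 : |θ'| ≤ R₁ + ρ := by
        have := abs_add_le (θ' - θ) θ
        rw [sub_add_cancel] at this
        linarith
      refine ⟨ht, abs_le.mp ?_, ?_⟩
      · simp only
        rw [abs_mul, abs_of_pos (inv_pos.mpr htpos), inv_mul_le_iff₀ htpos]
        nlinarith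
      · simp only
        rwa [mul_inv_cancel_left₀ htpos.ne']
    · rw [Real.volume_preimage_mul_left (inv_ne_zero htpos.ne'), inv_inv, abs_of_pos htpos]
      calc ENNReal.ofReal t * volume (Prod.mk t ⁻¹' D)
          ≤ ENNReal.ofReal 2 * ENNReal.ofReal (K * ρ / 2) := by
            gcongr
            linarith
        _ = ENNReal.ofReal (K * ρ) := by
            rw [← ENNReal.ofReal_mul (by norm_num)]
            congr 1
            ring
  refine (measure_mono hsub).trans ?_
  have hKρ : 0 < (K : ℝ) * ρ := by positivity
  have hpos : 0 < K * ρ / 2 := by positivity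
  have h1 := hmarkov.trans hvolD
  rw [mul_comm, ← ENNReal.le_div_iff_mul_le (Or.inl (by simpa using hpos))
    (Or.inl ENNReal.ofReal_ne_top), ← ENNReal.ofReal_div_of_pos hpos] at h1
  refine h1.trans (le_of_eq ?_)
  congr 1
  field_simp
  ring

/-! ### Bounds on the approximate kernels of the linearized operators -/

section Diagonal

variable {κ : Type*} [Fintype κ] [DecidableEq κ]

theorem abs_quadForm_le_of_approx {E : Type*} [NormedAddCommGroup E] [InnerProductSpace ℂ E]
    (A : E →L[ℂ] E) {α : ℝ} {v : E} (h : ‖A v‖ ≤ α * ‖v‖) : |quadForm A v| ≤ α * ‖v‖ ^ 2 := by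
  calc |quadForm A v| ≤ ‖inner ℂ (A v) v‖ := Complex.abs_re_le_norm _
    _ ≤ ‖A v‖ * ‖v‖ := norm_inner_le_norm _ _
    _ ≤ α * ‖v‖ * ‖v‖ := by gcongr
    _ = α * ‖v‖ ^ 2 := by ring

theorem exists_le_sq_of_hasApproxKernel (y : κ → ℝ)
    (S W : EuclideanSpace ℂ κ →L[ℂ] EuclideanSpace ℂ κ) {a c α : ℝ}
    (hS : ∀ v, a * ‖v‖ ^ 2 ≤ quadForm S v) (hW : ‖W‖ ≤ c)
    (h : HasApproxKernel (diagCLM (fun k => -(y k) ^ 2) + (S - W)) α) :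
    ∃ k, a - c - α ≤ y k ^ 2 := by
  obtain ⟨v, hv, hAv⟩ := h
  have h1 := (abs_le.mp (abs_quadForm_le_of_approx _ hAv)).2
  rw [quadForm_add, quadForm_sub, quadForm_diagCLM] at h1
  have h3 := (abs_le.mp (abs_quadForm_le W v)).2
  have h4 := mul_le_mul_of_nonneg_right hW (sq_nonneg ‖v‖)
  have h2 : ∑ k, (a - c - α) * ‖v k‖ ^ 2 ≤ ∑ k, y k ^ 2 * ‖v k‖ ^ 2 := by
    rw [← Finset.mul_sum, ← EuclideanSpace.norm_sq_eq]
    simp only [neg_mul, Finset.sum_neg_distrib] at h1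
    linarith [hS v]
  by_contra! hcon
  obtain ⟨k, hk⟩ : ∃ k, v k ≠ 0 := by
    by_contra! h0
    exact hv (by ext k; exact h0 k)
  refine absurd h2 (not_le.mpr (Finset.sum_lt_sum (fun i _ => ?_) ⟨k, Finset.mem_univ _, ?_⟩))
  · exact mul_le_mul_of_nonneg_right (hcon i).le (by positivity)
  · have := norm_pos_iff.mpr hk
    exact mul_lt_mul_of_pos_right (hcon k) (by positivity)

theorem exists_sq_le_of_hasApproxKernel (y : κ → ℝ)
    (S W : EuclideanSpace ℂ κ →L[ℂ] EuclideanSpace ℂ κ) {b c α : ℝ}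
    (hS : ∀ v, quadForm S v ≤ b * ‖v‖ ^ 2) (hW : ‖W‖ ≤ c)
    (h : HasApproxKernel (diagCLM (fun k => -(y k) ^ 2) + (S - W)) α) :
    ∃ k, y k ^ 2 ≤ b + c + α := by
  obtain ⟨v, hv, hAv⟩ := h
  have h1 := (abs_le.mp (abs_quadForm_le_of_approx _ hAv)).1
  rw [quadForm_add, quadForm_sub, quadForm_diagCLM] at h1
  have h3 := (abs_le.mp (abs_quadForm_le W v)).1
  have h4 := mul_le_mul_of_nonneg_right hW (sq_nonneg ‖v‖)
  have h2 : ∑ k, y k ^ 2 * ‖v k‖ ^ 2 ≤ ∑ k, (b + c + α) * ‖v k‖ ^ 2 := by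
    rw [← Finset.mul_sum, ← EuclideanSpace.norm_sq_eq]
    simp only [neg_mul, Finset.sum_neg_distrib] at h1
    linarith [hS v]
  by_contra! hcon
  obtain ⟨k, hk⟩ : ∃ k, v k ≠ 0 := by
    by_contra! h0
    exact hv (by ext k; exact h0 k)
  refine absurd h2 (not_le.mpr (Finset.sum_lt_sum (fun i _ => ?_) ⟨k, Finset.mem_univ _, ?_⟩))
  · exact mul_le_mul_of_nonneg_right (hcon i).le (by positivity)
  · have := norm_pos_iff.mpr hk
    exact mul_lt_mul_of_pos_right (hcon k) (by positivity)

theorem hasApproxKernel_of_phase_close (x : κ → ℝ)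
    (Q : EuclideanSpace ℂ κ →L[ℂ] EuclideanSpace ℂ κ) {X R ρ α θ θ' : ℝ}
    (hx : ∀ k, |x k| ≤ X) (hX : 0 ≤ X) (hθ : |θ| ≤ R) (hρ : |θ' - θ| ≤ ρ) (hρ1 : ρ ≤ 1)
    (hα : ρ * (2 * X + 2 * R + 1) ≤ α)
    (h : HasApproxKernel (diagCLM (fun k => -(x k + θ) ^ 2) + Q) α) :
    HasApproxKernel (diagCLM (fun k => -(x k + θ') ^ 2) + Q) (2 * α) := by
  obtain ⟨v, hv, hAv⟩ := h
  have hρ0 : 0 ≤ ρ := (abs_nonneg _).trans hρ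
  have hR0 : 0 ≤ R := (abs_nonneg _).trans hθ
  have hnorm : ‖diagCLM (fun k => -(x k + θ') ^ 2 - -(x k + θ) ^ 2)‖ ≤ α := by
    refine (norm_diagCLM_le _ (by positivity) fun k => ?_).trans hα
    have e : -(x k + θ') ^ 2 - -(x k + θ) ^ 2 =
        -((θ' - θ) * (2 * x k + 2 * θ + (θ' - θ))) := by ring
    rw [e, abs_neg, abs_mul]
    refine mul_le_mul hρ ?_ (abs_nonneg _) hρ0
    have h1 := abs_le.mp (hx k)
    have h2 := abs_le.mp hθ
    have h3 := abs_le.mp (hρ.trans hρ1)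
    rw [abs_le]
    constructor <;> linarith
  rw [diagCLM_sub] at hnorm
  refine ⟨v, hv, ?_⟩
  have e : (diagCLM (fun k => -(x k + θ') ^ 2) + Q) v = (diagCLM (fun k => -(x k + θ) ^ 2) + Q) v +
      (diagCLM (fun k => -(x k + θ') ^ 2) - diagCLM (fun k => -(x k + θ) ^ 2)) v := by
    simp only [add_apply, sub_apply]
    abel
  rw [e]
  refine (norm_add_le _ _).trans ?_
  have h1 := (ContinuousLinearMap.le_opNorm _ v).trans
    (mul_le_mul_of_nonneg_right hnorm (norm_nonneg v))
  linarith

theorem continuous_diagCLM : Continuous (diagCLM : (κ → ℝ) → _) := by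
  refine LipschitzWith.continuous (K := 1) (LipschitzWith.of_dist_le_mul fun a a' => ?_)
  rw [NNReal.coe_one, one_mul, dist_eq_norm, dist_eq_norm, ← diagCLM_sub]
  exact norm_diagCLM_le _ (norm_nonneg _) fun k => norm_le_pi_norm (a - a') k

/-- The conjugate of an operator by a unitary map. -/
def conjCLM {E F : Type*} [NormedAddCommGroup E] [InnerProductSpace ℂ E] [NormedAddCommGroup F]
    [InnerProductSpace ℂ F] (U : E ≃ₗᵢ[ℂ] F) (T : E →L[ℂ] E) : F →L[ℂ] F :=
  U.toContinuousLinearEquiv.toContinuousLinearMap ∘L T ∘L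
    U.symm.toContinuousLinearEquiv.toContinuousLinearMap

theorem conjCLM_apply {E F : Type*} [NormedAddCommGroup E] [InnerProductSpace ℂ E]
    [NormedAddCommGroup F] [InnerProductSpace ℂ F] (U : E ≃ₗᵢ[ℂ] F) (T : E →L[ℂ] E) (v : F) :
    conjCLM U T v = U (T (U.symm v)) := rfl

theorem norm_conjCLM_le {E F : Type*} [NormedAddCommGroup E] [InnerProductSpace ℂ E]
    [NormedAddCommGroup F] [InnerProductSpace ℂ F] (U : E ≃ₗᵢ[ℂ] F) (T : E →L[ℂ] E) :
    ‖conjCLM U T‖ ≤ ‖T‖ := by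
  refine ContinuousLinearMap.opNorm_le_bound _ (norm_nonneg _) fun v => ?_
  rw [conjCLM_apply, U.norm_map]
  refine (T.le_opNorm _).trans (le_of_eq ?_)
  rw [U.symm.norm_map]

theorem conjCLM_sub {E F : Type*} [NormedAddCommGroup E] [InnerProductSpace ℂ E]
    [NormedAddCommGroup F] [InnerProductSpace ℂ F] (U : E ≃ₗᵢ[ℂ] F) (T T' : E →L[ℂ] E) :
    conjCLM U (T - T') = conjCLM U T - conjCLM U T' := by
  ext v
  simp [conjCLM_apply]

theorem conjCLM_isSymmetric {E F : Type*} [NormedAddCommGroup E] [InnerProductSpace ℂ E]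
    [NormedAddCommGroup F] [InnerProductSpace ℂ F] (U : E ≃ₗᵢ[ℂ] F) {T : E →L[ℂ] E}
    (hT : (T : E →ₗ[ℂ] E).IsSymmetric) : (conjCLM U T : F →ₗ[ℂ] F).IsSymmetric := by
  intro u v
  have h := hT (U.symm u) (U.symm v)
  rw [← U.inner_map_map, ← U.inner_map_map (U.symm u), U.apply_symm_apply, U.apply_symm_apply] at h
  exact h

theorem repr_eigenbasis {E : Type*} [NormedAddCommGroup E] [InnerProductSpace ℂ E] (A : E →L[ℂ] E)
    (hA : (A : E →ₗ[ℂ] E).IsSymmetric) (e : OrthonormalBasis κ ℂ E) (ev : κ → ℝ)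
    (he : ∀ i, A (e i) = (ev i : ℂ) • e i) (v : E) :
    e.repr (A v) = diagCLM ev (e.repr v) := by
  ext k
  rw [diagCLM_apply, e.repr_apply_apply, e.repr_apply_apply, inner_eigenbasis A hA e ev he]

theorem isSymmetric_diagCLM_add (a : κ → ℝ) {Q : EuclideanSpace ℂ κ →L[ℂ] EuclideanSpace ℂ κ}
    (hQ : (Q : EuclideanSpace ℂ κ →ₗ[ℂ] EuclideanSpace ℂ κ).IsSymmetric) :
    ((diagCLM a + Q : EuclideanSpace ℂ κ →L[ℂ] EuclideanSpace ℂ κ) :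
      EuclideanSpace ℂ κ →ₗ[ℂ] EuclideanSpace ℂ κ).IsSymmetric :=
  (diagCLM_isSymmetric a).add hQ

/-- `coveredByIntervals_frequency` in an arbitrary eigenbasis. -/
theorem coveredByIntervals_frequency_eigenbasis {E : Type*} [NormedAddCommGroup E]
    [InnerProductSpace ℂ E] (f : OrthonormalBasis κ ℂ E) (x h : κ → ℝ) {β c α : ℝ} (hβ : 0 < β)
    (hα : 0 ≤ α) (hh : ∀ k, β ≤ |h k|) (S W : ℝ → E →L[ℂ] E)
    (hS : ∀ t, (S t : E →ₗ[ℂ] E).IsSymmetric)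
    (hSf : ∀ t k, S t (f k) = ((-(t * x k) ^ 2 + h k : ℝ) : ℂ) • f k)
    (hWs : ∀ t, (W t : E →ₗ[ℂ] E).IsSymmetric) (hWn : ∀ t ∈ Lam, ‖W t‖ ≤ c)
    (hWl : ∀ t ∈ Lam, ∀ t' ∈ Lam, ‖W t' - W t‖ ≤ c * |t' - t|) (hc : 80 * c ≤ β) :
    CoveredByIntervals {t | t ∈ Lam ∧ HasApproxKernel (S t - W t) α}
      (Fintype.card κ) (32 * α / β) := by
  refine (coveredByIntervals_frequency x h hβ hα hh (fun t => conjCLM f.repr (W t))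
    (fun t _ => conjCLM_isSymmetric _ (hWs t))
    (fun t ht => (norm_conjCLM_le _ _).trans (hWn t ht))
    (fun t ht t' ht' => ?_) hc).mono ?_ le_rfl le_rfl
  · rw [← conjCLM_sub]
    exact (norm_conjCLM_le _ _).trans (hWl t ht t' ht')
  · rintro t ⟨ht, hk⟩
    refine ⟨ht, hasApproxKernel_conj f.repr _ _ (fun v => ?_) hk⟩
    rw [sub_apply, sub_apply, map_sub, repr_eigenbasis (S t) (hS t) f _ (hSf t), conjCLM_apply,
      f.repr.symm_apply_apply]

end Diagonal

section Linearized

variable {ν d : ℕ}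

theorem abs_freq_le {ω : Fin ν → ℝ} (hω : ∀ a, |ω a| ≤ 1) {M : ℕ} {l : Fin ν → ℤ}
    (hl : l ∈ box M (0 : Fin ν → ℤ)) : |freq ω l| ≤ ν * M := by
  calc |freq ω l| ≤ ∑ a, |ω a * (l a : ℝ)| := Finset.abs_sum_le_sum_abs _ _
    _ ≤ ∑ _a : Fin ν, (M : ℝ) := by
        refine Finset.sum_le_sum fun a _ => ?_
        rw [abs_mul]
        have h1 : |(l a : ℝ)| ≤ M := by
          have := mem_box.mp hl a
          rw [Pi.zero_apply, sub_zero] at this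
          exact_mod_cast this
        calc |ω a| * |(l a : ℝ)| ≤ 1 * M := mul_le_mul (hω a) h1 (abs_nonneg _) zero_le_one
          _ = M := one_mul _
    _ = ν * M := by simp

theorem abs_mul_freq_le {ω : Fin ν → ℝ} (hω : ∀ a, |ω a| ≤ 1) {M : ℕ} {l : Fin ν → ℤ}
    (hl : l ∈ box M (0 : Fin ν → ℤ)) {t : ℝ} (ht : t ∈ Lam) : |t * freq ω l| ≤ 2 * ν * M := by
  have ht0 : (1 : ℝ) / 2 ≤ t ∧ t ≤ 3 / 2 := ht
  have h := abs_freq_le hω hl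
  rw [abs_mul, abs_of_nonneg (by linarith)]
  have := abs_nonneg (freq ω l)
  nlinarith

theorem mul_norm_multOp_le {E : Finset (Site ν d)} {g : C(SpaceTime ν d, ℝ)} {ε c : ℝ} {y : ℝ≥0∞}
    (hε : 0 ≤ ε) (hc : 0 ≤ c) (hy : opNormInf (multMatrix g) ≤ y)
    (h : ENNReal.ofReal ε * y ≤ ENNReal.ofReal c) : ε * ‖multOp E g‖ ≤ c := by
  rw [← ENNReal.ofReal_le_ofReal_iff hc, ENNReal.ofReal_mul hε]
  refine le_trans ?_ h
  gcongr
  exact (norm_toEuclideanCLM_restrict_le _ E).trans hy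

/-- The size of the perturbation and its variation with the parameter. -/
structure PerturbationBound (ε c : ℝ) (g : ℝ → C(SpaceTime ν d, ℝ)) : Prop where
  nonneg : 0 ≤ c
  continuousOn : ContinuousOn g Lam
  norm_le : ∀ E : Finset (Site ν d), ∀ t ∈ Lam, ‖ε • multOp E (g t)‖ ≤ c
  lipschitz : ∀ E : Finset (Site ν d), ∀ t ∈ Lam, ∀ t' ∈ Lam,
    ‖ε • multOp E (g t') - ε • multOp E (g t)‖ ≤ c * |t' - t|

theorem perturbationBound {ε₀ ε c : ℝ} (hε : ε ∈ Set.Ico 0 ε₀) (hc : 0 ≤ c)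
    {g : ℝ → C(SpaceTime ν d, ℝ)} (hg : ContDiffOn ℝ 1 g Lam)
    (h : ∀ lam ∈ Lam, ENNReal.ofReal ε₀ *
      (opNormInf (multMatrix (g lam)) + opNormInf (multMatrix (derivWithin g Lam lam)))
        ≤ ENNReal.ofReal c) : PerturbationBound ε c g := by
  have h' : ∀ lam ∈ Lam, ENNReal.ofReal ε *
      (opNormInf (multMatrix (g lam)) + opNormInf (multMatrix (derivWithin g Lam lam)))
        ≤ ENNReal.ofReal c := fun lam hlam =>
    le_trans (by gcongr; exact hε.2.le) (h lam hlam)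
  refine ⟨hc, hg.continuousOn, fun E t ht => ?_, fun E t ht t' ht' => ?_⟩
  · rw [norm_smul, Real.norm_eq_abs, abs_of_nonneg hε.1]
    exact mul_norm_multOp_le hε.1 hc le_self_add (h' t ht)
  · have hder : ∀ s ∈ Lam, HasDerivWithinAt (fun s => ε • multOp E (g s))
        (ε • multOp E (derivWithin g Lam s)) Lam s := fun s hs => by
      have h1 := ((hg.differentiableOn one_ne_zero) s hs).hasDerivWithinAt
      exact ((multOp E).hasFDerivAt.comp_hasDerivWithinAt s h1).const_smul ε
    have h2 := (convex_Icc (1 / 2 : ℝ) (3 / 2)).norm_image_sub_le_of_norm_hasDerivWithin_le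
      (C := c) hder (fun s hs => ?_) ht ht'
    · exact h2
    · rw [norm_smul, Real.norm_eq_abs, abs_of_nonneg hε.1]
      exact mul_norm_multOp_le hε.1 hc le_add_self (h' s hs)

theorem card_sites (M : ℕ) (j₀ : Fin d → ℤ) :
    (box M (0 : Fin ν → ℤ) ×ˢ box M j₀ : Finset (Site ν d)).card = (2 * M + 1) ^ (ν + d) := by
  rw [Finset.card_product, card_box, card_box, pow_add]

theorem continuousOn_centeredOp (V : C(UnitAddTorus (Fin d), ℝ)) (ω : Fin ν → ℝ) {ε : ℝ}
    {g : ℝ → C(SpaceTime ν d, ℝ)} (hg : ContinuousOn g Lam) (M : ℕ) (j₀ : Fin d → ℤ) :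
    ContinuousOn (Function.uncurry (centeredOp V ω ε g M j₀)) (Lam ×ˢ Set.univ) := by
  have e : Function.uncurry (centeredOp V ω ε g M j₀) = fun p : ℝ × ℝ =>
      diagCLM (fun i => -(p.1 * freq ω i.1.1 + p.2) ^ 2) +
        (spaceOp V (box M 0) (box M j₀) - ε • multOp (box M 0 ×ˢ box M j₀) (g p.1)) := by
    funext p
    exact centeredOp_eq V ω ε g M j₀ p.1 p.2
  rw [e]
  refine ContinuousOn.add (Continuous.continuousOn ?_) (continuousOn_const.sub (.const_smul ?_ ε))
  · exact continuous_diagCLM.comp (by fun_prop)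
  · exact (multOp _).continuous.comp_continuousOn
      (hg.comp continuous_fst.continuousOn fun p hp => hp.1)

/-- Along the lines `θ = λ η`, the bad parameters are few. -/
theorem coveredByIntervals_centeredOp_line {V : C(UnitAddTorus (Fin d), ℝ)} {L₀ : ℕ}
    (hβ : 0 < gapConst V) (hL : IsSpectralLength V L₀) {M : ℕ} {j₀ : Fin d → ℤ}
    (hj₀ : j₀ ∉ nearOrigin d L₀ M) (ω : Fin ν → ℝ) {ε c : ℝ} {g : ℝ → C(SpaceTime ν d, ℝ)}
    (hP : PerturbationBound ε c g) (hc : 80 * c ≤ gapConst V) {α : ℝ} (hα : 0 ≤ α) (η : ℝ) :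
    CoveredByIntervals {t | t ∈ Lam ∧ HasApproxKernel (centeredOp V ω ε g M j₀ t (t * η)) α}
      ((2 * M + 1) ^ (ν + d)) (32 * α / gapConst V) := by
  obtain ⟨f, hf, hf'⟩ := exists_product_eigenbasis (siteEquiv (box M (0 : Fin ν → ℤ)) (box M j₀))
    (restrictedMatrix_isHermitian V (box M j₀))
  have h := coveredByIntervals_frequency_eigenbasis f (fun p => freq ω p.1.1 + η)
    (fun p => (restrictedMatrix_isHermitian V (box M j₀)).eigenvalues p.2) hβ hα
    (fun p => gapConst_le_abs_eigenvalues hL hj₀ p.2)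
    (fun t => diagCLM (fun i => -(t * freq ω i.1.1 + t * η) ^ 2) + spaceOp V (box M 0) (box M j₀))
    (fun t => ε • multOp (box M (0 : Fin ν → ℤ) ×ˢ box M j₀) (g t))
    (fun t => isSymmetric_diagCLM_add _ (spaceOp_isSymmetric V _ _)) (fun t p => ?_)
    (fun t => ?_) (hP.norm_le _) (hP.lipschitz _) hc
  · refine h.mono ?_ (le_of_eq ?_) le_rfl
    · rintro t ⟨ht, hk⟩
      rw [centeredOp_eq, ← add_sub_assoc] at hk
      exact ⟨ht, hk⟩
    · rw [← card_sites (ν := ν) M j₀, Finset.card_product, Fintype.card_prod, Fintype.card_coe,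
        Fintype.card_coe]
  · have h2 := hf' (fun l => -(t * freq ω l.1 + t * η) ^ 2) p
    rw [add_apply, spaceOp, hf p]
    refine (congrArg (· + _) h2).trans ?_
    rw [← add_smul, ← Complex.ofReal_add, mul_add]
  · rw [← map_smul]
    exact multOp_isSymmetric _ _

end Linearized

/-! ### The measure of the bad parameters -/

section Estimates

variable {ν d : ℕ}

theorem norm_le_of_mem_box {M : ℕ} {j₀ j : Fin d → ℤ} (h : j ∈ box M j₀) : ‖j‖ ≤ ‖j₀‖ + M := by
  have h1 := norm_sub_le_of_mem_box h
  have h2 := norm_add_le (j - j₀) j₀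
  rw [sub_add_cancel] at h2
  linarith

theorem le_norm_of_mem_box {M : ℕ} {j₀ j : Fin d → ℤ} (h : j ∈ box M j₀) : ‖j₀‖ - M ≤ ‖j‖ := by
  have h1 := norm_sub_le_of_mem_box h
  have h2 := norm_add_le (j₀ - j) j
  rw [sub_add_cancel, norm_sub_rev] at h2
  linarith

/-- For sites far from the origin, all bad phases are large. -/
theorem lt_abs_of_hasApproxKernel (V : C(UnitAddTorus (Fin d), ℝ)) {ω : Fin ν → ℝ}
    (hω : ∀ a, |ω a| ≤ 1) {ε c : ℝ} {g : ℝ → C(SpaceTime ν d, ℝ)} (hP : PerturbationBound ε c g)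
    {M N : ℕ} (hMN : M ≤ N) (hN : ‖potentialOp V‖ + c + 1 ≤ N) {j₀ : Fin d → ℤ}
    (hj₀ : ((4 * ν + 3) * N : ℝ) < ‖j₀‖) {α : ℝ} (hα : α ≤ 1) {t : ℝ} (ht : t ∈ Lam) {θ : ℝ}
    (h : HasApproxKernel (centeredOp V ω ε g M j₀ t θ) α) : (2 * ν + 1 : ℝ) * N < |θ| := by
  have hMN' : (M : ℝ) ≤ N := by exact_mod_cast hMN
  have hN1 : (1 : ℝ) ≤ N := by linarith [norm_nonneg (potentialOp V), hP.nonneg]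
  rw [centeredOp_eq] at h
  have hlow : ∀ j ∈ box M j₀, ((4 * ν + 2) * N : ℝ) ^ 2 ≤ sqNorm j := fun j hj => by
    refine le_trans ?_ (norm_sq_le_sqNorm j)
    have := le_norm_of_mem_box hj
    refine pow_le_pow_left₀ (by positivity) ?_ 2
    linarith
  obtain ⟨k, hk⟩ := exists_le_sq_of_hasApproxKernel (fun i => t * freq ω i.1.1 + θ)
    (spaceOp V (box M 0) (box M j₀)) (ε • multOp (box M 0 ×ˢ box M j₀) (g t))
    (le_quadForm_spaceOp V _ _ hlow) (hP.norm_le _ t ht) h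
  by_contra! hθ
  have hx := abs_mul_freq_le hω (Finset.mem_product.mp k.2).1 ht
  have hx' : |t * freq ω k.1.1| ≤ 2 * ν * N := hx.trans (by gcongr)
  have hy : |t * freq ω k.1.1 + θ| ≤ (4 * ν + 1) * N := by
    have := abs_add_le (t * freq ω k.1.1) θ
    linarith
  have hy2 : (t * freq ω k.1.1 + θ) ^ 2 ≤ ((4 * ν + 1) * N : ℝ) ^ 2 := by
    rw [← sq_abs]
    exact pow_le_pow_left₀ (abs_nonneg _) hy 2
  have hν0 : (0 : ℝ) ≤ ν := by positivity
  nlinarith [mul_nonneg hν0 (mul_self_nonneg (N : ℝ)), mul_le_mul hN1 hN1 zero_le_one (by linarith)]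

/-- For sites not too far from the origin, all bad phases are bounded. -/
theorem abs_le_of_hasApproxKernel (V : C(UnitAddTorus (Fin d), ℝ)) {ω : Fin ν → ℝ}
    (hω : ∀ a, |ω a| ≤ 1) {ε c : ℝ} {g : ℝ → C(SpaceTime ν d, ℝ)} (hP : PerturbationBound ε c g)
    {M N : ℕ} (hMN : M ≤ N) (hN : ‖potentialOp V‖ + c + 1 ≤ N) {j₀ : Fin d → ℤ} {K : ℝ}
    (hK : 0 ≤ K) (hj₀ : ‖j₀‖ ≤ K * N) {α : ℝ} (hα : α ≤ 1) {t : ℝ} (ht : t ∈ Lam) {θ : ℝ}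
    (h : HasApproxKernel (centeredOp V ω ε g M j₀ t θ) α) :
    |θ| ≤ (2 * ν + d * (K + 1) + 2) * N := by
  have hMN' : (M : ℝ) ≤ N := by exact_mod_cast hMN
  have hN1 : (1 : ℝ) ≤ N := by linarith [norm_nonneg (potentialOp V), hP.nonneg]
  rw [centeredOp_eq] at h
  have hup : ∀ j ∈ box M j₀, sqNorm j ≤ (d * (K + 1) * N : ℝ) ^ 2 := fun j hj => by
    refine (sqNorm_le j).trans ?_
    have h1 := norm_le_of_mem_box hj
    have h2 : ‖j‖ ^ 2 ≤ ((K + 1) * N) ^ 2 :=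
      pow_le_pow_left₀ (norm_nonneg _) (by linarith) 2
    have h3 : (d : ℝ) ≤ d ^ 2 := by exact_mod_cast Nat.le_self_pow two_ne_zero d
    calc (d : ℝ) * ‖j‖ ^ 2 ≤ d ^ 2 * ((K + 1) * N) ^ 2 := by gcongr
      _ = _ := by ring
  obtain ⟨k, hk⟩ := exists_sq_le_of_hasApproxKernel (fun i => t * freq ω i.1.1 + θ)
    (spaceOp V (box M 0) (box M j₀)) (ε • multOp (box M 0 ×ˢ box M j₀) (g t))
    (quadForm_spaceOp_le V _ _ hup) (hP.norm_le _ t ht) h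
  by_contra! hθ
  have hx := abs_mul_freq_le hω (Finset.mem_product.mp k.2).1 ht
  have hx' : |t * freq ω k.1.1| ≤ 2 * ν * N := hx.trans (by gcongr)
  have hy : d * (K + 1) * N + 2 * N ≤ |t * freq ω k.1.1 + θ| := by
    have := abs_sub_abs_le_abs_sub θ (-(t * freq ω k.1.1))
    rw [abs_neg, sub_neg_eq_add, add_comm θ] at this
    linarith
  have hy2 : (d * (K + 1) * N + 2 * N : ℝ) ^ 2 ≤ (t * freq ω k.1.1 + θ) ^ 2 := by
    rw [← sq_abs (t * _ + _)]
    exact pow_le_pow_left₀ (by positivity) hy 2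
  have h0 : 0 ≤ d * (K + 1) * N * N := by positivity
  nlinarith [mul_le_mul hN1 hN1 zero_le_one (by linarith)]

theorem hasApproxKernel_centeredOp_of_phase_close (V : C(UnitAddTorus (Fin d), ℝ))
    {ω : Fin ν → ℝ} (hω : ∀ a, |ω a| ≤ 1) (ε : ℝ) (g : ℝ → C(SpaceTime ν d, ℝ)) {M N : ℕ}
    (hMN : M ≤ N) {j₀ : Fin d → ℤ} {t : ℝ} (ht : t ∈ Lam) {R ρ α θ θ' : ℝ} (hθ : |θ| ≤ R)
    (hρ : |θ' - θ| ≤ ρ) (hρ1 : ρ ≤ 1) (hα : ρ * (2 * (2 * ν * N) + 2 * R + 1) ≤ α)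
    (h : HasApproxKernel (centeredOp V ω ε g M j₀ t θ) α) :
    HasApproxKernel (centeredOp V ω ε g M j₀ t θ') (2 * α) := by
  have hX : (0 : ℝ) ≤ 2 * ν * N := by positivity
  rw [centeredOp_eq] at h ⊢
  have hx : ∀ i : (box M (0 : Fin ν → ℤ) ×ˢ box M j₀ : Finset (Site ν d)),
      |t * freq ω i.1.1| ≤ 2 * ν * N := fun i =>
    (abs_mul_freq_le hω (Finset.mem_product.mp i.2).1 ht).trans (by gcongr)
  exact hasApproxKernel_of_phase_close
    (fun i : (box M (0 : Fin ν → ℤ) ×ˢ box M j₀ : Finset (Site ν d)) => t * freq ω i.1.1)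
    (spaceOp V (box M 0) (box M j₀) - ε • multOp (box M 0 ×ˢ box M j₀) (g t))
    (X := 2 * ν * N) (R := R) (ρ := ρ) (α := α) hx hX hθ hρ hρ1 hα h

theorem badSet_subset (V : C(UnitAddTorus (Fin d), ℝ)) (τ : ℝ) (ω : Fin ν → ℝ) (ε : ℝ)
    (g : ℝ → C(SpaceTime ν d, ℝ)) {M : ℕ} (hM : 0 < M) (j₀ : Fin d → ℤ) (t : ℝ) :
    badSet V τ ω ε g M j₀ t ⊆ {θ | HasApproxKernel (centeredOp V ω ε g M j₀ t θ) ((M : ℝ) ^ τ)⁻¹} :=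
  fun _ h => hasApproxKernel_of_invNorm (Real.rpow_pos_of_pos (by exact_mod_cast hM) τ) h

theorem inv_rpow_le {M N : ℕ} (hM : 0 < M) (hN : 0 < N) (hNM : N ≤ 2 * M) {τ : ℝ} (hτ : 0 ≤ τ) :
    ((M : ℝ) ^ τ)⁻¹ ≤ 2 ^ τ * (N : ℝ) ^ (-τ) := by
  have hM' : (0 : ℝ) < M := by exact_mod_cast hM
  have hpos := Real.rpow_pos_of_pos hM' τ
  have hN' : (0 : ℝ) < N := by exact_mod_cast hN
  have hNM' : (N : ℝ) ≤ 2 * M := by exact_mod_cast hNM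
  rw [Real.rpow_neg hN'.le, ← div_eq_mul_inv, le_div_iff₀ (Real.rpow_pos_of_pos hN' τ),
    inv_mul_le_iff₀ hpos, mul_comm, ← Real.mul_rpow zero_le_two hM'.le]
  exact Real.rpow_le_rpow hN'.le hNM' hτ

theorem rpow_neg_le_inv {M N : ℕ} (hM : 0 < M) (hMN : M ≤ N) {τ : ℝ} (hτ : 0 ≤ τ) :
    (N : ℝ) ^ (-τ) ≤ ((M : ℝ) ^ τ)⁻¹ := by
  have hM' : (0 : ℝ) < M := by exact_mod_cast hM
  have hMN' : (M : ℝ) ≤ N := by exact_mod_cast hMN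
  rw [Real.rpow_neg (hM'.le.trans hMN')]
  exact inv_anti₀ (Real.rpow_pos_of_pos hM' τ) (Real.rpow_le_rpow hM'.le hMN' hτ)

theorem inv_rpow_le_one {M : ℕ} (hM : 0 < M) {τ : ℝ} (hτ : 0 ≤ τ) : ((M : ℝ) ^ τ)⁻¹ ≤ 1 :=
  inv_le_one_of_one_le₀ (Real.one_le_rpow (by exact_mod_cast hM) hτ)

/-- Far from the origin, the complexity of the bad sets is always small. -/
theorem coveredByIntervals_badSet_of_far (V : C(UnitAddTorus (Fin d), ℝ)) {τ : ℝ} (hτ : 0 ≤ τ)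
    {ω : Fin ν → ℝ} (hω : ∀ a, |ω a| ≤ 1) {ε c : ℝ} {g : ℝ → C(SpaceTime ν d, ℝ)}
    (hP : PerturbationBound ε c g) {M N : ℕ} (hM : 0 < M) (hMN : M ≤ N) (hNM : N ≤ 2 * M)
    (hN : ‖potentialOp V‖ + c + 1 ≤ N) (hN2 : (2 : ℝ) ^ τ ≤ N) (hN3 : 2 * 3 ^ (ν + d) ≤ N)
    {j₀ : Fin d → ℤ} (hj₀ : ((4 * ν + 3) * N : ℝ) < ‖j₀‖) {t : ℝ} (ht : t ∈ Lam) :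
    CoveredByIntervals (badSet V τ ω ε g M j₀ t) (N ^ (2 * d + ν + 3)) ((N : ℝ) ^ (-τ)) := by
  have hMN' : (M : ℝ) ≤ N := by exact_mod_cast hMN
  have hN0 : 0 < N := hM.trans_le hMN
  have hN' : (0 : ℝ) < N := by exact_mod_cast hN0
  have hα1 := inv_rpow_le_one hM hτ
  have hα0 : (0 : ℝ) ≤ ((M : ℝ) ^ τ)⁻¹ := by positivity
  have h := coveredByIntervals_phase
    (fun i : (box M (0 : Fin ν → ℤ) ×ˢ box M j₀ : Finset (Site ν d)) => t * freq ω i.1.1)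
    (X := 2 * ν * N) (Θ := (2 * ν + 1) * N) (r := 2 * N) (α := ((M : ℝ) ^ τ)⁻¹)
    (fun i => (abs_mul_freq_le hω (Finset.mem_product.mp i.2).1 ht).trans (by gcongr))
    (by positivity) (by linarith) hα0
    (spaceOp V (box M 0) (box M j₀) - ε • multOp (box M 0 ×ˢ box M j₀) (g t)) ?_
  · refine h.mono (fun θ hθ => ?_) ?_ ?_
    · have h1 := badSet_subset V τ ω ε g hM j₀ t hθ
      refine ⟨lt_abs_of_hasApproxKernel V hω hP hMN hN hj₀ hα1 ht h1, ?_⟩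
      have h2 : HasApproxKernel (centeredOp V ω ε g M j₀ t θ) ((M : ℝ) ^ τ)⁻¹ := h1
      rwa [centeredOp_eq] at h2
    · rw [Fintype.card_coe, card_sites]
      calc (2 * M + 1) ^ (ν + d) + (2 * M + 1) ^ (ν + d) = 2 * (2 * M + 1) ^ (ν + d) := by ring
        _ ≤ 2 * (3 * N) ^ (ν + d) := by gcongr; omega
        _ = (2 * 3 ^ (ν + d)) * N ^ (ν + d) := by rw [mul_pow]; ring
        _ ≤ N * N ^ (ν + d) := by gcongr
        _ = N ^ (ν + d + 1) := by ring
        _ ≤ N ^ (2 * d + ν + 3) := Nat.pow_le_pow_right hN0 (by omega)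
    · rw [mul_div_mul_left _ _ two_ne_zero, div_le_iff₀ hN']
      refine (inv_rpow_le hM hN0 hNM hτ).trans ?_
      rw [mul_comm]
      gcongr
  · have h1 := multOp_isSymmetric (box M (0 : Fin ν → ℤ) ×ˢ box M j₀) (ε • g t)
    rw [map_smul] at h1
    exact (spaceOp_isSymmetric V _ _).sub h1

/-- The parameters for which the complexity of a bad set is large. -/
theorem volume_not_coveredByIntervals_badSet_le {V : C(UnitAddTorus (Fin d), ℝ)} {L₀ : ℕ}
    (hβ : 0 < gapConst V) (hL : IsSpectralLength V L₀) {τ : ℝ} (hτ : 0 ≤ τ)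
    {ω : Fin ν → ℝ} (hω : ∀ a, |ω a| ≤ 1) {ε c : ℝ} {g : ℝ → C(SpaceTime ν d, ℝ)}
    (hP : PerturbationBound ε c g) (hc : 80 * c ≤ gapConst V) {M N : ℕ} (hM : 0 < M)
    (hMN : M ≤ N) (hNM : N ≤ 2 * M) (hN : ‖potentialOp V‖ + c + 1 ≤ N)
    {K K' : ℝ} (hK : 0 ≤ K) (hK' : K' = 2 * ν + d * (K + 1) + 2) {j₀ : Fin d → ℤ}
    (hj₀ : j₀ ∉ nearOrigin d L₀ M) (hj₀' : ‖j₀‖ ≤ K * N) :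
    volume {t | t ∈ Lam ∧ ¬ CoveredByIntervals (badSet V τ ω ε g M j₀ t)
      (N ^ (2 * d + ν + 3)) ((N : ℝ) ^ (-τ))} ≤
      ENNReal.ofReal (1024 * K' * (4 * ν + 2 * K' + 1) * 3 ^ (ν + d) * 2 ^ τ / gapConst V /
        (N : ℝ) ^ (d + 1)) := by
  have hMN' : (M : ℝ) ≤ N := by exact_mod_cast hMN
  have hN0 : 0 < N := hM.trans_le hMN
  have hN' : (0 : ℝ) < N := by exact_mod_cast hN0
  have hN1 : (1 : ℝ) ≤ N := by exact_mod_cast hN0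
  have hα1 := inv_rpow_le_one hM hτ
  have hα2 := inv_rpow_le hM hN0 hNM hτ
  have hα3 := rpow_neg_le_inv hM hMN hτ
  have hα0 : (0 : ℝ) ≤ ((M : ℝ) ^ τ)⁻¹ := by positivity
  set α : ℝ := ((M : ℝ) ^ τ)⁻¹ with hα
  set r : ℝ := (N : ℝ) ^ (-τ) with hr
  have hr0 : 0 < r := Real.rpow_pos_of_pos hN' _
  have hK'2 : 2 ≤ K' := by
    have : (0 : ℝ) ≤ 2 * ν + d * (K + 1) := by positivity
    linarith
  set C' : ℝ := 4 * ν + 2 * K' + 1 with hC'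
  have hC'5 : 5 ≤ C' := by
    have : (0 : ℝ) ≤ 4 * ν := by positivity
    linarith
  set ρ : ℝ := r / (C' * N) with hρ
  have hρ0 : 0 < ρ := by positivity
  have hρr : ρ * (C' * N) = r := div_mul_cancel₀ _ (by positivity)
  have hC'N : 5 ≤ C' * N := by nlinarith
  have hr1 : r ≤ 1 := hα3.trans hα1
  have hρ2 : ρ ≤ r / 2 := by nlinarith
  have hρ1 : ρ ≤ 1 := by linarith
  have hbound : ∀ t ∈ Lam, ∀ θ, HasApproxKernel (centeredOp V ω ε g M j₀ t θ) α → |θ| ≤ K' * N :=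
    fun t ht θ h => by
      rw [hK']
      exact abs_le_of_hasApproxKernel V hω hP hMN hN hK hj₀' hα1 ht h
  have h := volume_not_covered_le (centeredOp V ω ε g M j₀)
    (continuousOn_centeredOp V ω hP.continuousOn M j₀) (α := α) (R := 4 * K' * N) (R₁ := K' * N)
    (ρ := ρ) (r := r) (K := N ^ (2 * d + ν + 3)) (pow_pos hN0 _) hρ0 hρ2
    (δ := 32 * (2 * α) / gapConst V) (by positivity) (by positivity)
    (by nlinarith) hbound (fun t ht θ h θ' hθ' => ?_)
    (fun η => coveredByIntervals_centeredOp_line hβ hL hj₀ ω hP hc (by positivity) η)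
  · refine (measure_mono ?_).trans (h.trans (ENNReal.ofReal_le_ofReal ?_))
    · rintro t ⟨ht, hn⟩
      exact ⟨ht, fun hcov => hn (hcov.mono (badSet_subset V τ ω ε g hM j₀ t) le_rfl le_rfl)⟩
    · have hcount : (((2 * M + 1) ^ (ν + d) : ℕ) : ℝ) ≤ 3 ^ (ν + d) * (N : ℝ) ^ (ν + d) := by
        rw [← mul_pow]
        push_cast
        gcongr
        linarith
      rw [div_le_iff₀ (by positivity)]
      calc 4 * (4 * K' * N) * (((2 * M + 1) ^ (ν + d) : ℕ) : ℝ) * (32 * (2 * α) / gapConst V)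
          ≤ 4 * (4 * K' * N) * (3 ^ (ν + d) * (N : ℝ) ^ (ν + d)) *
              (32 * (2 * (2 ^ τ * r)) / gapConst V) := by gcongr
        _ = 1024 * K' * C' * 3 ^ (ν + d) * 2 ^ τ / gapConst V / (N : ℝ) ^ (d + 1) *
              (((N ^ (2 * d + ν + 3) : ℕ) : ℝ) * ρ) := by
            rw [hρ]
            have e : ((N ^ (2 * d + ν + 3) : ℕ) : ℝ) =
                (N : ℝ) ^ (ν + d) * (N : ℝ) ^ (d + 1) * (N * N) := by
              push_cast
              ring
            rw [e]
            have : C' ≠ 0 := by positivity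
            field_simp
            ring
  · refine hasApproxKernel_centeredOp_of_phase_close V hω ε g hMN ht (hbound t ht θ h) hθ' hρ1 ?_ h
    refine le_trans ?_ hα3
    rw [← hρr]
    refine mul_le_mul_of_nonneg_left ?_ hρ0.le
    rw [hC']
    linarith

/-- The measure of the complement of the good parameters. -/
theorem volume_diff_goodParams_le {V : C(UnitAddTorus (Fin d), ℝ)} {L₀ : ℕ}
    (hβ : 0 < gapConst V) (hL : IsSpectralLength V L₀) {τ : ℝ} (hτ : 0 ≤ τ)
    {ω : Fin ν → ℝ} (hω : ∀ a, |ω a| ≤ 1) {ε c : ℝ} {g : ℝ → C(SpaceTime ν d, ℝ)}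
    (hP : PerturbationBound ε c g) (hc : 80 * c ≤ gapConst V) {N : ℕ} (hN0 : 0 < N)
    (hN4 : 4 * L₀ ≤ N)
    (hN : ‖potentialOp V‖ + c + 1 ≤ N) (hN2 : (2 : ℝ) ^ τ ≤ N) (hN3 : 2 * 3 ^ (ν + d) ≤ N)
    {K' : ℝ} (hK' : K' = 2 * ν + d * ((4 * ν + 3) + 1) + 2) :
    volume (Lam \ goodParams V L₀ τ ω ε g N) ≤
      ENNReal.ofReal (2 * (8 * ν + 7) ^ d *
        (1024 * K' * (4 * ν + 2 * K' + 1) * 3 ^ (ν + d) * 2 ^ τ / gapConst V) * (N : ℝ)⁻¹) := by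
  classical
  set S : Finset (ℕ × (Fin d → ℤ)) :=
    ({N, N - 2 * L₀} : Finset ℕ) ×ˢ box ((4 * ν + 3) * N) (0 : Fin d → ℤ) with hS
  set D := 1024 * K' * (4 * ν + 2 * K' + 1) * 3 ^ (ν + d) * 2 ^ τ / gapConst V with hD
  set bad : ℕ × (Fin d → ℤ) → Set ℝ := fun p => {t | t ∈ Lam ∧ p.2 ∉ nearOrigin d L₀ p.1 ∧
    ¬ CoveredByIntervals (badSet V τ ω ε g p.1 p.2 t) (N ^ (2 * d + ν + 3)) ((N : ℝ) ^ (-τ))}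
    with hbad
  have hN' : (0 : ℝ) < N := by exact_mod_cast hN0
  have hM : ∀ M ∈ ({N, N - 2 * L₀} : Set ℕ), 0 < M ∧ M ≤ N ∧ N ≤ 2 * M := by
    rintro M (rfl | rfl) <;> omega
  have hK'0 : 0 ≤ K' := by rw [hK']; positivity
  have hnorm : ∀ j : Fin d → ℤ, j ∈ box ((4 * ν + 3) * N) (0 : Fin d → ℤ) ↔
      ‖j‖ ≤ (4 * ν + 3 : ℝ) * N := fun j => by
    have h1 := norm_le_iff_forall_abs (j := j) (r := (((4 * ν + 3) * N : ℕ) : ℤ)) (by positivity)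
    rw [mem_box]
    simp only [Pi.zero_apply, sub_zero]
    rw [← h1]
    push_cast
    rfl
  have hsub : Lam \ goodParams V L₀ τ ω ε g N ⊆ ⋃ p ∈ S, bad p := by
    rintro t ⟨ht, hn⟩
    have hn' : ¬ ∀ M ∈ ({N, N - 2 * L₀} : Set ℕ), ∀ j₀ : Fin d → ℤ, j₀ ∉ nearOrigin d L₀ M →
        CoveredByIntervals (badSet V τ ω ε g M j₀ t) (N ^ (2 * d + ν + 3)) ((N : ℝ) ^ (-τ)) :=
      fun h => hn ⟨ht, h⟩
    push Not at hn'
    obtain ⟨M, hMm, j₀, hj₀, hcov⟩ := hn'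
    obtain ⟨hM0, hMN, hNM⟩ := hM M hMm
    have hj : j₀ ∈ box ((4 * ν + 3) * N) (0 : Fin d → ℤ) := by
      rw [hnorm]
      by_contra! hfar
      exact hcov (coveredByIntervals_badSet_of_far V hτ hω hP hM0 hMN hNM hN hN2 hN3 hfar ht)
    refine Set.mem_biUnion (x := (M, j₀)) ?_ ⟨ht, hj₀, hcov⟩
    exact Finset.mem_coe.mpr (Finset.mem_product.mpr ⟨by simpa using hMm, hj⟩)
  have hone : ∀ p ∈ S, volume (bad p) ≤ ENNReal.ofReal (D / (N : ℝ) ^ (d + 1)) := by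
    rintro ⟨M, j₀⟩ hp
    obtain ⟨hp1, hp2⟩ := Finset.mem_product.mp hp
    obtain ⟨hM0, hMN, hNM⟩ := hM M (by simpa using hp1)
    by_cases hj₀ : j₀ ∈ nearOrigin d L₀ M
    · have : bad (M, j₀) = ∅ := Set.eq_empty_of_forall_notMem fun t ht => ht.2.1 hj₀
      rw [this, measure_empty]
      exact zero_le
    · refine (measure_mono ?_).trans (volume_not_coveredByIntervals_badSet_le hβ hL hτ hω hP hc
        hM0 hMN hNM hN (by positivity) hK' hj₀ ((hnorm j₀).mp hp2))
      rintro t ⟨ht, -, hcov⟩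
      exact ⟨ht, hcov⟩
  have hcard : (S.card : ℝ) ≤ 2 * ((8 * ν + 7) * N) ^ d := by
    have h1 : S.card ≤ 2 * ((8 * ν + 7) * N) ^ d := by
      rw [hS, Finset.card_product, card_box]
      refine Nat.mul_le_mul Finset.card_le_two (Nat.pow_le_pow_left ?_ d)
      nlinarith
    exact_mod_cast h1
  calc volume (Lam \ goodParams V L₀ τ ω ε g N) ≤ ∑ p ∈ S, volume (bad p) :=
        (measure_mono hsub).trans (measure_biUnion_finset_le _ _)
    _ ≤ ∑ _p ∈ S, ENNReal.ofReal (D / (N : ℝ) ^ (d + 1)) := Finset.sum_le_sum hone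
    _ = ENNReal.ofReal (S.card * (D / (N : ℝ) ^ (d + 1))) := by
        rw [Finset.sum_const, nsmul_eq_mul, ENNReal.ofReal_mul (by positivity),
          ENNReal.ofReal_natCast]
    _ ≤ ENNReal.ofReal (2 * ((8 * ν + 7) * N) ^ d * (D / (N : ℝ) ^ (d + 1))) := by
        exact ENNReal.ofReal_le_ofReal (by gcongr)
    _ = _ := by
        congr 1
        rw [mul_pow, pow_succ]
        field_simp

end Estimates

end

end QuasiPeriodicWave

theorem mainTheorem5 (d ν : ℕ) (hd : 1 ≤ d) (hν : 1 ≤ ν) (V : C(UnitAddTorus (Fin d), ℝ))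
    (hV : TrivialKernel V) (τ : ℝ) (hτ : (d : ℝ) + ν + 3 ≤ τ) :
    (∃ L₀ : ℕ, IsSpectralLength V L₀) ∧
    ∀ L₀ : ℕ, IsSpectralLength V L₀ →
      ∃ c : ℝ, 0 < c ∧ ∃ C : ℝ, 0 < C ∧ ∃ N₀ : ℕ,
        ∀ ω : Fin ν → ℝ, (∀ a, |ω a| ≤ 1) →
        ∀ ε₀ ε : ℝ, ε ∈ Set.Ico 0 ε₀ →
        ∀ g : ℝ → C(SpaceTime ν d, ℝ), ContDiffOn ℝ 1 g Lam →
          (∀ lam ∈ Lam, ENNReal.ofReal ε₀ *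
            (opNormInf (multMatrix (g lam)) + opNormInf (multMatrix (derivWithin g Lam lam)))
              ≤ ENNReal.ofReal c) →
        ∀ N : ℕ, N₀ ≤ N →
          volume (Lam \ goodParams V L₀ τ ω ε g N) ≤ ENNReal.ofReal (C * (N : ℝ)⁻¹) := by
  have hβ := gapConst_pos V hV
  have hτ0 : 0 ≤ τ := le_trans (by positivity) hτ
  refine ⟨exists_isSpectralLength V hV, fun L₀ hL => ⟨gapConst V / 80, by positivity, ?_⟩⟩
  obtain ⟨n, hn⟩ := exists_nat_ge (‖potentialOp V‖ + gapConst V / 80 + 1 + 2 ^ τ)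
  refine ⟨_, ?_, 4 * L₀ + n + 2 * 3 ^ (ν + d),
    fun ω hω ε₀ ε hε g hg hT N hN =>
      volume_diff_goodParams_le hβ hL hτ0 hω (perturbationBound hε (by positivity) hg hT)
        (by linarith) ?_ ?_ ?_ ?_ ?_ rfl⟩
  · positivity
  · have : 0 < 3 ^ (ν + d) := by positivity
    omega
  · omega
  all_goals
    first
      | omega
      | have hnN : (n : ℝ) ≤ N := by exact_mod_cast (by omega : n ≤ N)
        have h2 : (0 : ℝ) < 2 ^ τ := by positivity
        linarith [norm_nonneg (potentialOp V)]
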